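/- All graphs are simple, and all 2-coloured graphs have their vertices coloured red and blue; isomorphisms preserve colours. A countably infinite 2-coloured graph $G$ is called CUH if it is ultrahomogeneous (every isomorphism between finite induced subgraphs extends to an automorphism) and both colour classes induce disjoint unions of cliques; $\alpha_R,\alpha_B\in\mathbb N\cup\{\aleph_0\}$ denote the independence numbers of its red and blue part. A CUH graph is basic if $\min\{\alpha_R,\alpha_B\}\ge 2$ and it is not a blow-up, i.e. it does not arise from a 2-coloured graph $H$, one of whose colour classes is an independent set, by replacing all vertices of this class by cliques of a fixed size $i\in\{2,3,\dots\}\cup\{\aleph_0\}$ whose vertices are joined to the neighbours of the original vertex. For a 2-coloured graph $H$ let $\widetilde H$ arise from $H$ by complementing the edges between vertices of different colour. Let $T_r$ and $T_b$ be the triangles with exactly one blue and exactly one red vertex, respectively, and let $D$ be the complete graph on two red and two blue vertices with one red-blue edge deleted. A graph omits $H$ if $H$ is not isomorphic to an induced subgraph. Let $\mathcal C$ be the class of finite 2-coloured graphs whose colour classes induce disjoint unions of cliques. For every integer $k\ge 2$, the following are amalgamation classes (nonempty, closed under isomorphism and induced subgraphs, and with the amalgamation property): - the class of graphs in $\mathcal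 C$ that omit the red $\overline K_{k+1}$ and the blue $K_2$; its Fraïssé limit is denoted $F^{k}_{\aleph_0,1}$; - the class of graphs in $\mathcal C$ that omit the red $\overline K_{k+1}$, the blue $K_3$, $T_b$ and $\widetilde T_b$; limit $F^{k}_{\aleph_0,2}$; - the class of graphs in $\mathcal C$ that omit the red $K_3$, the blue $K_2$, $T_r$ and $\widetilde T_r$; limit $F_{2,1}$; - the class of graphs in $\mathcal C$ that omit the blue $K_2$; limit $F_{\aleph_0,1}$; - the class of graphs in $\mathcal C$ that omit the red $K_3$, the blue $K_3$, $T_r$, $\widetilde T_r$, $T_b$ and $\widetilde T_b$; limit $F_{2,2}$; - the class of graphs in $\mathcal C$ that omit the blue $K_3$, $T_b$ and $\widetilde T_b$; limit $F_{\aleph_0,2}$; - the class of graphs in $\mathcal C$ that omit $D$ and $\widetilde D$; limit $F_{\aleph_0,\aleph_0}$. Let $G$ be a basic CUH graph that omits $D$ or $\widetilde D$. Assume that $G$ is not one of the following graphs of Jenkinson et al.: the countable 2-coloured graphs in which both colour classes are independent sets and in which all or none of the possible red-blue edges are present, or the red-blue edges form a perfect matching or the complement of one, or the graph is the generic bipartite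 graph (for any finite disjoint sets $S,T$ of vertices of one colour there is a vertex of the other colour adjacent to all of $S$ and to none of $T$). Then, after possibly interchanging the two colours of $G$: (i) if $\alpha_R$ is finite, $G$ is isomorphic to $F^{\alpha_R}_{\aleph_0,1}$ or $F^{\alpha_R}_{\aleph_0,2}$; (ii) if $\alpha_R$ is infinite, $G$ is isomorphic to one of $F_{2,1}$, $F_{\aleph_0,1}$, $F_{2,2}$, $F_{\aleph_0,2}$, $F_{\aleph_0,\aleph_0}$. -/

import Mathlib

open FirstOrder CategoryTheory

/-- The two colours. -/
inductive Color : Type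
  | red : Color
  | blue : Color

namespace Color

/-- The other colour. -/
def other : Color → Color
  | red => blue
  | blue => red

end Color

/-- Relation symbols for 2-coloured graphs: adjacency and "is red".  (The blue vertices are the
vertices that are not red.) -/
inductive ColRel : ℕ → Type
  | adj : ColRel 2
  | isRed : ColRel 1

/-- The relational first-order language of 2-coloured graphs. -/
def colLang : FirstOrder.Language.{0, 0} := ⟨fun _ => Empty, ColRel⟩

instance colLang.instIsRelational : colLang.IsRelational :=
  fun _ => inferInstanceAs (IsEmpty Empty)

universe u v

/-- A 2-coloured graph: a simple graph with a map from its vertices to `{red, blue}`. -/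
structure TwoColGraph : Type (u + 1) where
  /-- the vertex set -/
  V : Type u
  /-- the graph -/
  graph : SimpleGraph V
  /-- the colouring of the vertices -/
  color : V → Color

namespace TwoColGraph

/-- A 2-coloured graph as a first-order structure.  Embeddings `↪[colLang]` are the isomorphisms
onto induced subgraphs, and `≃[colLang]` are the isomorphisms, of 2-coloured graphs. -/
instance instStructure (G : TwoColGraph.{u}) : colLang.Structure G.V where
  funMap f _ := nomatch f
  RelMap
    | .adj => fun x => G.graph.Adj (x 0) (x 1)
    | .isRed => fun x => G.color (x 0) = Color.red

/-- `H` is realized in `G`: it is isomorphic to an induced subgraph of `G`. -/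
def Realized (H : TwoColGraph.{v}) (G : TwoColGraph.{u}) : Prop :=
  Nonempty (H.V ↪[colLang] G.V)

/-- `H` is omitted in `G`. -/
def Omitted (H : TwoColGraph.{v}) (G : TwoColGraph.{u}) : Prop := ¬ Realized H G

/-- The graph obtained by interchanging the two colours. -/
def swap (G : TwoColGraph.{u}) : TwoColGraph.{u} where
  V := G.V
  graph := G.graph
  color x := (G.color x).other

/-- `G̃`: complement the cross edges and keep the edges within the colour classes. -/
def crossCompl (G : TwoColGraph.{u}) : TwoColGraph.{u} where
  V := G.V
  graph :=
    { Adj := fun x y => (G.color x = G.color y ∧ G.graph.Adj x y) ∨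
        (G.color x ≠ G.color y ∧ ¬ G.graph.Adj x y)
      symm := ⟨fun _ _ h => h.imp (fun h => ⟨h.1.symm, h.2.symm⟩)
        (fun h => ⟨h.1.symm, fun h' => h.2 h'.symm⟩)⟩
      loopless := ⟨fun _ h => h.elim (fun h => G.graph.irrefl h.2) (fun h => h.1 rfl)⟩ }
  color := G.color

/-- The vertices of colour `c` induce a disjoint union of cliques, i.e. on them the relation
"adjacent or equal" is transitive. -/
def ClassIsCliques (G : TwoColGraph.{u}) (c : Color) : Prop :=
  ∀ x y z : G.V, G.color x = c → G.color y = c → G.color z = c →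
    G.graph.Adj x y → G.graph.Adj y z → x ≠ z → G.graph.Adj x z

/-- The vertices of colour `c` form an independent set. -/
def ClassIsIndep (G : TwoColGraph.{u}) (c : Color) : Prop :=
  G.graph.IsIndepSet {x | G.color x = c}

/-- Independence number (in `ℕ ∪ {∞}`) of the subgraph induced by the vertices of colour `c`. -/
noncomputable def alpha (G : TwoColGraph.{u}) (c : Color) : ℕ∞ :=
  ⨆ s : {s : Finset G.V // (∀ x ∈ s, G.color x = c) ∧ G.graph.IsIndepSet (s : Set G.V)},
    (s.1.card : ℕ∞)

/-- Clique-ultrahomogeneous (CUH) graphs: countably infinite ultrahomogeneous 2-coloured graphs in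
which both colour classes induce disjoint unions of cliques. -/
structure IsCUH (G : TwoColGraph.{u}) : Prop where
  countable : Countable G.V
  infinite : Infinite G.V
  ultrahomogeneous : colLang.IsUltrahomogeneous G.V
  cliques : ∀ c, G.ClassIsCliques c

/-- The vertices of the blow-up of `H` at colour `c` by cliques indexed by `I`: `I` many copies of
each vertex of colour `c`, and one copy of each other vertex. -/
abbrev BlowUpVertex (H : TwoColGraph.{u}) (c : Color) (I : Type) : Type u :=
  ({x : H.V // H.color x = c} × I) ⊕ {x : H.V // H.color x ≠ c}

/-- The vertex of `H` that a vertex of the blow-up is a copy of. -/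
def blowUpBase (H : TwoColGraph.{u}) (c : Color) (I : Type) : H.BlowUpVertex c I → H.V
  | .inl p => p.1.1
  | .inr y => y.1

/-- Replace every vertex of colour `c` of `H` by a clique indexed by `I`. -/
def blowUp (H : TwoColGraph.{u}) (c : Color) (I : Type) : TwoColGraph.{u} where
  V := H.BlowUpVertex c I
  graph :=
    { Adj := fun x y => H.graph.Adj (H.blowUpBase c I x) (H.blowUpBase c I y) ∨
        (H.blowUpBase c I x = H.blowUpBase c I y ∧ x ≠ y)
      symm := ⟨fun _ _ h => h.imp (fun h => h.symm) (fun h => ⟨h.1.symm, h.2.symm⟩)⟩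
      loopless := ⟨fun _ h => h.elim (fun h => H.graph.irrefl h) (fun h => h.2 rfl)⟩ }
  color x := H.color (H.blowUpBase c I x)

/-- `G` is a blow-up: for some 2-coloured graph `H` with an independent colour class, `G` arises by
replacing the vertices in this class by cliques of one size in `{2, 3, …} ∪ {ℵ₀}`. -/
def IsBlowUp (G : TwoColGraph.{u}) : Prop :=
  ∃ (H : TwoColGraph.{u}) (c : Color) (I : Type), H.ClassIsIndep c ∧ Nontrivial I ∧ Countable I ∧
    Nonempty (G.V ≃[colLang] (H.blowUp c I).V)

/-- Basic CUH graphs. -/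
structure IsBasicCUH (G : TwoColGraph.{u}) : Prop extends IsCUH G where
  not_blowUp : ¬ G.IsBlowUp
  two_le_alpha : ∀ c, 2 ≤ G.alpha c

/-- All or none of the possible cross edges are present. -/
def IsHomogeneouslyConnected (G : TwoColGraph.{u}) : Prop :=
  (∀ x y, G.color x ≠ G.color y → G.graph.Adj x y) ∨
    (∀ x y, G.color x ≠ G.color y → ¬ G.graph.Adj x y)

/-- The cross edges form a perfect matching. -/
def CrossIsPerfectMatching (G : TwoColGraph.{u}) : Prop :=
  ∀ x, ∃! y, G.color x ≠ G.color y ∧ G.graph.Adj x y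

/-- For all finite disjoint sets `S`, `T` of vertices of one colour, there is a vertex of the other
colour that is adjacent to all vertices in `S` and to none in `T`. -/
def CrossIsGeneric (G : TwoColGraph.{u}) : Prop :=
  ∀ (c : Color) (S T : Finset G.V), Disjoint S T → (∀ x ∈ S, G.color x = c) →
    (∀ x ∈ T, G.color x = c) →
    ∃ y, G.color y ≠ c ∧ (∀ x ∈ S, G.graph.Adj y x) ∧ (∀ x ∈ T, ¬ G.graph.Adj y x)

/-- The bipartite graphs of the classification of Jenkinson, Seidel and Truss: both colour classes
are independent, and the graph is homogeneously connected, or its cross edges form a perfect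
matching or the complement of one, or it is the generic bipartite graph. -/
def IsJenkinsonBipartite (G : TwoColGraph.{u}) : Prop :=
  Countable G.V ∧ (∀ c, G.ClassIsIndep c) ∧
    (G.IsHomogeneouslyConnected ∨ G.CrossIsPerfectMatching ∨
      G.crossCompl.CrossIsPerfectMatching ∨ G.CrossIsGeneric)

/-- The monochromatic graph of colour `c` on a given uncoloured graph. -/
def mono {n : ℕ} (c : Color) (A : SimpleGraph (Fin n)) : TwoColGraph.{0} where
  V := Fin n
  graph := A
  color _ := c

/-- The monochromatic complete graph `K_n` of colour `c`. -/
def monoK (c : Color) (n : ℕ) : TwoColGraph.{0} := mono c (⊤ : SimpleGraph (Fin n))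

/-- The monochromatic edgeless graph on `n` vertices of colour `c`. -/
def monoKbar (c : Color) (n : ℕ) : TwoColGraph.{0} := mono c (⊥ : SimpleGraph (Fin n))

/-- A red `K_m` and a blue `K_n` with cross edges given by the relation `E`. -/
def twoCliques (m n : ℕ) (E : Fin m → Fin n → Prop) : TwoColGraph.{0} where
  V := Fin m ⊕ Fin n
  graph :=
    { Adj := fun x y => match x, y with
        | .inl i, .inl j => i ≠ j
        | .inr i, .inr j => i ≠ j
        | .inl i, .inr j => E i j
        | .inr j, .inl i => E i j
      symm := ⟨fun x y h => match x, y, h with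
        | .inl _, .inl _, h => Ne.symm h
        | .inr _, .inr _, h => Ne.symm h
        | .inl _, .inr _, h => h
        | .inr _, .inl _, h => h⟩
      loopless := ⟨fun x h => match x, h with
        | .inl _, h => h rfl
        | .inr _, h => h rfl⟩ }
  color x := match x with
    | .inl _ => Color.red
    | .inr _ => Color.blue

/-- The triangle with a single blue vertex. -/
def Tr : TwoColGraph.{0} := twoCliques 2 1 fun _ _ => True

/-- The triangle with a single red vertex. -/
def Tb : TwoColGraph.{0} := twoCliques 1 2 fun _ _ => True

/-- The complete graph on two red and two blue vertices with one cross edge deleted. -/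
def D : TwoColGraph.{0} := twoCliques 2 2 fun i j => ¬ (i = 1 ∧ j = 1)

/-- The class of the finite 2-coloured graphs (as first-order structures) in which both colour
classes form disjoint unions of cliques and which omit all graphs in `F`. -/
def classOmitting (F : Set TwoColGraph.{0}) : Set (Bundled.{u} colLang.Structure) :=
  {M | ∃ A : TwoColGraph.{u}, Finite A.V ∧ (∀ c, A.ClassIsCliques c) ∧ (∀ H ∈ F, Omitted H A) ∧
    Nonempty (M ≃[colLang] A.V)}

/-- `G` is a Fraïssé limit of the class `K`. -/
def IsLimitOf (G : TwoColGraph.{u}) (K : Set (Bundled.{u} colLang.Structure)) : Prop :=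
  ∃ _ : Countable G.V, FirstOrder.Language.IsFraisseLimit K G.V

/-- The class with limit `F_{ℵ₀,1}^k`. -/
def classInfOneFin (k : ℕ) : Set (Bundled.{u} colLang.Structure) :=
  classOmitting {monoKbar .red (k + 1), monoK .blue 2}

/-- The class with limit `F_{ℵ₀,2}^k`. -/
def classInfTwoFin (k : ℕ) : Set (Bundled.{u} colLang.Structure) :=
  classOmitting {monoKbar .red (k + 1), monoK .blue 3, Tb, Tb.crossCompl}

/-- The class with limit `F_{2,1}`. -/
def classTwoOne : Set (Bundled.{u} colLang.Structure) :=
  classOmitting {monoK .red 3, monoK .blue 2, Tr, Tr.crossCompl}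

/-- The class with limit `F_{ℵ₀,1}`. -/
def classInfOne : Set (Bundled.{u} colLang.Structure) :=
  classOmitting {monoK .blue 2}

/-- The class with limit `F_{2,2}`. -/
def classTwoTwo : Set (Bundled.{u} colLang.Structure) :=
  classOmitting {monoK .red 3, monoK .blue 3, Tr, Tr.crossCompl, Tb, Tb.crossCompl}

/-- The class with limit `F_{ℵ₀,2}`. -/
def classInfTwo : Set (Bundled.{u} colLang.Structure) :=
  classOmitting {monoK .blue 3, Tb, Tb.crossCompl}

/-- The class with limit `F_{ℵ₀,ℵ₀}`. -/
def classInfInf : Set (Bundled.{u} colLang.Structure) :=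
  classOmitting {D, D.crossCompl}

end TwoColGraph

/-!
All classes in the theorem have a common description (`InClass`): both colour classes are disjoint
unions of cliques; the cliques of each colour are single vertices, or have at most two vertices, or
are unrestricted; the number of cliques may be bounded for one colour; every `2 × 2` pattern of
cross edges between two cliques has an even number of edges; and in a colour whose cliques have at
most two vertices, the two vertices of a clique have complementary neighbourhoods in the other
colour class. The forbidden subgraphs are translated into these conditions, `D` and its cross
complement together being the parity condition (`crossParity_iff_omitted`).

*Amalgamation.* By induction it is enough to add a single vertex `x` of `B` to `C`
(`InClass.extendsTo`). If `x` belongs to a clique that is present in `C`, parity determines its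
cross edges up to a global switch on each clique of the other colour; otherwise `x` forms a new
clique, or joins an existing one when the number of cliques is bounded. In either case the
prescribed values on the common part extend consistently to all of `C`
(`InClass.exists_interpolation`).

*Structure of the given graph.* A basic CUH graph `G` has no adjacent twins: if one edge within a
colour class had ends with the same cross neighbours, then by homogeneity all edges of this colour
would, and `G` would be a blow-up (`Homogeneous.isBlowUp`). So every edge within a colour class is
separated by some vertex of the other colour. If both colour classes are independent, then `G` is
one of the bipartite graphs that are excluded (`IsReduced.isJenkinsonBipartite`). Otherwise,
omitting `D` or its cross complement says that no `2 × 2` pattern has exactly three edges (or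
exactly three non-edges), and homogeneity then rules out exactly one as well
(`IsReduced.crossParity_of_omitted`).

*Identification.* In a colour without triangles, adjacent vertices have complementary cross
neighbourhoods (`IsReduced.sizeCondition_two`), and if one colour has only finitely many cliques,
then the other colour has infinitely many cliques, none with three vertices
(`IsReduced.not_hasTriangle`). So `G` belongs to one of the classes after a choice of colours. In a
clique with three vertices, every pattern over an edge occurs in infinitely many cliques of the
other colour, if there are that many (`IsReduced.meetsMany_of_hasTriangle`); together with parity
this realizes every neighbourhood over a finite set that the class permits
(`IsReduced.exists_realization`), and the colours without triangles can be handled by moving the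
finite set (`IsRich.exists_realization_of_small`). These facts give the extension property
(`IsRich.exists_extension`). Hence every finite member of the class embeds in `G`, and `G` is its
Fraïssé limit (`IsRich.isLimitOf`).
-/

theorem Color.eq_of_ne_of_ne {a b c : Color} (h : a ≠ c) (h' : b ≠ c) : a = b := by
  cases a <;> cases b <;> cases c <;> simp_all

theorem Color.eq_or_eq {c d : Color} (h : c ≠ d) (a : Color) : a = c ∨ a = d := by
  cases a <;> cases c <;> cases d <;> simp_all

namespace TwoColGraph

/-! ### Cliques, partial embeddings, automorphisms -/

/-- Two vertices of the same colour lie in the same clique: they are equal or adjacent.  This is an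
equivalence relation as soon as both colour classes are disjoint unions of cliques. -/
def Sim (G : TwoColGraph.{u}) (x y : G.V) : Prop :=
  G.color x = G.color y ∧ (x = y ∨ G.graph.Adj x y)

section Sim

variable {G : TwoColGraph.{u}}

theorem Sim.color_eq {x y : G.V} (h : G.Sim x y) : G.color x = G.color y := h.1

theorem Sim.refl (x : G.V) : G.Sim x x := ⟨rfl, Or.inl rfl⟩

theorem Sim.symm {x y : G.V} (h : G.Sim x y) : G.Sim y x :=
  ⟨h.1.symm, h.2.imp Eq.symm SimpleGraph.Adj.symm⟩

theorem sim_comm {x y : G.V} : G.Sim x y ↔ G.Sim y x := ⟨Sim.symm, Sim.symm⟩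

theorem Sim.trans (hG : ∀ c, G.ClassIsCliques c) {x y z : G.V} (h : G.Sim x y) (h' : G.Sim y z) :
    G.Sim x z := by
  refine ⟨h.1.trans h'.1, ?_⟩
  rcases h with ⟨hc, rfl | h⟩
  · exact h'.2
  rcases h' with ⟨hc', rfl | h'⟩
  · exact Or.inr h
  by_cases hxz : x = z
  · exact Or.inl hxz
  · exact Or.inr (hG _ x y z rfl hc.symm (hc.trans hc').symm h h' hxz)

theorem adj_iff_sim {x y : G.V} (h : G.color x = G.color y) :
    G.graph.Adj x y ↔ G.Sim x y ∧ x ≠ y := by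
  constructor
  · exact fun hxy => ⟨⟨h, Or.inr hxy⟩, hxy.ne⟩
  · rintro ⟨⟨-, rfl | h⟩, hne⟩
    · exact absurd rfl hne
    · exact h

theorem classIsCliques_of_trans (h : ∀ x y z : G.V, G.Sim x y → G.Sim y z → G.Sim x z) (c : Color) :
    G.ClassIsCliques c := fun x y z hx hy hz hxy hyz hxz =>
  ((adj_iff_sim (hx.trans hz.symm)).2 ⟨h x y z ⟨hx.trans hy.symm, Or.inr hxy⟩
    ⟨hy.trans hz.symm, Or.inr hyz⟩, hxz⟩)

end Sim

/-- `f` is an isomorphism from the subgraph of `A` induced by `s` onto an induced subgraph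
of `B`. -/
structure IsEmbOn (A : TwoColGraph.{u}) (B : TwoColGraph.{v}) (s : Set A.V) (f : A.V → B.V) :
    Prop where
  inj : Set.InjOn f s
  color : ∀ x ∈ s, B.color (f x) = A.color x
  adj : ∀ x ∈ s, ∀ y ∈ s, (B.graph.Adj (f x) (f y) ↔ A.graph.Adj x y)

section IsEmbOn

universe w

variable {A : TwoColGraph.{u}} {B : TwoColGraph.{v}} {C : TwoColGraph.{w}} {s : Set A.V}
  {f : A.V → B.V}

theorem IsEmbOn.mono (h : IsEmbOn A B s f) {t : Set A.V} (hts : t ⊆ s) : IsEmbOn A B t f :=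
  ⟨h.inj.mono hts, fun x hx => h.color x (hts hx), fun x hx y hy => h.adj x (hts hx) y (hts hy)⟩

theorem IsEmbOn.sim_iff (h : IsEmbOn A B s f) {x y : A.V} (hx : x ∈ s) (hy : y ∈ s) :
    B.Sim (f x) (f y) ↔ A.Sim x y := by
  unfold Sim
  rw [h.color x hx, h.color y hy, h.adj x hx y hy, h.inj.eq_iff hx hy]

theorem IsEmbOn.comp {t : Set B.V} {g : B.V → C.V} (hg : IsEmbOn B C t g) (hf : IsEmbOn A B s f)
    (hst : Set.MapsTo f s t) : IsEmbOn A C s (g ∘ f) where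
  inj := hg.inj.comp hf.inj hst
  color x hx := (hg.color _ (hst hx)).trans (hf.color x hx)
  adj x hx y hy := (hg.adj _ (hst hx) _ (hst hy)).trans (hf.adj x hx y hy)

/-- Extending a partial embedding by one vertex. -/
theorem IsEmbOn.insert [DecidableEq A.V] (h : IsEmbOn A B s f) {x : A.V} (hx : x ∉ s) {v : B.V}
    (hc : B.color v = A.color x)
    (hv : ∀ y ∈ s, f y ≠ v ∧ (B.graph.Adj (f y) v ↔ A.graph.Adj y x)) :
    IsEmbOn A B (insert x s) (Function.update f x v) := by
  have hne : ∀ y ∈ s, y ≠ x := fun y hy hyx => hx (hyx ▸ hy)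
  refine ⟨?_, ?_, ?_⟩
  · rintro y (rfl | hy) z (rfl | hz) hyz
    · rfl
    · rw [Function.update_self, Function.update_of_ne (hne z hz)] at hyz
      exact absurd hyz.symm (hv z hz).1
    · rw [Function.update_self, Function.update_of_ne (hne y hy)] at hyz
      exact absurd hyz (hv y hy).1
    · rw [Function.update_of_ne (hne y hy), Function.update_of_ne (hne z hz)] at hyz
      exact h.inj hy hz hyz
  · rintro y (rfl | hy)
    · rwa [Function.update_self]
    · rw [Function.update_of_ne (hne y hy), h.color y hy]
  · rintro y (rfl | hy) z (rfl | hz)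
    · simp
    · rw [Function.update_self, Function.update_of_ne (hne z hz), SimpleGraph.adj_comm,
        (hv z hz).2, SimpleGraph.adj_comm]
    · rw [Function.update_self, Function.update_of_ne (hne y hy), (hv y hy).2]
    · rw [Function.update_of_ne (hne y hy), Function.update_of_ne (hne z hz), h.adj y hy z hz]

/-- A globally defined embedding of 2-coloured graphs as an embedding of first-order structures. -/
def IsEmbOn.toEmbedding (h : IsEmbOn A B Set.univ f) : A.V ↪[colLang] B.V where
  toFun := f
  inj' := Set.injOn_univ.1 h.inj
  map_fun' g := nomatch g
  map_rel' r x := by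
    cases r with
    | adj => exact h.adj _ trivial _ trivial
    | isRed =>
      change B.color (f (x 0)) = _ ↔ A.color (x 0) = _
      rw [h.color _ trivial]

theorem color_eq_of_red_iff {a b : Color} (h : a = Color.red ↔ b = Color.red) : a = b := by
  cases a <;> cases b <;> simp_all

theorem isEmbOn_embedding (φ : A.V ↪[colLang] B.V) : IsEmbOn A B Set.univ φ where
  inj := φ.injective.injOn
  color x _ := color_eq_of_red_iff (φ.map_rel (show colLang.Relations 1 from ColRel.isRed) ![x])
  adj x _ y _ := φ.map_rel (show colLang.Relations 2 from ColRel.adj) ![x, y]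

theorem realized_iff : Realized A B ↔ ∃ f : A.V → B.V, IsEmbOn A B Set.univ f :=
  ⟨fun ⟨φ⟩ => ⟨φ, isEmbOn_embedding φ⟩, fun ⟨_, h⟩ => ⟨h.toEmbedding⟩⟩

/-- A bijective embedding of 2-coloured graphs as an isomorphism of first-order structures. -/
noncomputable def equivOfIsEmbOn (e : A.V ≃ B.V) (h : IsEmbOn A B Set.univ e) :
    A.V ≃[colLang] B.V where
  toEquiv := e
  map_fun' := h.toEmbedding.map_fun'
  map_rel' := h.toEmbedding.map_rel'

end IsEmbOn

/-- The 2-coloured graph on `W` pulled back from `G` along an injection. -/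
def comap (G : TwoColGraph.{u}) {W : Type v} (f : W ↪ G.V) : TwoColGraph.{v} where
  V := W
  graph := G.graph.comap f
  color := G.color ∘ f

theorem isEmbOn_comap (G : TwoColGraph.{u}) {W : Type v} (f : W ↪ G.V) :
    IsEmbOn (G.comap f) G Set.univ f :=
  ⟨f.injective.injOn, fun _ _ => rfl, fun _ _ _ _ => Iff.rfl⟩

/-- Every structure that embeds in a 2-coloured graph is a 2-coloured graph. -/
noncomputable def equivComap (G : TwoColGraph.{u}) {M : Type v} [colLang.Structure M]
    (φ : M ↪[colLang] G.V) : M ≃[colLang] (G.comap φ.toEmbedding).V where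
  toEquiv := Equiv.refl M
  map_fun' g := nomatch g
  map_rel' r x := by
    rw [← φ.map_rel]
    cases r <;> exact Iff.rfl

/-- A colour-preserving automorphism. -/
structure IsAut (G : TwoColGraph.{u}) (g : G.V ≃ G.V) : Prop where
  color : ∀ x, G.color (g x) = G.color x
  adj : ∀ x y, G.graph.Adj (g x) (g y) ↔ G.graph.Adj x y

/-- Ultrahomogeneity, phrased with partial maps on finite sets of vertices. -/
def Homogeneous (G : TwoColGraph.{u}) : Prop :=
  ∀ (s : Finset G.V) (f : G.V → G.V), IsEmbOn G G s f → ∃ g : G.V ≃ G.V, G.IsAut g ∧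
    ∀ x ∈ s, g x = f x

theorem IsAut.sim_iff {G : TwoColGraph.{u}} {g : G.V ≃ G.V} (hg : G.IsAut g) (x y : G.V) :
    G.Sim (g x) (g y) ↔ G.Sim x y := by
  unfold Sim
  rw [hg.color, hg.color, hg.adj, g.apply_eq_iff_eq]

theorem IsAut.adj_of_eq {G : TwoColGraph.{u}} {g : G.V ≃ G.V} (hg : G.IsAut g) {x y x' y' : G.V}
    (hx : g x = x') (hy : g y = y') : G.graph.Adj x' y' ↔ G.graph.Adj x y := by
  rw [← hx, ← hy, hg.adj]

theorem IsAut.sim_of_eq {G : TwoColGraph.{u}} {g : G.V ≃ G.V} (hg : G.IsAut g) {x y x' y' : G.V}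
    (hx : g x = x') (hy : g y = y') : G.Sim x' y' ↔ G.Sim x y := by
  rw [← hx, ← hy, hg.sim_iff]

theorem IsAut.symm {G : TwoColGraph.{u}} {g : G.V ≃ G.V} (hg : G.IsAut g) : G.IsAut g.symm where
  color x := by rw [← hg.color, g.apply_symm_apply]
  adj x y := by rw [← hg.adj, g.apply_symm_apply, g.apply_symm_apply]

theorem homogeneous_iff (G : TwoColGraph.{u}) :
    colLang.IsUltrahomogeneous G.V ↔ G.Homogeneous := by
  classical
  constructor
  · intro h s f hf
    let S : colLang.Substructure G.V := ⟨s, fun {n} g => nomatch g⟩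
    have hS : S.FG := Language.Substructure.fg_iff_finite.2 (s.finite_toSet.to_subtype)
    let φ : S ↪[colLang] G.V :=
      { toFun := fun x => f x
        inj' := fun x y hxy => Subtype.ext (hf.inj x.2 y.2 hxy)
        map_fun' := fun g => nomatch g
        map_rel' := fun r x => by
          cases r with
          | adj => exact hf.adj _ (x 0).2 _ (x 1).2
          | isRed =>
            change G.color (f (x 0)) = _ ↔ G.color (x 0) = _
            rw [hf.color _ (x 0).2] }
    obtain ⟨g, hg⟩ := h S hS φ
    have hg' := isEmbOn_embedding (A := G) (B := G) g.toEmbedding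
    refine ⟨g.toEquiv, ⟨fun x => hg'.color x trivial, fun x y => hg'.adj x trivial y trivial⟩,
      fun x hx => ?_⟩
    exact (congrArg (fun ψ : S ↪[colLang] G.V => ψ ⟨x, hx⟩) hg).symm
  · intro h S hS φ
    have : Finite S := Language.Substructure.fg_iff_finite.1 hS
    have hfin : (S : Set G.V).Finite := this
    let f : G.V → G.V := fun x => if hx : x ∈ S then φ ⟨x, hx⟩ else x
    have hf : ∀ x (hx : x ∈ S), f x = φ ⟨x, hx⟩ := fun x hx => dif_pos hx
    obtain ⟨g, hg, hgf⟩ := h hfin.toFinset f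
      { inj := by
          intro x hx y hy hxy
          rw [Set.Finite.coe_toFinset] at hx hy
          rw [hf x hx, hf y hy] at hxy
          exact congrArg Subtype.val (φ.injective hxy)
        color := by
          intro x hx
          rw [Set.Finite.coe_toFinset] at hx
          rw [hf x hx]
          exact color_eq_of_red_iff
            (φ.map_rel (show colLang.Relations 1 from ColRel.isRed) ![⟨x, hx⟩])
        adj := by
          intro x hx y hy
          rw [Set.Finite.coe_toFinset] at hx hy
          rw [hf x hx, hf y hy]
          exact φ.map_rel (show colLang.Relations 2 from ColRel.adj) ![⟨x, hx⟩, ⟨y, hy⟩] }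
    refine ⟨equivOfIsEmbOn g ⟨g.injective.injOn, fun x _ => hg.color x,
      fun x _ y _ => hg.adj x y⟩, ?_⟩
    ext x
    rw [← hf x x.2]
    exact (hgf x (hfin.mem_toFinset.2 x.2)).symm

end TwoColGraph

namespace TwoColGraph

/-! ### Classes described by clique sizes -/

/-- The three possible bounds on the size of the cliques of one colour: `many` stands for no
bound. -/
inductive CliqueSize : Type
  | one : CliqueSize
  | two : CliqueSize
  | many : CliqueSize

/-- The 2-coloured graphs whose colour classes are disjoint unions of cliques, with the size of the
cliques of colour `c` bounded by `s c` and their number bounded by `κ c`, subject to the following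
conditions.  Between two cliques of different colours every `2 × 2` pattern has an even number of
edges, and if `s c` is `two`, then the two vertices of a clique of colour `c` have complementary
neighbourhoods in the other colour class.  All classes in the classification are of this form. -/
structure InClass (s : Color → CliqueSize) (κ : Color → ℕ∞) (A : TwoColGraph.{u}) : Prop where
  cliques : ∀ c, A.ClassIsCliques c
  parity : ∀ {x x' y y' : A.V}, A.Sim x x' → A.Sim y y' → A.color x ≠ A.color y →
    ((A.graph.Adj x y ↔ A.graph.Adj x' y) ↔ (A.graph.Adj x y' ↔ A.graph.Adj x' y'))
  one : ∀ {x y : A.V}, s (A.color x) = .one → A.Sim x y → x = y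
  two : ∀ {x y z : A.V}, s (A.color x) = .two → A.Sim x y → A.Sim x z → x = y ∨ x = z ∨ y = z
  mates : ∀ {x y z : A.V}, s (A.color x) = .two → A.Sim x y → x ≠ y → A.color z ≠ A.color x →
    (A.graph.Adj x z ↔ ¬ A.graph.Adj y z)
  bound : ∀ (c : Color) (t : Finset A.V), (∀ x ∈ t, A.color x = c) →
    (∀ x ∈ t, ∀ y ∈ t, A.Sim x y → x = y) → (t.card : ℕ∞) ≤ κ c

/-- The number of cliques of one colour may be bounded only if the cliques of this colour can be
large and those of the other colour cannot. -/
def Admissible (s : Color → CliqueSize) (κ : Color → ℕ∞) : Prop :=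
  ∀ c d, c ≠ d → κ c ≠ ⊤ → s c = .many ∧ s d ≠ .many

variable {s : Color → CliqueSize} {κ : Color → ℕ∞}

theorem InClass.sim_trans {A : TwoColGraph.{u}} (hA : InClass s κ A) {x y z : A.V}
    (h : A.Sim x y) (h' : A.Sim y z) : A.Sim x z := h.trans hA.cliques h'

/-- The classes are closed under induced subgraphs. -/
theorem InClass.of_isEmbOn {A : TwoColGraph.{u}} {B : TwoColGraph.{v}} (hB : InClass s κ B)
    {f : A.V → B.V} (hf : IsEmbOn A B Set.univ f) : InClass s κ A := by
  have hs : ∀ x y, A.Sim x y ↔ B.Sim (f x) (f y) := fun x y => (hf.sim_iff trivial trivial).symm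
  have hc : ∀ x, A.color x = B.color (f x) := fun x => (hf.color x trivial).symm
  have ha : ∀ x y, A.graph.Adj x y ↔ B.graph.Adj (f x) (f y) :=
    fun x y => (hf.adj x trivial y trivial).symm
  have hi : Function.Injective f := Set.injOn_univ.1 hf.inj
  refine ⟨classIsCliques_of_trans fun x y z hxy hyz => ?_, ?_, ?_, ?_, ?_, ?_⟩
  · rw [hs] at *
    exact hB.sim_trans hxy hyz
  · intro x x' y y' hx hy hxy
    simp only [hs, ha, hc] at *
    exact hB.parity hx hy hxy
  · intro x y h hxy
    simp only [hs, hc] at *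
    exact hi (hB.one h hxy)
  · intro x y z h hxy hxz
    simp only [hs, hc, ← hi.eq_iff] at *
    exact hB.two h hxy hxz
  · intro x y z h hxy hne hz
    simp only [hs, hc, ha] at *
    exact hB.mates h hxy (hi.ne hne) hz
  · intro c t ht hind
    have := hB.bound c (t.map ⟨f, hi⟩) (by simpa [← hc] using ht) (by
      simp only [Finset.mem_map, Function.Embedding.coeFn_mk]
      rintro _ ⟨x, hx, rfl⟩ _ ⟨y, hy, rfl⟩ h
      rw [hind x hx y hy ((hs x y).2 h)])
    simpa using this

/-! ### Adding a vertex -/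

theorem parity_comm {p q r t : Prop} : ((p ↔ q) ↔ (r ↔ t)) ↔ ((p ↔ r) ↔ (q ↔ t)) := by
  by_cases p <;> by_cases q <;> by_cases r <;> by_cases t <;> simp_all

theorem parity_swap {p q r t : Prop} : ((p ↔ q) ↔ (r ↔ t)) ↔ ((q ↔ p) ↔ (t ↔ r)) := by
  rw [iff_comm (a := p), iff_comm (a := r)]

/-- `C` together with a new vertex `none` of colour `c` that is adjacent to the vertices
in `N`. -/
def addPoint (C : TwoColGraph.{u}) (c : Color) (N : C.V → Prop) : TwoColGraph.{u} where
  V := Option C.V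
  graph :=
    { Adj := fun x y => match x, y with
        | some a, some b => C.graph.Adj a b
        | none, some b => N b
        | some a, none => N a
        | none, none => False
      symm := ⟨fun x y h => match x, y, h with
        | some _, some _, h => SimpleGraph.Adj.symm h
        | none, some _, h => h
        | some _, none, h => h⟩
      loopless := ⟨fun x h => match x, h with
        | some _, h => C.graph.irrefl h⟩ }
  color x := match x with
    | some a => C.color a
    | none => c

section addPoint

variable {C : TwoColGraph.{u}} {c : Color} {N : C.V → Prop}

theorem addPoint_sim_some {a b : C.V} :
    (C.addPoint c N).Sim (some a : Option C.V) (some b : Option C.V) ↔ C.Sim a b := by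
  unfold Sim
  exact and_congr Iff.rfl (or_congr Option.some_inj Iff.rfl)

theorem addPoint_sim_none {b : C.V} :
    (C.addPoint c N).Sim (none : Option C.V) (some b : Option C.V) ↔ C.color b = c ∧ N b := by
  unfold Sim
  refine and_congr eq_comm ⟨fun h => h.resolve_left (fun h => Option.noConfusion rfl (heq_of_eq h)), Or.inr⟩

theorem card_of_none_mem {α : Type*} {t : Finset (Option α)} (hn : none ∈ t) :
    t.card = (Finset.eraseNone t).card + 1 := by
  classical
  rw [← Finset.card_insertNone, Finset.insertNone_eraseNone, Finset.insert_eq_of_mem hn]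

theorem card_of_none_notMem {α : Type*} {t : Finset (Option α)} (hn : none ∉ t) :
    t.card = (Finset.eraseNone t).card := by
  classical
  exact (congrArg Finset.card ((Finset.map_some_eraseNone t).trans
    (Finset.erase_eq_of_notMem hn))).symm.trans (Finset.card_map _)

theorem inClass_addPoint (hC : InClass s κ C)
    (hsim : ∀ a, C.color a = c → N a → ∀ b, C.color b = c → (N b ↔ C.Sim a b))
    (hpar : ∀ a y y', C.color a = c → N a → C.color y ≠ c → C.Sim y y' →
      ((N y ↔ N y') ↔ (C.graph.Adj a y ↔ C.graph.Adj a y')))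
    (hone : s c = .one → ∀ a, C.color a = c → ¬ N a)
    (htwo : s c = .two → ∀ a, C.color a = c → N a → (∀ b, C.Sim a b → a = b) ∧
      ∀ y, C.color y ≠ c → (N y ↔ ¬ C.graph.Adj a y))
    (hmates : ∀ y y', C.color y ≠ c → s (C.color y) = .two → C.Sim y y' → y ≠ y' →
      (N y ↔ ¬ N y'))
    (hbound : (∀ a, C.color a = c → ¬ N a) → ∀ t : Finset C.V, (∀ x ∈ t, C.color x = c) →
      (∀ x ∈ t, ∀ y ∈ t, C.Sim x y → x = y) → (t.card : ℕ∞) + 1 ≤ κ c) :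
    InClass s κ (C.addPoint c N) := by
  classical
  have hsn : ∀ {b : C.V}, (C.addPoint c N).Sim (some b : Option C.V) (none : Option C.V) ↔
      C.color b = c ∧ N b := fun {b} => sim_comm.trans addPoint_sim_none
  refine ⟨classIsCliques_of_trans ?_, ?_, ?_, ?_, ?_, ?_⟩
  · rintro (_ | x) (_ | y) (_ | z) hxy hyz
    · exact Sim.refl _
    · exact hyz
    · exact Sim.refl _
    · rw [addPoint_sim_none, addPoint_sim_some] at *
      have hz := hyz.1.symm.trans hxy.1
      exact ⟨hz, (hsim y hxy.1 hxy.2 z hz).2 hyz⟩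
    · exact hxy
    · rw [hsn] at hxy
      rw [addPoint_sim_none] at hyz
      rw [addPoint_sim_some]
      exact (hsim x hxy.1 hxy.2 z hyz.1).1 hyz.2
    · rw [hsn, addPoint_sim_some] at *
      have hx := hxy.1.trans hyz.1
      exact ⟨hx, (hsim y hyz.1 hyz.2 x hx).2 hxy.symm⟩
    · rw [addPoint_sim_some] at *
      exact hC.sim_trans hxy hyz
  · -- the colour of `none` may be assumed to be that of `x`
    have key : ∀ x x' y y' : Option C.V, (C.addPoint c N).Sim x x' → (C.addPoint c N).Sim y y' →
        (C.addPoint c N).color x = c → (C.addPoint c N).color y ≠ c →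
        (((C.addPoint c N).graph.Adj x y ↔ (C.addPoint c N).graph.Adj x' y) ↔
          ((C.addPoint c N).graph.Adj x y' ↔ (C.addPoint c N).graph.Adj x' y')) := by
      rintro x x' (_ | y) (_ | y') hx hy hxc hyc
      · exact absurd rfl hyc
      · exact absurd rfl hyc
      · exact absurd (hy.1.trans rfl) hyc
      rw [addPoint_sim_some] at hy
      rcases x with _ | x <;> rcases x' with _ | x'
      · simp
      · rw [addPoint_sim_none] at hx
        exact parity_comm.1 (hpar x' y y' hx.1 hx.2 hyc hy)
      · rw [hsn] at hx
        exact parity_swap.1 (parity_comm.1 (hpar x y y' hx.1 hx.2 hyc hy))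
      · rw [addPoint_sim_some] at hx
        exact hC.parity hx hy (fun h => hyc (h.symm.trans hxc))
    intro x x' y y' hx hy hxy
    by_cases hxc : (C.addPoint c N).color x = c
    · exact key x x' y y' hx hy hxc (fun h => hxy (hxc.trans h.symm))
    by_cases hyc : (C.addPoint c N).color y = c
    · have := key y y' x x' hy hx hyc hxc
      rw [SimpleGraph.adj_comm _ x y, SimpleGraph.adj_comm _ x' y, SimpleGraph.adj_comm _ x y',
        SimpleGraph.adj_comm _ x' y']
      exact parity_comm.1 this
    · exact absurd (Color.eq_of_ne_of_ne hxc hyc) hxy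
  · rintro (_ | x) (_ | y) h hxy
    · rfl
    · rw [addPoint_sim_none] at hxy
      exact absurd hxy.2 (hone h y hxy.1)
    · rw [hsn] at hxy
      refine absurd hxy.2 (hone ?_ x hxy.1)
      rw [← hxy.1]; exact h
    · rw [addPoint_sim_some] at hxy
      exact congrArg some (hC.one h hxy)
  · rintro (_ | x) (_ | y) (_ | z) h hxy hxz
    · exact Or.inl rfl
    · exact Or.inl rfl
    · exact Or.inr (Or.inl rfl)
    · rw [addPoint_sim_none] at hxy hxz
      exact Or.inr (Or.inr (congrArg some
        ((htwo h y hxy.1 hxy.2).1 z ((hsim y hxy.1 hxy.2 z hxz.1).1 hxz.2))))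
    · exact Or.inr (Or.inr rfl)
    · rw [hsn] at hxy
      rw [addPoint_sim_some] at hxz
      exact Or.inr (Or.inl (congrArg some ((htwo (hxy.1 ▸ h) x hxy.1 hxy.2).1 z hxz)))
    · rw [hsn] at hxz
      rw [addPoint_sim_some] at hxy
      exact Or.inl (congrArg some ((htwo (hxz.1 ▸ h) x hxz.1 hxz.2).1 y hxy))
    · rw [addPoint_sim_some] at hxy hxz
      exact (hC.two h hxy hxz).imp (congrArg some) (Or.imp (congrArg some) (congrArg some))
  · rintro (_ | x) (_ | y) (_ | z) h hxy hne hz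
    · exact absurd rfl hz
    · exact absurd rfl hne
    · exact absurd rfl hz
    · rw [addPoint_sim_none] at hxy
      exact (htwo h y hxy.1 hxy.2).2 z hz
    · exact absurd (hxy.1.symm) hz
    · rw [hsn] at hxy
      have hz' : C.color z ≠ c := fun h => hz (h.trans hxy.1.symm)
      have := (htwo (hxy.1 ▸ h) x hxy.1 hxy.2).2 z hz'
      exact iff_not_comm.1 this
    · rw [addPoint_sim_some] at hxy
      exact hmates x y (Ne.symm hz) h hxy (fun h => hne (congrArg some h))
    · rw [addPoint_sim_some] at hxy
      exact hC.mates h hxy (fun h => hne (congrArg some h)) hz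
  · intro c' t ht hind
    set t' : Finset C.V := Finset.eraseNone t with ht'
    have hmem : ∀ a, a ∈ t' ↔ (some a : Option C.V) ∈ t := fun a => by
      rw [ht']; exact Finset.mem_eraseNone
    have htc : ∀ x ∈ t', C.color x = c' := fun x hx => ht _ ((hmem x).1 hx)
    have hti : ∀ x ∈ t', ∀ y ∈ t', C.Sim x y → x = y := fun x hx y hy hxy =>
      Option.some_inj.1 (hind _ ((hmem x).1 hx) _ ((hmem y).1 hy) (addPoint_sim_some.2 hxy))
    by_cases hn : (none : Option C.V) ∈ t
    · have hcc : c = c' := ht _ hn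
      subst hcc
      have hcard : t.card = t'.card + 1 := card_of_none_mem hn
      by_cases hN : ∃ a, C.color a = c ∧ N a
      · obtain ⟨a, hac, ha⟩ := hN
        -- `a` takes the place of `none`
        have hdis : ∀ x ∈ t', ¬ C.Sim a x := fun x hx hax => by
          have := hind _ hn _ ((hmem x).1 hx) (addPoint_sim_none.2
            ⟨htc x hx, (hsim a hac ha x (htc x hx)).2 hax⟩)
          exact Option.noConfusion rfl (heq_of_eq this)
        have hat : a ∉ t' := fun h => hdis a h (Sim.refl a)
        have := hC.bound c (insert a t') (by
          intro x hx
          rcases Finset.mem_insert.1 hx with rfl | hx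
          exacts [hac, htc x hx]) (by
          intro x hx y hy hxy
          rcases Finset.mem_insert.1 hx with rfl | hx' <;>
            rcases Finset.mem_insert.1 hy with rfl | hy'
          · rfl
          · exact absurd hxy (hdis y hy')
          · exact absurd hxy.symm (hdis x hx')
          · exact hti x hx' y hy' hxy)
        rwa [Finset.card_insert_of_notMem hat, ← hcard] at this
      · push Not at hN
        have := hbound hN t' htc hti
        rw [hcard]
        exact_mod_cast this
    · have hcard : t.card = t'.card := card_of_none_notMem hn
      rw [hcard]
      exact hC.bound c' t' htc hti

end addPoint
end TwoColGraph

namespace TwoColGraph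

variable {s : Color → CliqueSize} {κ : Color → ℕ∞}

/-! ### Amalgamation -/

/-- A 2-colouring of the vertices that separates the two vertices of each clique of size two. -/
theorem InClass.exists_orientation {C : TwoColGraph.{u}} (hC : InClass s κ C) :
    ∃ h : C.V → Prop, ∀ y y', s (C.color y) = .two → C.Sim y y' → y ≠ y' → (h y ↔ ¬ h y') := by
  classical
  let r : C.V → C.V → Prop := WellOrderingRel
  have hr : IsStrictTotalOrder C.V r := inferInstanceAs (IsStrictTotalOrder C.V WellOrderingRel)
  -- `h y` holds if `y` is the greater of the two vertices of its clique
  refine ⟨fun y => ∃ z, C.Sim z y ∧ r z y, ?_⟩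
  have main : ∀ y y', s (C.color y) = .two → C.Sim y y' → r y y' →
      ((∃ z, C.Sim z y ∧ r z y) ↔ ¬ ∃ z, C.Sim z y' ∧ r z y') := by
    intro y y' h hyy hr'
    refine iff_of_false ?_ (not_not.2 ⟨y, hyy, hr'⟩)
    rintro ⟨z, hz, hzy⟩
    rcases hC.two h hyy hz.symm with rfl | rfl | rfl
    · exact irrefl_of r _ hr'
    · exact irrefl_of r _ hzy
    · exact irrefl_of r _ (trans_of r hr' hzy)
  intro y y' h hyy hne
  rcases trichotomous_of r y y' with hr' | rfl | hr'
  · exact main y y' h hyy hr'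
  · exact absurd rfl hne
  · exact iff_not_comm.1 (main y' y (hyy.1 ▸ h) hyy.symm hr')

/-- A prescribed set of neighbours on the image of `f`, extended to all of `C`: on each clique it
agrees with `h` or is opposite to `h`, as dictated by the prescribed values. -/
theorem InClass.exists_interpolation {C : TwoColGraph.{u}} (hC : InClass s κ C) {ι : Type v}
    (f : ι → C.V) (τ : ι → Prop) (h : C.V → Prop)
    (hcons : ∀ b b', C.Sim (f b) (f b') → ((τ b ↔ τ b') ↔ (h (f b) ↔ h (f b')))) :
    ∃ E : C.V → Prop, (∀ b, E (f b) ↔ τ b) ∧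
      ∀ y y', C.Sim y y' → ((E y ↔ E y') ↔ (h y ↔ h y')) := by
  classical
  refine ⟨fun y => if H : ∃ b, C.Sim (f b) y then ((τ H.choose ↔ h (f H.choose)) ↔ h y) else h y,
    ?_, ?_⟩
  · intro b
    have H : ∃ b', C.Sim (f b') (f b) := ⟨b, Sim.refl _⟩
    simp only [dif_pos H]
    have := hcons _ _ H.choose_spec
    grind
  · intro y y' hyy
    by_cases H : ∃ b, C.Sim (f b) y
    · have H' : ∃ b, C.Sim (f b) y' := H.imp fun b hb => hC.sim_trans hb hyy
      have h1 : C.Sim (f H.choose) (f H'.choose) :=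
        hC.sim_trans (hC.sim_trans H.choose_spec hyy) H'.choose_spec.symm
      have := hcons _ _ h1
      simp only [dif_pos H, dif_pos H']
      grind
    · have H' : ¬ ∃ b, C.Sim (f b) y' :=
        fun H' => H (H'.imp fun b hb => hC.sim_trans hb hyy.symm)
      simp only [dif_neg H, dif_neg H']

/-- The conclusion of the one-point amalgamation: the vertex `x` of `B` can be added to the image
of `f : X → C` in some extension of `C`. -/
def ExtendsTo (s : Color → CliqueSize) (κ : Color → ℕ∞) (B C : TwoColGraph.{u}) (X : Set B.V)
    (f : B.V → C.V) (x : B.V) : Prop :=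
  ∃ C' : TwoColGraph.{u}, Finite C'.V ∧ InClass s κ C' ∧ ∃ (e : C.V → C'.V) (v : C'.V),
    IsEmbOn C C' Set.univ e ∧ C'.color v = B.color x ∧
      ∀ y ∈ X, e (f y) ≠ v ∧ (C'.graph.Adj (e (f y)) v ↔ B.graph.Adj y x)

section OnePoint

variable {B C : TwoColGraph.{u}} {X : Set B.V} {f : B.V → C.V} {x : B.V}

theorem extendsTo_of_addPoint [Finite C.V] {N : C.V → Prop}
    (h : InClass s κ (C.addPoint (B.color x) N)) (hN : ∀ y ∈ X, N (f y) ↔ B.graph.Adj y x) :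
    ExtendsTo s κ B C X f x := by
  refine ⟨C.addPoint (B.color x) N, inferInstanceAs (Finite (Option C.V)), h, some, none,
    ⟨(Option.some_injective _).injOn, fun _ _ => rfl, fun _ _ _ _ => Iff.rfl⟩, rfl, ?_⟩
  exact fun y hy => ⟨Option.some_ne_none (f y), hN y hy⟩

/-- The new vertex joins the clique of the vertex `u`. -/
theorem extendsTo_join [Finite C.V] (hC : InClass s κ C)
    (hf : IsEmbOn B C X f) (hx : x ∉ X) {u : C.V} (huc : C.color u = B.color x)
    (hu : ∀ y ∈ X, B.color y = B.color x → (C.Sim u (f y) ↔ B.Sim y x))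
    (hs : s (B.color x) = .many)
    (hcons : ∀ b ∈ X, ∀ b' ∈ X, B.color b ≠ B.color x → B.Sim b b' →
      ((B.graph.Adj b x ↔ B.graph.Adj b' x) ↔ (C.graph.Adj u (f b) ↔ C.graph.Adj u (f b')))) :
    ExtendsTo s κ B C X f x := by
  obtain ⟨E, hE, hE'⟩ := hC.exists_interpolation
    (ι := {b : B.V // b ∈ X ∧ B.color b ≠ B.color x}) (fun b => f b) (fun b => B.graph.Adj b x)
    (fun y => C.graph.Adj u y)
    (fun b b' h => hcons b b.2.1 b' b'.2.1 b.2.2 ((hf.sim_iff b.2.1 b'.2.1).1 h))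
  refine extendsTo_of_addPoint (N := fun y => (C.color y = B.color x ∧ C.Sim u y) ∨
    (C.color y ≠ B.color x ∧ E y)) (inClass_addPoint hC ?_ ?_ ?_ ?_ ?_ ?_) ?_
  · rintro a hac (⟨-, hua⟩ | ⟨h, -⟩) b hbc
    · refine ⟨?_, fun h => Or.inl ⟨hbc, hC.sim_trans hua h⟩⟩
      rintro (⟨-, h⟩ | ⟨h, -⟩)
      · exact hC.sim_trans hua.symm h
      · exact absurd hbc h
    · exact absurd hac h
  · rintro a y y' hac (⟨-, hua⟩ | ⟨h, -⟩) hyc hyy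
    · have hyc' : C.color y' ≠ B.color x := hyy.1 ▸ hyc
      have h1 := hE' y y' hyy
      have h2 := hC.parity hua hyy (fun h => hyc (h.symm.trans huc))
      simp only [hyc, hyc', ne_eq, not_false_eq_true, true_and, false_and, false_or]
      rw [h1]
      exact parity_comm.1 h2 |> fun h => by grind
    · exact absurd hac h
  · intro h; rw [hs] at h; cases h
  · intro h; rw [hs] at h; cases h
  · intro y y' hyc h hyy hne
    have hyc' : C.color y' ≠ B.color x := hyy.1 ▸ hyc
    have h1 := hE' y y' hyy
    have h2 := hC.mates h hyy hne (fun h => hyc (h.symm.trans huc))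
    rw [SimpleGraph.adj_comm, SimpleGraph.adj_comm _ y'] at h2
    simp only [hyc, hyc', ne_eq, not_false_eq_true, true_and, false_and, false_or]
    grind
  · exact fun h => absurd (Or.inl ⟨huc, Sim.refl u⟩) (h u huc)
  · intro y hy
    have hyx : y ≠ x := fun h => hx (h ▸ hy)
    by_cases hyc : B.color y = B.color x
    · simp only [hf.color y hy, hyc, true_and, ne_eq, not_true_eq_false, false_and, or_false]
      rw [hu y hy hyc, adj_iff_sim hyc, and_iff_left hyx]
    · simp only [hf.color y hy, hyc, false_and, ne_eq, not_false_eq_true, true_and, false_or]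
      exact hE ⟨y, hy, hyc⟩

/-- The new vertex forms a clique of its own. -/
theorem extendsTo_new [Finite C.V] (hB : InClass s κ B) (hC : InClass s κ C)
    (hf : IsEmbOn B C X f) (hx : x ∉ X) (hX : ∀ y ∈ X, ¬ B.Sim y x)
    (hκ : κ (B.color x) ≠ ⊤ → ∀ u, C.color u = B.color x → ∃ y ∈ X, C.Sim u (f y)) :
    ExtendsTo s κ B C X f x := by
  classical
  have hE : ∃ E : C.V → Prop, (∀ b ∈ X, B.color b ≠ B.color x → (E (f b) ↔ B.graph.Adj b x)) ∧
      ∀ y y', C.color y ≠ B.color x → s (C.color y) = .two → C.Sim y y' → y ≠ y' →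
        (E y ↔ ¬ E y') := by
    by_cases hd : ∃ d, d ≠ B.color x ∧ s d = .two
    · obtain ⟨d, hdx, hds⟩ := hd
      obtain ⟨h, hh⟩ := hC.exists_orientation
      obtain ⟨E, hE, hE'⟩ := hC.exists_interpolation
        (ι := {b : B.V // b ∈ X ∧ B.color b ≠ B.color x}) (fun b => f b)
        (fun b => B.graph.Adj b x) h (by
          rintro ⟨b, hb, hbc⟩ ⟨b', hb', hbc'⟩ hbb
          by_cases hne : b = b'
          · subst hne; simp
          have hbs : s (B.color b) = .two := by rw [Color.eq_of_ne_of_ne hbc hdx, hds]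
          have h1 := hB.mates hbs ((hf.sim_iff hb hb').1 hbb) hne (Ne.symm hbc)
          have h2 := hh (f b) (f b') (by rw [hf.color b hb, hbs]) hbb (hf.inj.ne hb hb' hne)
          simp only
          grind)
      refine ⟨E, fun b hb hbc => hE ⟨b, hb, hbc⟩, fun y y' _ hys hyy hne => ?_⟩
      have h1 := hE' y y' hyy
      have h2 := hh y y' hys hyy hne
      grind
    · refine ⟨fun y => ∃ b ∈ X, f b = y ∧ B.graph.Adj b x, fun b hb _ => ?_, fun y y' hyc hys => ?_⟩
      · constructor
        · rintro ⟨b', hb', hbb, h⟩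
          rwa [← hf.inj hb' hb hbb]
        · exact fun h => ⟨b, hb, rfl, h⟩
      · exact absurd ⟨_, hyc, hys⟩ hd
  obtain ⟨E, hE, hE'⟩ := hE
  refine extendsTo_of_addPoint (N := fun y => C.color y ≠ B.color x ∧ E y)
    (inClass_addPoint hC ?_ ?_ ?_ ?_ ?_ ?_) ?_
  · exact fun a hac h => absurd hac h.1
  · exact fun a y y' hac h => absurd hac h.1
  · exact fun _ a hac h => absurd hac h.1
  · exact fun _ a hac h => absurd hac h.1
  · intro y y' hyc hys hyy hne
    have hyc' : C.color y' ≠ B.color x := hyy.1 ▸ hyc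
    simp only [hyc, hyc', ne_eq, not_false_eq_true, true_and]
    exact hE' y y' hyc hys hyy hne
  · intro _ t htc hti
    by_cases hk : κ (B.color x) = ⊤
    · rw [hk]; exact le_top
    -- pull the independent set back to `B` and add `x`
    have hch : ∀ u : C.V, ∃ y : B.V, C.color u = B.color x → y ∈ X ∧ C.Sim u (f y) := fun u => by
      by_cases huc : C.color u = B.color x
      · obtain ⟨y, hy, h⟩ := hκ hk u huc
        exact ⟨y, fun _ => ⟨hy, h⟩⟩
      · exact ⟨x, fun h => absurd h huc⟩
    choose p hp using hch
    have hp1 : ∀ u ∈ t, p u ∈ X := fun u hu => (hp u (htc u hu)).1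
    have hp2 : ∀ u ∈ t, C.Sim u (f (p u)) := fun u hu => (hp u (htc u hu)).2
    have hp3 : ∀ u ∈ t, ∀ w ∈ t, B.Sim (p u) (p w) → u = w := fun u hu w hw h =>
      hti u hu w hw (hC.sim_trans (hp2 u hu) (hC.sim_trans
        ((hf.sim_iff (hp1 u hu) (hp1 w hw)).2 h) (hp2 w hw).symm))
    have hxt : x ∉ t.image p := fun h => by
      obtain ⟨u, hu, rfl⟩ := Finset.mem_image.1 h
      exact hx (hp1 u hu)
    have hcard : (t.image p).card = t.card := Finset.card_image_of_injOn fun u hu w hw h =>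
      hp3 u hu w hw (h ▸ Sim.refl _)
    have := hB.bound (B.color x) (insert x (t.image p)) (by
      intro y hy
      rcases Finset.mem_insert.1 hy with rfl | hy
      · rfl
      · obtain ⟨u, hu, rfl⟩ := Finset.mem_image.1 hy
        rw [← hf.color _ (hp1 u hu), ← (hp2 u hu).1, htc u hu]) (by
      intro y hy z hz hyz
      rcases Finset.mem_insert.1 hy with rfl | hy' <;> rcases Finset.mem_insert.1 hz with rfl | hz'
      · rfl
      · obtain ⟨u, hu, rfl⟩ := Finset.mem_image.1 hz'
        exact absurd hyz.symm (hX _ (hp1 u hu))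
      · obtain ⟨u, hu, rfl⟩ := Finset.mem_image.1 hy'
        exact absurd hyz (hX _ (hp1 u hu))
      · obtain ⟨u, hu, rfl⟩ := Finset.mem_image.1 hy'
        obtain ⟨w, hw, rfl⟩ := Finset.mem_image.1 hz'
        rw [hp3 u hu w hw hyz])
    rw [Finset.card_insert_of_notMem hxt, hcard] at this
    exact_mod_cast this
  · intro y hy
    by_cases hyc : B.color y = B.color x
    · rw [hf.color y hy]
      refine iff_of_false (fun h => h.1 hyc) (fun h => hX y hy ⟨hyc, Or.inr h⟩)
    · rw [hf.color y hy, and_iff_right hyc]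
      exact hE y hy hyc

/-- One-point amalgamation. -/
theorem InClass.extendsTo (hv : Admissible s κ) [Finite C.V] (hB : InClass s κ B)
    (hC : InClass s κ C) (hf : IsEmbOn B C X f) (hx : x ∉ X) : ExtendsTo s κ B C X f x := by
  classical
  by_cases hX : ∃ x₀ ∈ X, B.Sim x₀ x
  · obtain ⟨x₀, hx₀, hsim⟩ := hX
    have hne : x₀ ≠ x := fun h => hx (h ▸ hx₀)
    have huc : C.color (f x₀) = B.color x := (hf.color _ hx₀).trans hsim.1
    cases hs : s (B.color x) with
    | one => exact absurd (hB.one (hsim.1 ▸ hs) hsim) hne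
    | two =>
      have hs0 : s (B.color x₀) = .two := hsim.1 ▸ hs
      have hs' : s (C.color (f x₀)) = .two := huc ▸ hs
      -- in `X`, the clique of `x` consists of `x₀` only
      have honly : ∀ y ∈ X, B.Sim y x → y = x₀ := fun y hy hyx => by
        rcases hB.two hs0 hsim (hB.sim_trans hsim hyx.symm) with h | h | h
        · exact absurd h hne
        · exact h.symm
        · exact absurd (h ▸ hy) hx
      by_cases hv : ∃ v, C.Sim (f x₀) v ∧ f x₀ ≠ v
      · -- the mate of `f x₀` is already present
        obtain ⟨v, hv, hvne⟩ := hv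
        refine ⟨C, inferInstance, hC, id, v, ⟨Function.injective_id.injOn, fun _ _ => rfl,
          fun _ _ _ _ => Iff.rfl⟩, hv.1.symm.trans huc, fun y hy => ?_⟩
        have hfy : f y ≠ v := fun h => by
          have : B.Sim x₀ y := (hf.sim_iff hx₀ hy).1 (h ▸ hv)
          have := honly y hy (hB.sim_trans this.symm hsim)
          exact hvne (this ▸ h)
        refine ⟨hfy, ?_⟩
        change C.graph.Adj (f y) v ↔ _
        by_cases hyc : B.color y = B.color x
        · rw [adj_iff_sim hyc, adj_iff_sim (by rw [hf.color y hy, hyc, ← huc, hv.1]),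
            and_iff_left hfy, and_iff_left (show y ≠ x from fun h => hx (h ▸ hy))]
          constructor
          · exact fun h => hB.sim_trans ((hf.sim_iff hy hx₀).1 (hC.sim_trans h hv.symm)) hsim
          · exact fun h => hC.sim_trans ((hf.sim_iff hy hx₀).2 (hB.sim_trans h hsim.symm)) hv
        · have h1 := hB.mates hs0 hsim hne (fun h => hyc (h.trans hsim.1))
          have h2 := hC.mates hs' hv hvne (z := f y) (by rw [huc, hf.color y hy]; exact hyc)
          rw [hf.adj _ hx₀ _ hy] at h2
          rw [SimpleGraph.adj_comm, SimpleGraph.adj_comm _ y]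
          grind
      · push Not at hv
        refine extendsTo_of_addPoint (N := fun y => y = f x₀ ∨
          (C.color y ≠ B.color x ∧ ¬ C.graph.Adj (f x₀) y))
          (inClass_addPoint hC ?_ ?_ ?_ ?_ ?_ ?_) ?_
        · rintro a hac (rfl | h) b hbc
          · constructor
            · rintro (rfl | h)
              exacts [Sim.refl _, absurd hbc h.1]
            · exact fun h => Or.inl (hv b h).symm
          · exact absurd hac h.1
        · rintro a y y' hac (rfl | h) hyc hyy
          · have hyc' : C.color y' ≠ B.color x := hyy.1 ▸ hyc
            have h1 : y ≠ f x₀ := fun h => hyc (h ▸ huc)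
            have h2 : y' ≠ f x₀ := fun h => hyc' (h ▸ huc)
            simp only [h1, h2, hyc, hyc', ne_eq, not_false_eq_true, true_and, false_or, not_iff_not]
          · exact absurd hac h.1
        · intro h; rw [hs] at h; cases h
        · rintro - a hac (rfl | h)
          · refine ⟨hv, fun y hyc => ?_⟩
            have h1 : y ≠ f x₀ := fun h => hyc (h ▸ huc)
            simp only [h1, hyc, ne_eq, not_false_eq_true, true_and, false_or]
          · exact absurd hac h.1
        · intro y y' hyc h hyy hne
          have hyc' : C.color y' ≠ B.color x := hyy.1 ▸ hyc
          have h1 : y ≠ f x₀ := fun h => hyc (h ▸ huc)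
          have h2 : y' ≠ f x₀ := fun h => hyc' (h ▸ huc)
          have h3 := hC.mates h hyy hne (z := f x₀) (fun h => hyc (h.symm.trans huc))
          rw [SimpleGraph.adj_comm, SimpleGraph.adj_comm _ y'] at h3
          simp only [h1, h2, hyc, hyc', ne_eq, not_false_eq_true, true_and, false_or, h3]
        · exact fun h => absurd (Or.inl rfl) (h (f x₀) huc)
        · intro y hy
          by_cases hyc : B.color y = B.color x
          · rw [adj_iff_sim hyc, and_iff_left (show y ≠ x from fun h => hx (h ▸ hy)), hf.color y hy]
            constructor
            · rintro (h | h)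
              · rw [hf.inj hy hx₀ h]; exact hsim
              · exact absurd hyc h.1
            · exact fun h => Or.inl (by rw [honly y hy h])
          · have h1 : f y ≠ f x₀ := fun h => hyc (by rw [← hf.color y hy, h, huc])
            have h2 := hB.mates hs0 hsim hne (fun h => hyc (h.trans hsim.1))
            rw [hf.color y hy, hf.adj _ hx₀ _ hy, h2, not_not, SimpleGraph.adj_comm]
            simp only [h1, hyc, ne_eq, not_false_eq_true, true_and, false_or]
    | many =>
      refine extendsTo_join hC hf hx huc (fun y hy hyc => ?_) hs
        (fun b hb b' hb' hbc hbb => ?_)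
      · rw [hf.sim_iff hx₀ hy]
        exact ⟨fun h => hB.sim_trans h.symm hsim, fun h => hB.sim_trans hsim h.symm⟩
      · rw [hf.adj _ hx₀ _ hb, hf.adj _ hx₀ _ hb']
        have := hB.parity hsim hbb (fun h => hbc (h.symm.trans hsim.1))
        rw [SimpleGraph.adj_comm _ b, SimpleGraph.adj_comm _ b']
        grind
  · push Not at hX
    by_cases hκ : κ (B.color x) ≠ ⊤ ∧ ∃ u, C.color u = B.color x ∧ ∀ y ∈ X, ¬ C.Sim u (f y)
    · obtain ⟨hk, u, huc, hu⟩ := hκ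
      refine extendsTo_join hC hf hx huc (fun y hy hyc => iff_of_false (hu y hy) (hX y hy)) ?_ ?_
      · cases hB' : B.color x with
        | red => exact (hv .red .blue (by simp) (hB' ▸ hk)).1
        | blue => exact (hv .blue .red (by simp) (hB' ▸ hk)).1
      · -- the cliques of the other colour have at most two vertices
        intro b hb b' hb' hbc hbb
        by_cases hne : b = b'
        · subst hne; simp
        have hd := (hv _ _ (Ne.symm hbc) hk).2
        cases hs : s (B.color b) with
        | one => exact absurd (hB.one hs hbb) hne
        | two =>
          have h1 := hB.mates hs hbb hne (Ne.symm hbc)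
          have h2 := hC.mates (x := f b) (y := f b') (z := u) (by rw [hf.color b hb, hs])
            ((hf.sim_iff hb hb').2 hbb) (hf.inj.ne hb hb' hne)
            (by rw [huc, hf.color b hb]; exact Ne.symm hbc)
          rw [SimpleGraph.adj_comm _ u, SimpleGraph.adj_comm _ u]
          grind
        | many => exact absurd hs hd
    · push Not at hκ
      exact extendsTo_new hB hC hf hx hX hκ

end OnePoint
end TwoColGraph

namespace TwoColGraph

variable {s : Color → CliqueSize} {κ : Color → ℕ∞}

/-- Amalgamation of `C` with `B` over the image of a partial embedding. -/
theorem InClass.amalgam (hv : Admissible s κ) {B : TwoColGraph.{u}} [Finite B.V]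
    (hB : InClass s κ B) : ∀ (n : ℕ) (C : TwoColGraph.{u}) (X : Finset B.V) (f : B.V → C.V),
      Finite C.V → InClass s κ C → IsEmbOn B C X f → Nat.card B.V ≤ X.card + n →
      ∃ Q : TwoColGraph.{u}, Finite Q.V ∧ InClass s κ Q ∧ ∃ (e : C.V → Q.V) (g : B.V → Q.V),
        IsEmbOn C Q Set.univ e ∧ IsEmbOn B Q Set.univ g ∧ ∀ x ∈ X, g x = e (f x) := by
  classical
  intro n
  induction n with
  | zero =>
    intro C X f hfin hC hf hX
    have : Fintype B.V := Fintype.ofFinite _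
    have hX' : X = Finset.univ := by
      rw [← Finset.card_eq_iff_eq_univ]
      rw [Nat.card_eq_fintype_card] at hX
      exact le_antisymm (Finset.card_le_univ X) hX
    refine ⟨C, hfin, hC, id, f, ⟨Function.injective_id.injOn, fun _ _ => rfl,
      fun _ _ _ _ => Iff.rfl⟩, ?_, fun _ _ => rfl⟩
    rwa [hX', Finset.coe_univ] at hf
  | succ n ih =>
    intro C X f hfin hC hf hX
    by_cases hall : ∀ x, x ∈ X
    · refine ⟨C, hfin, hC, id, f, ⟨Function.injective_id.injOn, fun _ _ => rfl,
        fun _ _ _ _ => Iff.rfl⟩, hf.mono fun x _ => hall x, fun _ _ => rfl⟩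
    push Not at hall
    obtain ⟨x, hx⟩ := hall
    obtain ⟨C', hfin', hC', e, v, he, hvc, hva⟩ := hB.extendsTo hv hC hf (x := x) hx
    have hef : IsEmbOn B C' X (e ∘ f) := he.comp hf (fun _ _ => trivial)
    have hins := hef.insert (x := x) hx hvc hva
    rw [← Finset.coe_insert] at hins
    obtain ⟨Q, hfQ, hQ, e', g, he', hg, hgf⟩ := ih C' (insert x X) _ hfin' hC' hins (by
      rw [Finset.card_insert_of_notMem hx]; omega)
    refine ⟨Q, hfQ, hQ, e' ∘ e, g, he'.comp he (fun _ _ => trivial), hg, fun y hy => ?_⟩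
    have hyx : y ≠ x := fun h => hx (h ▸ hy)
    rw [hgf y (Finset.mem_insert_of_mem hy), Function.update_of_ne hyx]
    rfl

/-- The finite members of `InClass s κ`, as a class of first-order structures. -/
def finClass (s : Color → CliqueSize) (κ : Color → ℕ∞) : Set (Bundled.{u} colLang.Structure) :=
  {M | ∃ A : TwoColGraph.{u}, Finite A.V ∧ InClass s κ A ∧ Nonempty (M ≃[colLang] A.V)}

theorem finClass.finite {M : Bundled.{u} colLang.Structure} (hM : M ∈ finClass s κ) : Finite M := by
  obtain ⟨A, hA, -, ⟨e⟩⟩ := hM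
  exact Finite.of_equiv A.V e.toEquiv.symm

/-- Up to isomorphism there are only countably many finite 2-coloured graphs: each is isomorphic to
one on `Fin n`. -/
theorem finClass.countable :
    (Quotient.mk' '' finClass.{u} s κ : Set (Quotient _)).Countable := by
  let F : (Σ n : ℕ, (Fin n → Fin n → Prop) × (Fin n → Color)) →
      Set (Bundled.{u} colLang.Structure) := fun p =>
    {M | ∃ (A : TwoColGraph.{u}) (e : Fin p.1 ≃ A.V), (∀ i j, A.graph.Adj (e i) (e j) ↔ p.2.1 i j) ∧
      (∀ i, A.color (e i) = p.2.2 i) ∧ Nonempty (M ≃[colLang] A.V)}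
  have hcol : Finite Color :=
    Finite.of_surjective (fun b : Bool => if b then Color.red else Color.blue) fun c => by
      cases c
      exacts [⟨true, rfl⟩, ⟨false, rfl⟩]
  have hsub : ∀ p, ((Quotient.mk' '' F p : Set (Quotient _))).Subsingleton := by
    rintro ⟨n, p⟩ _ ⟨M, ⟨A, e, hadj, hcol, ⟨φ⟩⟩, rfl⟩ _ ⟨N, ⟨B, e', hadj', hcol', ⟨ψ⟩⟩, rfl⟩
    refine Quotient.sound ⟨(ψ.symm.comp (equivOfIsEmbOn (e.symm.trans e') ?_)).comp φ⟩
    refine ⟨(e.symm.trans e').injective.injOn, fun x _ => ?_, fun x _ y _ => ?_⟩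
    · obtain ⟨i, rfl⟩ := e.surjective x
      simp only [Equiv.trans_apply, Equiv.symm_apply_apply, hcol, hcol']
    · obtain ⟨i, rfl⟩ := e.surjective x
      obtain ⟨j, rfl⟩ := e.surjective y
      simp only [Equiv.trans_apply, Equiv.symm_apply_apply, hadj, hadj']
  refine Set.Countable.mono ?_ (Set.countable_iUnion fun p => (hsub p).countable)
  rintro _ ⟨M, ⟨A, hfin, -, hMA⟩, rfl⟩
  obtain ⟨n, ⟨e⟩⟩ := Finite.exists_equiv_fin A.V
  exact Set.mem_iUnion.2 ⟨⟨n, fun i j => A.graph.Adj (e.symm i) (e.symm j),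
    fun i => A.color (e.symm i)⟩, M, ⟨A, e.symm, fun _ _ => Iff.rfl, fun _ => rfl, hMA⟩, rfl⟩

/-- The amalgamation property, by adding the vertices of one graph to the other one at a time, is
the only property of a Fraïssé class that needs work. -/
theorem finClass_isFraisse (hv : Admissible s κ) :
    FirstOrder.Language.IsFraisse (finClass.{u} s κ) := by
  classical
  have ham : ∀ (M N P : Bundled.{u} colLang.Structure) (MN : M ↪[colLang] N) (MP : M ↪[colLang] P),
      N ∈ finClass s κ → P ∈ finClass s κ → ∃ (Q : Bundled.{u} colLang.Structure)
        (NQ : N ↪[colLang] Q) (PQ : P ↪[colLang] Q), Q ∈ finClass s κ ∧ NQ.comp MN = PQ.comp MP := by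
    rintro M N P MN MP ⟨B, hBfin, hB, ⟨φ⟩⟩ ⟨C, hCfin, hC, ⟨ψ⟩⟩
    have hM : Finite M := Finite.of_injective _ (φ.toEmbedding.comp MN).injective
    let A := B.comap (φ.toEmbedding.comp MN).toEmbedding
    let i : M → B.V := fun m => φ (MN m)
    have hi : Function.Injective i := (φ.toEmbedding.comp MN).injective
    let θ := equivComap B (φ.toEmbedding.comp MN)
    have hAB : IsEmbOn A B Set.univ i := isEmbOn_comap B _
    have hAC : IsEmbOn A C Set.univ (fun m : M => ψ (MP m)) :=
      isEmbOn_embedding (A := A) (B := C) ((ψ.toEmbedding.comp MP).comp θ.symm.toEmbedding)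
    let X : Finset B.V := (Set.finite_range i).toFinset
    have hX : ∀ m, i m ∈ X := fun m => (Set.Finite.mem_toFinset _).2 ⟨m, rfl⟩
    by_cases hne : Nonempty M
    · have hinv : ∀ m, Function.invFun i (i m) = m := Function.leftInverse_invFun hi
      have hf : IsEmbOn B C X (fun b => ψ (MP (Function.invFun i b))) := by
        have hrange : ∀ b ∈ (X : Set B.V), ∃ m, i m = b := fun b hb =>
          (Set.Finite.mem_toFinset (Set.finite_range i)).1 hb
        refine ⟨fun b hb b' hb' h => ?_, fun b hb => ?_, fun b hb b' hb' => ?_⟩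
        · obtain ⟨m, rfl⟩ := hrange b hb
          obtain ⟨m', rfl⟩ := hrange b' hb'
          rw [hinv, hinv] at h
          exact congrArg i (hAC.inj trivial trivial h)
        · obtain ⟨m, rfl⟩ := hrange b hb
          rw [hinv]
          exact hAC.color m trivial
        · obtain ⟨m, rfl⟩ := hrange b hb
          obtain ⟨m', rfl⟩ := hrange b' hb'
          rw [hinv, hinv]
          exact hAC.adj m trivial m' trivial
      obtain ⟨Q, hQfin, hQ, e, g, he, hg, hge⟩ :=
        hB.amalgam hv (Nat.card B.V) C X _ hCfin hC hf (by omega)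
      refine ⟨⟨Q.V, inferInstance⟩, hg.toEmbedding.comp φ.toEmbedding,
        he.toEmbedding.comp ψ.toEmbedding, ⟨Q, hQfin, hQ, ⟨Language.Equiv.refl _ _⟩⟩, ?_⟩
      ext m
      have := hge (i m) (hX m)
      rw [hinv] at this
      exact this
    · have hemp : IsEmpty M := not_nonempty_iff.1 hne
      by_cases hCne : Nonempty C.V
      · have hf : IsEmbOn B C ((∅ : Finset B.V) : Set B.V) (fun _ => hCne.some) := by
          rw [Finset.coe_empty]
          exact ⟨Set.injOn_empty _, fun _ h => h.elim, fun _ h => h.elim⟩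
        obtain ⟨Q, hQfin, hQ, e, g, he, hg, -⟩ :=
          hB.amalgam hv (Nat.card B.V) C ∅ _ hCfin hC hf (by omega)
        refine ⟨⟨Q.V, inferInstance⟩, hg.toEmbedding.comp φ.toEmbedding,
          he.toEmbedding.comp ψ.toEmbedding, ⟨Q, hQfin, hQ, ⟨Language.Equiv.refl _ _⟩⟩, ?_⟩
        ext m
        exact hemp.elim m
      · have hCe : IsEmpty C.V := not_nonempty_iff.1 hCne
        have he : IsEmbOn C B Set.univ (fun x => hCe.elim x) :=
          ⟨fun x => hCe.elim x, fun x => hCe.elim x, fun x => hCe.elim x⟩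
        refine ⟨N, Language.Embedding.refl _ _,
          φ.symm.toEmbedding.comp (he.toEmbedding.comp ψ.toEmbedding),
          ⟨B, hBfin, hB, ⟨φ⟩⟩, ?_⟩
        ext m
        exact hemp.elim m
  have hempty : ∃ M : Bundled.{u} colLang.Structure, IsEmpty M ∧ M ∈ finClass s κ := by
    obtain ⟨A, hA⟩ : ∃ A : TwoColGraph.{u}, IsEmpty A.V :=
      ⟨⟨PEmpty, ⊥, fun x => x.elim⟩, inferInstanceAs (IsEmpty PEmpty)⟩
    refine ⟨⟨A.V, A.instStructure⟩, hA, A, inferInstance, ⟨fun c x => hA.elim x, fun {x} => hA.elim x,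
      fun {x} => hA.elim x, fun {x} => hA.elim x, fun {x} => hA.elim x, fun c t _ _ => ?_⟩,
      ⟨Language.Equiv.refl _ _⟩⟩
    rw [Finset.eq_empty_of_isEmpty t]
    simp
  refine ⟨?_, fun M hM => ?_, finClass.countable, ?_, ?_, fun M N P MN MP _ => ham M N P MN MP⟩
  · obtain ⟨M, -, hM⟩ := hempty
    exact ⟨M, hM⟩
  · exact Language.Structure.fg_iff_finite.2 (finClass.finite hM)
  · rintro M ⟨A, hfin, hA, ⟨e⟩⟩ N ⟨-, ⟨φ⟩⟩
    let ψ := e.toEmbedding.comp φ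
    exact ⟨A.comap ψ.toEmbedding, Finite.of_injective _ ψ.injective,
      hA.of_isEmbOn (isEmbOn_comap A _), ⟨equivComap A ψ⟩⟩
  · intro N hN P hP
    obtain ⟨M, hM, -⟩ := hempty
    have emb : ∀ N : Bundled.{u} colLang.Structure, Nonempty (M ↪[colLang] N) := fun N =>
      ⟨{ toFun := fun x => hM.elim x
         inj' := fun x => hM.elim x
         map_fun' := fun g => nomatch g
         map_rel' := fun r x => by
          cases r
          · exact hM.elim (x 0)
          · exact hM.elim (x 0) }⟩
    obtain ⟨Q, NQ, PQ, hQ, -⟩ := ham M N P (emb N).some (emb P).some hN hP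
    exact ⟨Q, hQ, ⟨NQ⟩, ⟨PQ⟩⟩

end TwoColGraph

namespace TwoColGraph

variable {s : Color → CliqueSize} {κ : Color → ℕ∞}

/-! ### The classes of the classification in terms of clique sizes -/

theorem omitted_monoK {A : TwoColGraph.{u}} {c : Color} {n : ℕ} :
    Omitted (monoK c n) A ↔ ¬ ∃ f : Fin n → A.V, Function.Injective f ∧ (∀ i, A.color (f i) = c) ∧
      ∀ i j, A.Sim (f i) (f j) := by
  rw [Omitted, realized_iff, not_iff_not]
  refine exists_congr fun f => ⟨fun h => ⟨Set.injOn_univ.1 h.inj, fun i => h.color i trivial,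
    fun i j => ?_⟩, fun h => ⟨h.1.injOn, fun i _ => h.2.1 i, fun i _ j _ => ?_⟩⟩
  · exact (h.sim_iff trivial trivial).2 ⟨rfl, (eq_or_ne i j).imp id id⟩
  · rw [adj_iff_sim ((h.2.1 i).trans (h.2.1 j).symm), and_iff_right (h.2.2 i j)]
    exact not_congr h.1.eq_iff

theorem omitted_monoKbar {A : TwoColGraph.{u}} {c : Color} {n : ℕ} :
    Omitted (monoKbar c n) A ↔ ¬ ∃ f : Fin n → A.V, (∀ i, A.color (f i) = c) ∧
      ∀ i j, A.Sim (f i) (f j) → i = j := by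
  rw [Omitted, realized_iff, not_iff_not]
  refine exists_congr fun f => ⟨fun h => ⟨fun i => h.color i trivial, fun i j hij => ?_⟩,
    fun h => ⟨?_, fun i _ => h.1 i, fun i _ j _ => iff_of_false ?_ (fun h => h)⟩⟩
  · exact ((h.sim_iff trivial trivial).1 hij).2.resolve_right (fun h => h)
  · exact fun i _ j _ hij => h.2 i j (hij ▸ Sim.refl _)
  · intro hij
    exact hij.ne (congrArg f (h.2 i j ⟨(h.1 i).trans (h.1 j).symm, Or.inr hij⟩))

theorem omitted_twoCliques {A : TwoColGraph.{u}} {m n : ℕ} {E : Fin m → Fin n → Prop} :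
    Omitted (twoCliques m n E) A ↔ ¬ ∃ (f : Fin m → A.V) (g : Fin n → A.V), f.Injective ∧
      g.Injective ∧ (∀ i, A.color (f i) = .red) ∧ (∀ j, A.color (g j) = .blue) ∧
      (∀ i j, A.Sim (f i) (f j)) ∧ (∀ i j, A.Sim (g i) (g j)) ∧
      ∀ i j, A.graph.Adj (f i) (g j) ↔ E i j := by
  rw [Omitted, realized_iff, not_iff_not]
  constructor
  · rintro ⟨h, hh⟩
    have hi := Set.injOn_univ.1 hh.inj
    refine ⟨fun i => h (Sum.inl i), fun j => h (Sum.inr j), hi.comp Sum.inl_injective,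
      hi.comp Sum.inr_injective, fun i => hh.color _ trivial, fun j => hh.color _ trivial,
      fun i j => (hh.sim_iff trivial trivial).2 ⟨rfl, ?_⟩,
      fun i j => (hh.sim_iff trivial trivial).2 ⟨rfl, ?_⟩, fun i j => hh.adj _ trivial _ trivial⟩
    · exact (eq_or_ne i j).imp (congrArg Sum.inl) id
    · exact (eq_or_ne i j).imp (congrArg Sum.inr) id
  · rintro ⟨f, g, hf, hg, hfc, hgc, hfs, hgs, hE⟩
    have hne : ∀ i j, f i ≠ g j := fun i j h => by
      have := (hfc i).symm.trans ((congrArg A.color h).trans (hgc j))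
      cases this
    refine ⟨Sum.elim f g, (hf.sumElim hg hne).injOn, ?_, ?_⟩
    · rintro (i | j) -
      exacts [hfc i, hgc j]
    · rintro (i | i) - (j | j) -
      · change A.graph.Adj (f i) (f j) ↔ i ≠ j
        rw [adj_iff_sim (hfs i j).1, and_iff_right (hfs i j), hf.ne_iff]
      · exact hE i j
      · rw [SimpleGraph.adj_comm]
        exact hE j i
      · change A.graph.Adj (g i) (g j) ↔ i ≠ j
        rw [adj_iff_sim (hgs i j).1, and_iff_right (hgs i j), hg.ne_iff]

theorem crossCompl_twoCliques (m n : ℕ) (E : Fin m → Fin n → Prop) :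
    (twoCliques m n E).crossCompl = twoCliques m n fun i j => ¬ E i j := by
  unfold crossCompl twoCliques
  congr 1
  ext x y
  rcases x with i | i <;> rcases y with j | j <;> simp

theorem injective_pair {α : Type*} {x y : α} (h : x ≠ y) : Function.Injective ![x, y] := by
  intro i j
  fin_cases i <;> fin_cases j <;> simp [h, h.symm]

theorem injective_triple {α : Type*} {x y z : α} (h : x ≠ y) (h' : x ≠ z) (h'' : y ≠ z) :
    Function.Injective ![x, y, z] := by
  intro i j
  fin_cases i <;> fin_cases j <;> simp [h, h.symm, h', h'.symm, h'', h''.symm]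

theorem omitted_monoK_two {A : TwoColGraph.{u}} {c : Color} :
    Omitted (monoK c 2) A ↔ ∀ x y, A.color x = c → A.Sim x y → x = y := by
  rw [omitted_monoK]
  constructor
  · intro h x y hx hxy
    by_contra hne
    refine h ⟨![x, y], injective_pair hne, ?_, ?_⟩
    · intro i
      fin_cases i
      exacts [hx, hxy.1.symm.trans hx]
    · intro i j
      fin_cases i <;> fin_cases j
      exacts [Sim.refl _, hxy, hxy.symm, Sim.refl _]
  · rintro h ⟨f, hf, hfc, hfs⟩
    exact absurd (hf (h _ _ (hfc 0) (hfs 0 1))) (by simp)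

theorem omitted_monoK_three {A : TwoColGraph.{u}} (hA : ∀ c, A.ClassIsCliques c) {c : Color} :
    Omitted (monoK c 3) A ↔
      ∀ x y z, A.color x = c → A.Sim x y → A.Sim x z → x = y ∨ x = z ∨ y = z := by
  rw [omitted_monoK]
  constructor
  · intro h x y z hx hxy hxz
    by_contra hne
    push Not at hne
    have hyz := hxy.symm.trans hA hxz
    refine h ⟨![x, y, z], injective_triple hne.1 hne.2.1 hne.2.2, ?_, ?_⟩
    · intro i
      fin_cases i
      exacts [hx, hxy.1.symm.trans hx, hxz.1.symm.trans hx]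
    · intro i j
      fin_cases i <;> fin_cases j
      exacts [Sim.refl _, hxy, hxz, hxy.symm, Sim.refl _, hyz, hxz.symm, hyz.symm, Sim.refl _]
  · rintro h ⟨f, hf, hfc, hfs⟩
    rcases h _ _ _ (hfc 0) (hfs 0 1) (hfs 0 2) with h | h | h <;> exact absurd (hf h) (by simp)

theorem omitted_Tr_iff {A : TwoColGraph.{u}} (p : Prop) :
    Omitted (twoCliques 2 1 fun _ _ => p) A ↔ ∀ x y z, A.color x = .red → A.color z = .blue →
      A.Sim x y → x ≠ y → (A.graph.Adj x z ↔ p) → ¬ (A.graph.Adj y z ↔ p) := by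
  rw [omitted_twoCliques]
  constructor
  · intro h x y z hx hz hxy hne hxz hyz
    refine h ⟨![x, y], ![z], injective_pair hne, Function.injective_of_subsingleton _,
      ?_, ?_, ?_, ?_, ?_⟩
    · intro i
      fin_cases i
      exacts [hx, hxy.1.symm.trans hx]
    · intro i
      fin_cases i
      exact hz
    · intro i j
      fin_cases i <;> fin_cases j
      exacts [Sim.refl _, hxy, hxy.symm, Sim.refl _]
    · intro i j
      fin_cases i; fin_cases j
      exact Sim.refl _
    · intro i j
      fin_cases i <;> fin_cases j
      exacts [hxz, hyz]
  · rintro h ⟨f, g, hf, hg, hfc, hgc, hfs, hgs, hE⟩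
    exact h _ _ _ (hfc 0) (hgc 0) (hfs 0 1) (hf.ne (by simp)) (hE 0 0) (hE 1 0)

theorem omitted_Tb_iff {A : TwoColGraph.{u}} (p : Prop) :
    Omitted (twoCliques 1 2 fun _ _ => p) A ↔ ∀ x y z, A.color x = .blue → A.color z = .red →
      A.Sim x y → x ≠ y → (A.graph.Adj x z ↔ p) → ¬ (A.graph.Adj y z ↔ p) := by
  rw [omitted_twoCliques]
  constructor
  · intro h x y z hx hz hxy hne hxz hyz
    rw [SimpleGraph.adj_comm] at hxz hyz
    refine h ⟨![z], ![x, y], Function.injective_of_subsingleton _, injective_pair hne,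
      ?_, ?_, ?_, ?_, ?_⟩
    · intro i
      fin_cases i
      exact hz
    · intro i
      fin_cases i
      exacts [hx, hxy.1.symm.trans hx]
    · intro i j
      fin_cases i; fin_cases j
      exact Sim.refl _
    · intro i j
      fin_cases i <;> fin_cases j
      exacts [Sim.refl _, hxy, hxy.symm, Sim.refl _]
    · intro i j
      fin_cases i; fin_cases j
      exacts [hxz, hyz]
  · rintro h ⟨f, g, hf, hg, hfc, hgc, hfs, hgs, hE⟩
    refine h _ _ _ (hgc 0) (hfc 0) (hgs 0 1) (hg.ne (by simp)) ?_ ?_ <;> rw [SimpleGraph.adj_comm]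
    exacts [hE 0 0, hE 0 1]

theorem omitted_D_iff {A : TwoColGraph.{u}} (p : Prop) :
    Omitted (twoCliques 2 2 fun i j => ¬ (i = 1 ∧ j = 1) ↔ p) A ↔
      ∀ x x' y y', A.color x = .red → A.color y = .blue → A.Sim x x' → A.Sim y y' → x ≠ x' →
        y ≠ y' → (A.graph.Adj x y ↔ p) → (A.graph.Adj x y' ↔ p) → (A.graph.Adj x' y ↔ p) →
        (A.graph.Adj x' y' ↔ p) := by
  rw [omitted_twoCliques]
  constructor
  · intro h x x' y y' hx hy hxx hyy hx' hy' h1 h2 h3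
    by_contra h4
    refine h ⟨![x, x'], ![y, y'], injective_pair hx', injective_pair hy', ?_, ?_, ?_, ?_, ?_⟩
    · intro i
      fin_cases i
      exacts [hx, hxx.1.symm.trans hx]
    · intro i
      fin_cases i
      exacts [hy, hyy.1.symm.trans hy]
    · intro i j
      fin_cases i <;> fin_cases j
      exacts [Sim.refl _, hxx, hxx.symm, Sim.refl _]
    · intro i j
      fin_cases i <;> fin_cases j
      exacts [Sim.refl _, hyy, hyy.symm, Sim.refl _]
    · intro i j
      have h4' : A.graph.Adj x' y' ↔ ¬ p := by tauto
      fin_cases i <;> fin_cases j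
      exacts [by simpa using h1, by simpa using h2, by simpa using h3, by simpa using h4']
  · rintro h ⟨f, g, hf, hg, hfc, hgc, hfs, hgs, hE⟩
    have := h _ _ _ _ (hfc 0) (hgc 0) (hfs 0 1) (hgs 0 1) (hf.ne (by simp)) (hg.ne (by simp))
      (by simpa using hE 0 0) (by simpa using hE 0 1) (by simpa using hE 1 0)
    have h4 := hE 1 1
    rw [this] at h4
    by_cases hp : p <;> simp [hp] at h4

theorem D_eq : D = twoCliques 2 2 fun i j => ¬ (i = 1 ∧ j = 1) ↔ True := by
  exact congrArg (twoCliques 2 2) (funext fun _ => funext fun _ => (iff_true _).symm)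

theorem crossCompl_D_eq : D.crossCompl = twoCliques 2 2 fun i j => ¬ (i = 1 ∧ j = 1) ↔ False := by
  exact (crossCompl_twoCliques 2 2 _).trans
    (congrArg (twoCliques 2 2) (funext fun _ => funext fun _ => (iff_false _).symm))

/-- The two vertices of a clique of colour `c` have complementary neighbourhoods. -/
def MatesAreComplementary (A : TwoColGraph.{u}) (c : Color) : Prop :=
  ∀ x y z, A.color x = c → A.color z ≠ c → A.Sim x y → x ≠ y →
    (A.graph.Adj x z ↔ ¬ A.graph.Adj y z)

theorem omitted_Tr {A : TwoColGraph.{u}} :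
    Omitted Tr A ∧ Omitted Tr.crossCompl A ↔ A.MatesAreComplementary .red := by
  have h1 : Tr = twoCliques 2 1 fun _ _ => True := rfl
  rw [h1, crossCompl_twoCliques, omitted_Tr_iff, omitted_Tr_iff]
  constructor
  · rintro ⟨h, h'⟩ x y z hx hz hxy hne
    have hz' : A.color z = .blue := Color.eq_of_ne_of_ne hz (by simp)
    have := h x y z hx hz' hxy hne
    have := h' x y z hx hz' hxy hne
    tauto
  · intro h
    refine ⟨fun x y z hx hz hxy hne => ?_, fun x y z hx hz hxy hne => ?_⟩ <;>
    · have := h x y z hx (by simp [hz]) hxy hne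
      tauto

theorem omitted_Tb {A : TwoColGraph.{u}} :
    Omitted Tb A ∧ Omitted Tb.crossCompl A ↔ A.MatesAreComplementary .blue := by
  have h1 : Tb = twoCliques 1 2 fun _ _ => True := rfl
  rw [h1, crossCompl_twoCliques, omitted_Tb_iff, omitted_Tb_iff]
  constructor
  · rintro ⟨h, h'⟩ x y z hx hz hxy hne
    have hz' : A.color z = .red := Color.eq_of_ne_of_ne hz (by simp)
    have := h x y z hx hz' hxy hne
    have := h' x y z hx hz' hxy hne
    tauto
  · intro h
    refine ⟨fun x y z hx hz hxy hne => ?_, fun x y z hx hz hxy hne => ?_⟩ <;>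
    · have := h x y z hx (by simp [hz]) hxy hne
      tauto

theorem omitted_monoKbar_iff_bound {A : TwoColGraph.{u}} {c : Color} {k : ℕ} :
    Omitted (monoKbar c (k + 1)) A ↔ ∀ t : Finset A.V, (∀ x ∈ t, A.color x = c) →
      (∀ x ∈ t, ∀ y ∈ t, A.Sim x y → x = y) → (t.card : ℕ∞) ≤ k := by
  classical
  rw [omitted_monoKbar]
  constructor
  · intro h t ht hi
    by_contra hcard
    rw [Nat.cast_le, not_le, Nat.lt_iff_add_one_le] at hcard
    obtain ⟨t', ht', hcard'⟩ := Finset.exists_subset_card_eq hcard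
    let e := (Finset.equivFinOfCardEq hcard').symm
    refine h ⟨fun i => e i, fun i => ht _ (ht' (e i).2), fun i j hij => ?_⟩
    exact e.injective (Subtype.ext (hi _ (ht' (e i).2) _ (ht' (e j).2) hij))
  · rintro h ⟨f, hfc, hfi⟩
    have hf : Function.Injective f := fun i j hij => hfi i j (hij ▸ Sim.refl _)
    have := h (Finset.univ.map ⟨f, hf⟩) (by simpa using hfc) (by
      simp only [Finset.mem_map, Finset.mem_univ, true_and, Function.Embedding.coeFn_mk]
      rintro _ ⟨i, rfl⟩ _ ⟨j, rfl⟩ hij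
      rw [hfi i j hij])
    rw [Finset.card_map, Finset.card_univ, Fintype.card_fin, Nat.cast_le] at this
    omega

/-- The condition that `InClass` imposes on the cliques of one colour. -/
def SizeCondition (A : TwoColGraph.{u}) (c : Color) : CliqueSize → Prop
  | .one => ∀ x y, A.color x = c → A.Sim x y → x = y
  | .two => (∀ x y z, A.color x = c → A.Sim x y → A.Sim x z → x = y ∨ x = z ∨ y = z) ∧
      A.MatesAreComplementary c
  | .many => True

/-- The parity condition on the cross edges between two cliques. -/
def CrossParity (A : TwoColGraph.{u}) : Prop :=
  ∀ ⦃x x' y y' : A.V⦄, A.Sim x x' → A.Sim y y' → A.color x ≠ A.color y →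
    ((A.graph.Adj x y ↔ A.graph.Adj x' y) ↔ (A.graph.Adj x y' ↔ A.graph.Adj x' y'))

theorem inClass_iff {A : TwoColGraph.{u}} : InClass s κ A ↔ (∀ c, A.ClassIsCliques c) ∧
    A.CrossParity ∧ (∀ c, A.SizeCondition c (s c)) ∧ ∀ (c : Color) (t : Finset A.V),
      (∀ x ∈ t, A.color x = c) → (∀ x ∈ t, ∀ y ∈ t, A.Sim x y → x = y) → (t.card : ℕ∞) ≤ κ c := by
  constructor
  · intro h
    refine ⟨h.cliques, fun _ _ _ _ => h.parity, fun c => ?_, h.bound⟩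
    cases hs : s c with
    | one => exact fun x y hx => h.one (hx ▸ hs)
    | two => exact ⟨fun x y z hx => h.two (hx ▸ hs),
        fun x y z hx hz hxy hne => h.mates (hx ▸ hs) hxy hne (hx ▸ hz)⟩
    | many => trivial
  · rintro ⟨h1, h2, h3, h4⟩
    refine ⟨h1, fun {_ _ _ _} => @h2 _ _ _ _, fun {x y} hs hxy => ?_, fun {x y z} hs hxy hxz => ?_,
      fun {x y z} hs hxy hne hz => ?_, h4⟩
    · have := h3 (A.color x)
      rw [hs] at this
      exact this x y rfl hxy
    · have := h3 (A.color x)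
      rw [hs] at this
      exact this.1 x y z rfl hxy hxz
    · have := h3 (A.color x)
      rw [hs] at this
      exact this.2 x y z rfl hz hxy hne

theorem crossParity_of_one {A : TwoColGraph.{u}} {c : Color} (h : A.SizeCondition c .one) :
    A.CrossParity := by
  intro x x' y y' hx hy hxy
  by_cases hxc : A.color x = c
  · rw [h x x' hxc hx]; simp
  · have hyc : A.color y = c := by
      by_contra hyc
      exact hxy (Color.eq_of_ne_of_ne hxc hyc)
    rw [h y y' hyc hy]

theorem crossParity_of_two {A : TwoColGraph.{u}} {c : Color} (h : A.SizeCondition c .two) :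
    A.CrossParity := by
  intro x x' y y' hx hy hxy
  by_cases hxx : x = x'
  · rw [hxx]; simp
  by_cases hyy : y = y'
  · rw [hyy]
  by_cases hxc : A.color x = c
  · have h1 := h.2 x x' y hxc (fun h => hxy (hxc.trans h.symm)) hx hxx
    have h2 := h.2 x x' y' hxc (fun h => hxy (hxc.trans (hy.1.trans h).symm)) hx hxx
    rw [h1, h2]; simp
  · have hyc : A.color y = c := by
      by_contra hyc
      exact hxy (Color.eq_of_ne_of_ne hxc hyc)
    have h1 := h.2 y y' x hyc hxc hy hyy
    have h2 := h.2 y y' x' hyc (hx.1 ▸ hxc) hy hyy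
    rw [A.graph.adj_comm x, A.graph.adj_comm x', A.graph.adj_comm x, A.graph.adj_comm x', h1, h2]
    exact not_iff_not

theorem crossParity_iff_omitted {A : TwoColGraph.{u}} :
    A.CrossParity ↔ Omitted D A ∧ Omitted D.crossCompl A := by
  rw [crossCompl_D_eq, D_eq, omitted_D_iff, omitted_D_iff]
  constructor
  · intro h
    constructor <;>
    · intro x x' y y' hx hy hxx hyy _ _ h1 h2 h3
      have := h hxx hyy (by rw [hx, hy]; simp)
      tauto
  · rintro ⟨h, h'⟩
    have key : ∀ x x' y y' : A.V, A.Sim x x' → A.Sim y y' → A.color x = .red → A.color y = .blue →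
        ((A.graph.Adj x y ↔ A.graph.Adj x' y) ↔ (A.graph.Adj x y' ↔ A.graph.Adj x' y')) := by
      intro x x' y y' hx hy hxc hyc
      by_cases hxx : x = x'
      · rw [hxx]; simp
      by_cases hyy : y = y'
      · rw [hyy]
      have hxc' := hx.1.symm.trans hxc
      have hyc' := hy.1.symm.trans hyc
      simp only [iff_true, iff_false] at h h'
      -- any three of the four possible edges determine the fourth
      have a1 := h x x' y y' hxc hyc hx hy hxx hyy
      have a2 := h x x' y' y hxc hyc' hx hy.symm hxx (Ne.symm hyy)
      have a3 := h x' x y y' hxc' hyc hx.symm hy (Ne.symm hxx) hyy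
      have a4 := h x' x y' y hxc' hyc' hx.symm hy.symm (Ne.symm hxx) (Ne.symm hyy)
      have b1 := h' x x' y y' hxc hyc hx hy hxx hyy
      have b2 := h' x x' y' y hxc hyc' hx hy.symm hxx (Ne.symm hyy)
      have b3 := h' x' x y y' hxc' hyc hx.symm hy (Ne.symm hxx) hyy
      have b4 := h' x' x y' y hxc' hyc' hx.symm hy.symm (Ne.symm hxx) (Ne.symm hyy)
      clear h h'
      grind
    intro x x' y y' hx hy hxy
    cases hxc : A.color x
    · exact key x x' y y' hx hy hxc (Color.eq_of_ne_of_ne (hxc ▸ hxy.symm) (by simp))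
    · have := key y y' x x' hy hx (Color.eq_of_ne_of_ne (hxc ▸ hxy.symm) (by simp)) hxc
      rw [A.graph.adj_comm x, A.graph.adj_comm x', A.graph.adj_comm x, A.graph.adj_comm x']
      exact parity_comm.1 this

/-- Clique sizes prescribed separately for the two colours. -/
def sizes (r b : CliqueSize) : Color → CliqueSize
  | .red => r
  | .blue => b

/-- The bound `k` on the number of red cliques, and no bound on the number of blue ones. -/
def redBound (k : ℕ∞) : Color → ℕ∞
  | .red => k
  | .blue => ⊤

theorem inClass_sizes_iff {A : TwoColGraph.{u}} {r b : CliqueSize} {k : ℕ∞} :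
    InClass (sizes r b) (redBound k) A ↔ (∀ c, A.ClassIsCliques c) ∧ A.CrossParity ∧
      (A.SizeCondition .red r ∧ A.SizeCondition .blue b) ∧ ∀ (t : Finset A.V),
      (∀ x ∈ t, A.color x = .red) → (∀ x ∈ t, ∀ y ∈ t, A.Sim x y → x = y) →
        (t.card : ℕ∞) ≤ k := by
  rw [inClass_iff]
  refine and_congr Iff.rfl (and_congr Iff.rfl (and_congr ?_ ?_))
  · exact ⟨fun h => ⟨h .red, h .blue⟩, fun h c => by cases c; exacts [h.1, h.2]⟩
  · exact ⟨fun h => h .red, fun h c => by cases c; exacts [h, fun _ _ _ => le_top]⟩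

theorem classOmitting_eq {F : Set TwoColGraph.{0}} {r b : CliqueSize} {k : ℕ∞}
    (h : ∀ A : TwoColGraph.{u}, (∀ c, A.ClassIsCliques c) → ((∀ H ∈ F, Omitted H A) ↔
      A.CrossParity ∧ (A.SizeCondition .red r ∧ A.SizeCondition .blue b) ∧ ∀ (t : Finset A.V),
      (∀ x ∈ t, A.color x = .red) → (∀ x ∈ t, ∀ y ∈ t, A.Sim x y → x = y) →
        (t.card : ℕ∞) ≤ k)) :
    classOmitting.{u} F = finClass (sizes r b) (redBound k) := by
  ext M
  refine exists_congr fun A => and_congr Iff.rfl ?_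
  rw [inClass_sizes_iff, ← and_assoc]
  refine and_congr ⟨fun hA => ⟨hA.1, (h A hA.1).1 hA.2⟩, fun hA => ⟨hA.1, (h A hA.1).2 hA.2⟩⟩ Iff.rfl

theorem bound_top {A : TwoColGraph.{u}} : (∀ (t : Finset A.V),
    (∀ x ∈ t, A.color x = .red) → (∀ x ∈ t, ∀ y ∈ t, A.Sim x y → x = y) →
      (t.card : ℕ∞) ≤ ⊤) ↔ True := iff_true_intro fun _ _ _ => le_top

theorem classInfOneFin_eq (k : ℕ) :
    classInfOneFin.{u} k = finClass (sizes .many .one) (redBound k) := by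
  refine classOmitting_eq fun A hA => ?_
  simp only [Set.mem_insert_iff, Set.mem_singleton_iff, forall_eq_or_imp, forall_eq,
    omitted_monoK_two, omitted_monoKbar_iff_bound]
  constructor
  · exact fun h => ⟨crossParity_of_one (c := .blue) h.2, ⟨trivial, h.2⟩, h.1⟩
  · exact fun h => ⟨h.2.2, h.2.1.2⟩

theorem classInfTwoFin_eq (k : ℕ) :
    classInfTwoFin.{u} k = finClass (sizes .many .two) (redBound k) := by
  refine classOmitting_eq fun A hA => ?_
  simp only [Set.mem_insert_iff, Set.mem_singleton_iff, forall_eq_or_imp, forall_eq,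
    omitted_monoK_three hA, omitted_monoKbar_iff_bound, omitted_Tb]
  constructor
  · exact fun h => ⟨crossParity_of_two (c := .blue) h.2, ⟨trivial, h.2⟩, h.1⟩
  · exact fun h => ⟨h.2.2, h.2.1.2⟩

theorem classTwoOne_eq : classTwoOne.{u} = finClass (sizes .two .one) (redBound ⊤) := by
  refine classOmitting_eq fun A hA => ?_
  simp only [Set.mem_insert_iff, Set.mem_singleton_iff, forall_eq_or_imp, forall_eq,
    omitted_monoK_three hA, omitted_monoK_two, omitted_Tr, bound_top]
  constructor
  · exact fun h => ⟨crossParity_of_one (c := .blue) h.2.1, ⟨⟨h.1, h.2.2⟩, h.2.1⟩, trivial⟩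
  · exact fun h => ⟨h.2.1.1.1, h.2.1.2, h.2.1.1.2⟩

theorem classInfOne_eq : classInfOne.{u} = finClass (sizes .many .one) (redBound ⊤) := by
  refine classOmitting_eq fun A hA => ?_
  simp only [Set.mem_singleton_iff, forall_eq, omitted_monoK_two, bound_top]
  constructor
  · exact fun h => ⟨crossParity_of_one (c := .blue) h, ⟨trivial, h⟩, trivial⟩
  · exact fun h => h.2.1.2

theorem classTwoTwo_eq : classTwoTwo.{u} = finClass (sizes .two .two) (redBound ⊤) := by
  refine classOmitting_eq fun A hA => ?_
  simp only [Set.mem_insert_iff, Set.mem_singleton_iff, forall_eq_or_imp, forall_eq,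
    omitted_monoK_three hA, omitted_Tb, bound_top]
  rw [← and_assoc (a := Omitted Tr A), omitted_Tr]
  constructor
  · exact fun h => ⟨crossParity_of_two (c := .blue) ⟨h.2.1, h.2.2.2⟩,
      ⟨⟨h.1, h.2.2.1⟩, h.2.1, h.2.2.2⟩, trivial⟩
  · exact fun h => ⟨h.2.1.1.1, h.2.1.2.1, h.2.1.1.2, h.2.1.2.2⟩

theorem classInfTwo_eq : classInfTwo.{u} = finClass (sizes .many .two) (redBound ⊤) := by
  refine classOmitting_eq fun A hA => ?_
  simp only [Set.mem_insert_iff, Set.mem_singleton_iff, forall_eq_or_imp, forall_eq,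
    omitted_monoK_three hA, omitted_Tb, bound_top]
  constructor
  · exact fun h => ⟨crossParity_of_two (c := .blue) h, ⟨trivial, h⟩, trivial⟩
  · exact fun h => h.2.1.2

theorem classInfInf_eq : classInfInf.{u} = finClass (sizes .many .many) (redBound ⊤) := by
  refine classOmitting_eq fun A hA => ?_
  simp only [Set.mem_insert_iff, Set.mem_singleton_iff, forall_eq_or_imp, forall_eq,
    ← crossParity_iff_omitted, bound_top]
  exact ⟨fun h => ⟨h, ⟨trivial, trivial⟩, trivial⟩, fun h => h.1⟩

theorem admissible_top (r b : CliqueSize) : Admissible (sizes r b) (redBound ⊤) := by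
  intro c d _ h
  cases c <;> exact absurd rfl h

theorem admissible_many {b : CliqueSize} (hb : b ≠ .many) (k : ℕ∞) :
    Admissible (sizes .many b) (redBound k) := by
  intro c d hcd h
  cases c
  · cases d
    · exact absurd rfl hcd
    · exact ⟨rfl, hb⟩
  · exact absurd rfl h

end TwoColGraph

namespace TwoColGraph

/-! ### Homogeneous graphs without twins -/

/-- The standing assumptions on the graphs to be classified.  Two vertices in a clique never have
the same neighbours in the other colour class; this is what is left of not being a blow-up. -/
structure IsReduced (G : TwoColGraph.{u}) : Prop where
  homogeneous : G.Homogeneous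
  cliques : ∀ c, G.ClassIsCliques c
  infinite : Infinite G.V
  twinFree : ∀ x y, G.Sim x y → x ≠ y →
    ∃ z, G.color z ≠ G.color x ∧ ¬ (G.graph.Adj x z ↔ G.graph.Adj y z)
  exists_not_sim : ∀ c, ∃ x y, G.color x = c ∧ G.color y = c ∧ ¬ G.Sim x y

/-- Some clique of colour `c` has at least two vertices. -/
def HasEdge (G : TwoColGraph.{u}) (c : Color) : Prop :=
  ∃ x y, G.color x = c ∧ G.Sim x y ∧ x ≠ y

/-- Some clique of colour `c` has at least three vertices. -/
def HasTriangle (G : TwoColGraph.{u}) (c : Color) : Prop :=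
  ∃ x y z, G.color x = c ∧ G.Sim x y ∧ G.Sim x z ∧ x ≠ y ∧ x ≠ z ∧ y ≠ z

/-- There are infinitely many cliques of colour `c`. -/
def ManyCliques (G : TwoColGraph.{u}) (c : Color) : Prop :=
  ∀ X : Finset G.V, ∃ x, G.color x = c ∧ ∀ y ∈ X, ¬ G.Sim y x

/-- The pairs `p = (x, x')` and `q = (y, y')` are compatible with a partial isomorphism that maps
`x` to `x'` and `y` to `y'`. -/
def Compatible (G : TwoColGraph.{u}) (p q : G.V × G.V) : Prop :=
  (p.1 = q.1 ↔ p.2 = q.2) ∧ (G.graph.Adj p.1 q.1 ↔ G.graph.Adj p.2 q.2)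

section

variable {G : TwoColGraph.{u}}

theorem compatible_of_ne {x y x' y' : G.V} (hx : G.color x' = G.color x)
    (hy : G.color y' = G.color y) (hxy : G.color x ≠ G.color y)
    (h : G.graph.Adj x y ↔ G.graph.Adj x' y') : G.Compatible (x, x') (y, y') := by
  refine ⟨iff_of_false (fun h => hxy (congrArg G.color h)) (fun h => hxy ?_), h⟩
  rw [← hx, ← hy]
  exact congrArg G.color h

theorem compatible_of_sim {x y x' y' : G.V} (h : G.Sim x y) (h' : G.Sim x' y') (hne : x ≠ y)
    (hne' : x' ≠ y') : G.Compatible (x, x') (y, y') :=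
  ⟨iff_of_false hne hne', iff_of_true (h.2.resolve_left hne) (h'.2.resolve_left hne')⟩

theorem compatible_of_not_sim {x y x' y' : G.V} (hc : G.color x = G.color y)
    (hc' : G.color x' = G.color y') (h : ¬ G.Sim x y) (h' : ¬ G.Sim x' y') :
    G.Compatible (x, x') (y, y') :=
  ⟨iff_of_false (fun e : x = y => h (e ▸ Sim.refl _)) (fun e : x' = y' => h' (e ▸ Sim.refl _)),
    iff_of_false (fun e => h ⟨hc, Or.inr e⟩) (fun e => h' ⟨hc', Or.inr e⟩)⟩

namespace Homogeneous

/-- Homogeneity for a finite list of pairs `(x, g x)`. -/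
theorem exists_aut_of_list (hG : G.Homogeneous) (l : List (G.V × G.V))
    (hc : ∀ p ∈ l, G.color p.2 = G.color p.1) (hl : l.Pairwise G.Compatible) :
    ∃ g, G.IsAut g ∧ ∀ p ∈ l, g p.1 = p.2 := by
  classical
  have hok : ∀ p ∈ l, ∀ q ∈ l, G.Compatible p q := fun p hp q hq =>
    have : Std.Symm G.Compatible := ⟨fun p q h => ⟨eq_comm.trans (h.1.trans eq_comm), by
      rw [SimpleGraph.adj_comm, h.2, SimpleGraph.adj_comm]⟩⟩
    List.Pairwise.forall_of_forall (R := G.Compatible) (fun p _ => ⟨by simp, by simp⟩) hl hp hq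
  have hex : ∀ x, ∃ y, ∀ p ∈ l, p.1 = x → p.2 = y := fun x => by
    by_cases h : ∃ p ∈ l, p.1 = x
    · obtain ⟨p, hp, rfl⟩ := h
      exact ⟨p.2, fun q hq hqp => (hok q hq p hp).1.1 hqp⟩
    · exact ⟨x, fun p hp hpx => absurd ⟨p, hp, hpx⟩ h⟩
  choose f hf using hex
  have hf' : ∀ p ∈ l, f p.1 = p.2 := fun p hp => (hf p.1 p hp rfl).symm
  have hmem : ∀ x ∈ ((l.map Prod.fst).toFinset : Set G.V), ∃ p ∈ l, p.1 = x := fun x hx => by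
    rw [Finset.mem_coe, List.mem_toFinset, List.mem_map] at hx
    exact hx
  obtain ⟨g, hg, hgf⟩ := hG (l.map Prod.fst).toFinset f
    { inj := by
        intro x hx y hy hxy
        obtain ⟨p, hp, rfl⟩ := hmem x hx
        obtain ⟨q, hq, rfl⟩ := hmem y hy
        rw [hf' p hp, hf' q hq] at hxy
        exact (hok p hp q hq).1.2 hxy
      color := by
        intro x hx
        obtain ⟨p, hp, rfl⟩ := hmem x hx
        rw [hf' p hp, hc p hp]
      adj := by
        intro x hx y hy
        obtain ⟨p, hp, rfl⟩ := hmem x hx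
        obtain ⟨q, hq, rfl⟩ := hmem y hy
        rw [hf' p hp, hf' q hq, (hok p hp q hq).2] }
  refine ⟨g, hg, fun p hp => ?_⟩
  rw [hgf p.1 (List.mem_toFinset.2 (List.mem_map.2 ⟨p, hp, rfl⟩)), hf' p hp]

/-- Homogeneity for a map that fixes a finite set of vertices of colour `c` and moves a finite set
of vertices of the other colour. -/
theorem exists_aut_fixing (hG : G.Homogeneous) {c : Color} {W S : Finset G.V} {f : G.V → G.V}
    (hW : ∀ w ∈ W, G.color w = c) (hS : ∀ b ∈ S, G.color b ≠ c) (hf : ∀ b ∈ S, G.color (f b) ≠ c)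
    (hinj : ∀ b ∈ S, ∀ b' ∈ S, f b = f b' → b = b')
    (hsim : ∀ b ∈ S, ∀ b' ∈ S, (G.Sim (f b) (f b') ↔ G.Sim b b'))
    (hadj : ∀ w ∈ W, ∀ b ∈ S, (G.graph.Adj w (f b) ↔ G.graph.Adj w b)) :
    ∃ g, G.IsAut g ∧ (∀ w ∈ W, g w = w) ∧ ∀ b ∈ S, g b = f b := by
  classical
  let F : G.V → G.V := fun x => if G.color x = c then x else f x
  have hFW : ∀ w ∈ W, F w = w := fun w hw => if_pos (hW w hw)
  have hFS : ∀ b ∈ S, F b = f b := fun b hb => if_neg (hS b hb)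
  obtain ⟨g, hg, hgF⟩ := hG (W ∪ S) F
    { inj := by
        intro x hx y hy hxy
        rw [Finset.mem_coe, Finset.mem_union] at hx hy
        rcases hx with hx | hx <;> rcases hy with hy | hy
        · rwa [hFW x hx, hFW y hy] at hxy
        · rw [hFW x hx, hFS y hy] at hxy
          exact absurd (hxy ▸ hW x hx) (hf y hy)
        · rw [hFS x hx, hFW y hy] at hxy
          exact absurd (hxy ▸ hW y hy) (hf x hx)
        · rw [hFS x hx, hFS y hy] at hxy
          exact hinj x hx y hy hxy
      color := by
        intro x hx
        rw [Finset.mem_coe, Finset.mem_union] at hx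
        rcases hx with hx | hx
        · rw [hFW x hx]
        · rw [hFS x hx]
          exact Color.eq_of_ne_of_ne (hf x hx) (hS x hx)
      adj := by
        intro x hx y hy
        rw [Finset.mem_coe, Finset.mem_union] at hx hy
        rcases hx with hx | hx <;> rcases hy with hy | hy
        · rw [hFW x hx, hFW y hy]
        · rw [hFW x hx, hFS y hy, hadj x hx y hy]
        · rw [hFS x hx, hFW y hy, SimpleGraph.adj_comm, hadj y hy x hx, SimpleGraph.adj_comm]
        · rw [hFS x hx, hFS y hy, adj_iff_sim (Color.eq_of_ne_of_ne (hf x hx) (hf y hy)),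
            adj_iff_sim (Color.eq_of_ne_of_ne (hS x hx) (hS y hy)), hsim x hx y hy]
          exact and_congr_right fun _ => not_congr
            ⟨fun h => hinj x hx y hy h, fun h => h ▸ rfl⟩ }
  exact ⟨g, hg, fun w hw => (hgF w (Finset.mem_union_left _ hw)).trans (hFW w hw),
    fun b hb => (hgF b (Finset.mem_union_right _ hb)).trans (hFS b hb)⟩

theorem exists_aut_vertex (hG : G.Homogeneous) {x x' : G.V} (h : G.color x' = G.color x) :
    ∃ g, G.IsAut g ∧ g x = x' := by
  obtain ⟨g, hg, h⟩ := hG.exists_aut_of_list [(x, x')] (by simpa using h) (by simp)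
  exact ⟨g, hg, h (x, x') (by simp)⟩

theorem exists_aut_pair (hG : G.Homogeneous) {x y x' y' : G.V} (hx : G.color x' = G.color x)
    (hy : G.color y' = G.color y) (h : G.Compatible (x, x') (y, y')) :
    ∃ g, G.IsAut g ∧ g x = x' ∧ g y = y' := by
  obtain ⟨g, hg, h⟩ := hG.exists_aut_of_list [(x, x'), (y, y')] (by simp [hx, hy]) (by simpa using h)
  exact ⟨g, hg, h (x, x') (by simp), h (y, y') (by simp)⟩

theorem exists_aut_triple (hG : G.Homogeneous) {x y z x' y' z' : G.V}
    (hx : G.color x' = G.color x) (hy : G.color y' = G.color y) (hz : G.color z' = G.color z)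
    (hxy : G.Compatible (x, x') (y, y')) (hxz : G.Compatible (x, x') (z, z'))
    (hyz : G.Compatible (y, y') (z, z')) : ∃ g, G.IsAut g ∧ g x = x' ∧ g y = y' ∧ g z = z' := by
  obtain ⟨g, hg, h⟩ := hG.exists_aut_of_list [(x, x'), (y, y'), (z, z')] (by simp [hx, hy, hz])
    (by simp [hxy, hxz, hyz])
  exact ⟨g, hg, h (x, x') (by simp), h (y, y') (by simp), h (z, z') (by simp)⟩

/-- Any two edges of the same colour are equivalent. -/
theorem exists_aut_edge (hG : G.Homogeneous) {x y x' y' : G.V} (h : G.Sim x y) (h' : G.Sim x' y')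
    (hne : x ≠ y) (hne' : x' ≠ y') (hc : G.color x' = G.color x) :
    ∃ g, G.IsAut g ∧ g x = x' ∧ g y = y' :=
  hG.exists_aut_pair hc (h'.1.symm.trans (hc.trans h.1)) (compatible_of_sim h h' hne hne')

/-- Any two pairs of edges in different cliques of the same colour are equivalent. -/
theorem exists_aut_edges (hG : G.Homogeneous) (hcl : ∀ c, G.ClassIsCliques c)
    {x y z w x' y' z' w' : G.V}
    (h : G.Sim x y) (h' : G.Sim x' y') (k : G.Sim z w) (k' : G.Sim z' w')
    (hne : x ≠ y) (hne' : x' ≠ y') (kne : z ≠ w) (kne' : z' ≠ w')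
    (hc : G.color x' = G.color x) (hz : G.color z = G.color x) (hz' : G.color z' = G.color x')
    (hn : ¬ G.Sim x z) (hn' : ¬ G.Sim x' z') :
    ∃ g, G.IsAut g ∧ g x = x' ∧ g y = y' ∧ g z = z' ∧ g w = w' := by
  have hy := h.1
  have hy' := h'.1
  have hw := k.1
  have hw' := k'.1
  have c1 : G.Compatible (x, x') (y, y') := compatible_of_sim h h' hne hne'
  have c2 : G.Compatible (z, z') (w, w') := compatible_of_sim k k' kne kne'
  have c3 : G.Compatible (x, x') (z, z') := compatible_of_not_sim hz.symm hz'.symm hn hn'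
  have c4 : G.Compatible (x, x') (w, w') := compatible_of_not_sim (hz.symm.trans hw)
    (hz'.symm.trans hw') (fun e => hn (e.trans hcl k.symm)) (fun e => hn' (e.trans hcl k'.symm))
  have c5 : G.Compatible (y, y') (z, z') := compatible_of_not_sim (hy.symm.trans hz.symm)
    (hy'.symm.trans hz'.symm) (fun e => hn (h.trans hcl e)) (fun e => hn' (h'.trans hcl e))
  have c6 : G.Compatible (y, y') (w, w') := compatible_of_not_sim
    (hy.symm.trans (hz.symm.trans hw)) (hy'.symm.trans (hz'.symm.trans hw'))
    (fun e => hn (h.trans hcl (e.trans hcl k.symm)))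
    (fun e => hn' (h'.trans hcl (e.trans hcl k'.symm)))
  obtain ⟨g, hg, h⟩ := hG.exists_aut_of_list [(x, x'), (y, y'), (z, z'), (w, w')]
    (by simp only [List.mem_cons, List.not_mem_nil, or_false, forall_eq_or_imp, forall_eq]
        exact ⟨hc, hy'.symm.trans (hc.trans hy), hz'.trans (hc.trans hz.symm),
          hw'.symm.trans (hz'.trans (hc.trans (hz.symm.trans hw)))⟩)
    (by simp [c1, c2, c3, c4, c5, c6])
  exact ⟨g, hg, h (x, x') (by simp), h (y, y') (by simp), h (z, z') (by simp), h (w, w') (by simp)⟩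

end Homogeneous

/-- Choosing images of the elements of a finite set one after the other, each unrelated to the
previous ones. -/
theorem exists_fresh_choice {α : Type*} {R : α → α → Prop} (hR : ∀ x y, R x y → R y x)
    {T : Finset α} {P : α → α → Prop}
    (h : ∀ t ∈ T, ∀ X : Finset α, ∃ b, P t b ∧ ∀ y ∈ X, ¬ R y b) (X : Finset α) :
    ∃ f : α → α, (∀ t ∈ T, P t (f t)) ∧ (∀ t ∈ T, ∀ y ∈ X, ¬ R y (f t)) ∧
      ∀ t ∈ T, ∀ t' ∈ T, R (f t) (f t') → t = t' := by
  classical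
  induction T using Finset.induction_on with
  | empty => exact ⟨id, by simp⟩
  | insert a T ha ih =>
    obtain ⟨f, hP, hX, hf⟩ := ih fun t ht => h t (Finset.mem_insert_of_mem ht)
    obtain ⟨b, hb, hbX⟩ := h a (Finset.mem_insert_self _ _) (X ∪ T.image f)
    have hne : ∀ t ∈ T, t ≠ a := fun t ht e => ha (e ▸ ht)
    have hfb : ∀ t ∈ T, ¬ R (f t) b := fun t ht =>
      hbX _ (Finset.mem_union_right _ (Finset.mem_image_of_mem f ht))
    refine ⟨Function.update f a b, fun t ht => ?_, fun t ht y hy => ?_, fun t ht t' ht' hs => ?_⟩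
    · rcases Finset.mem_insert.1 ht with rfl | ht
      · rwa [Function.update_self]
      · rw [Function.update_of_ne (hne t ht)]
        exact hP t ht
    · rcases Finset.mem_insert.1 ht with rfl | ht
      · rw [Function.update_self]
        exact hbX y (Finset.mem_union_left _ hy)
      · rw [Function.update_of_ne (hne t ht)]
        exact hX t ht y hy
    · rcases Finset.mem_insert.1 ht with e | ht <;> rcases Finset.mem_insert.1 ht' with e' | ht'
      · exact e.trans e'.symm
      · rw [e, Function.update_self, Function.update_of_ne (hne t' ht')] at hs
        exact absurd (hR _ _ hs) (hfb t' ht')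
      · rw [e', Function.update_self, Function.update_of_ne (hne t ht)] at hs
        exact absurd hs (hfb t ht)
      · rw [Function.update_of_ne (hne t ht), Function.update_of_ne (hne t' ht')] at hs
        exact hf t ht t' ht' hs

/-- Every finite set of vertices contains a set of representatives of the cliques that it meets. -/
theorem exists_transversal (S : Finset G.V) :
    ∃ T ⊆ S, (∀ t ∈ T, ∀ t' ∈ T, G.Sim t t' → t = t') ∧ ∀ x ∈ S, ∃ t ∈ T, G.Sim t x := by
  classical
  induction S using Finset.induction_on with
  | empty => exact ⟨∅, by simp⟩
  | insert a S ha ih =>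
    obtain ⟨T, hTS, hT, hST⟩ := ih
    by_cases h : ∃ t ∈ T, G.Sim t a
    · refine ⟨T, hTS.trans (Finset.subset_insert _ _), hT, fun x hx => ?_⟩
      rcases Finset.mem_insert.1 hx with rfl | hx
      exacts [h, hST x hx]
    · push Not at h
      refine ⟨insert a T, Finset.insert_subset_insert _ hTS, fun t ht t' ht' hs => ?_,
        fun x hx => ?_⟩
      · rcases Finset.mem_insert.1 ht with e | ht <;> rcases Finset.mem_insert.1 ht' with e' | ht'
        · exact e.trans e'.symm
        · exact absurd (e ▸ hs.symm) (h t' ht')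
        · exact absurd (e' ▸ hs) (h t ht)
        · exact hT t ht t' ht' hs
      · rcases Finset.mem_insert.1 hx with rfl | hx
        · exact ⟨x, Finset.mem_insert_self _ _, Sim.refl _⟩
        · obtain ⟨t, ht, hs⟩ := hST x hx
          exact ⟨t, Finset.mem_insert_of_mem ht, hs⟩

end

end TwoColGraph

namespace TwoColGraph

variable {G : TwoColGraph.{u}} {c d : Color}

namespace IsReduced

theorem sim_trans (hG : G.IsReduced) {x y z : G.V} (h : G.Sim x y) (h' : G.Sim y z) :
    G.Sim x z := h.trans hG.cliques h'

/-- Every edge within a colour class can be reversed by an automorphism. -/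
theorem exists_swap (hG : G.IsReduced) {x y : G.V} (h : G.Sim x y) (hne : x ≠ y) :
    ∃ g, G.IsAut g ∧ g x = y ∧ g y = x :=
  hG.homogeneous.exists_aut_edge h h.symm hne hne.symm h.1.symm

theorem exists_mate (hG : G.IsReduced) {x : G.V} (h : G.HasEdge (G.color x)) :
    ∃ y, G.Sim x y ∧ x ≠ y := by
  obtain ⟨a, b, hac, hab, hne⟩ := h
  obtain ⟨g, hg, rfl⟩ := hG.homogeneous.exists_aut_vertex (x := a) (x' := x) hac.symm
  exact ⟨g b, (hg.sim_iff _ _).2 hab, g.injective.ne hne⟩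

theorem exists_third (hG : G.IsReduced) {x y : G.V} (h : G.HasTriangle (G.color x))
    (hxy : G.Sim x y) (hne : x ≠ y) : ∃ z, G.Sim x z ∧ x ≠ z ∧ y ≠ z := by
  obtain ⟨a, b, e, hac, hab, hae, h1, h2, h3⟩ := h
  obtain ⟨g, hg, rfl, rfl⟩ := hG.homogeneous.exists_aut_edge hab hxy h1 hne hac.symm
  exact ⟨g e, (hg.sim_iff _ _).2 hae, g.injective.ne h2, g.injective.ne h3⟩

theorem exists_not_sim_left (hG : G.IsReduced) (x : G.V) :
    ∃ y, G.color y = G.color x ∧ ¬ G.Sim x y := by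
  obtain ⟨a, b, ha, hb, hab⟩ := hG.exists_not_sim (G.color x)
  by_cases h : G.Sim x a
  · exact ⟨b, hb, fun h' => hab (hG.sim_trans h.symm h')⟩
  · exact ⟨a, ha, h⟩

/-- Some vertex distinguishes the two ends of an edge in a prescribed way. -/
theorem exists_separating (hG : G.IsReduced) {x y : G.V} (h : G.Sim x y) (hne : x ≠ y) (p : Prop) :
    ∃ z, G.color z ≠ G.color x ∧ (G.graph.Adj x z ↔ p) ∧ (G.graph.Adj y z ↔ ¬ p) := by
  obtain ⟨z, hz, hxy⟩ := hG.twinFree x y h hne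
  obtain ⟨g, hg, hx, hy⟩ := hG.exists_swap h hne
  by_cases hp : G.graph.Adj x z ↔ p
  · exact ⟨z, hz, hp, by tauto⟩
  · refine ⟨g z, by rwa [hg.color], ?_, ?_⟩
    · rw [hg.adj_of_eq hy rfl]; tauto
    · rw [hg.adj_of_eq hx rfl]; tauto

/-- If the cliques of the colour of `r` are not single vertices, then each of them contains both
neighbours and non-neighbours of every vertex of the other colour. -/
theorem exists_sim_adj_iff (hG : G.IsReduced) {r b : G.V} (hr : G.HasEdge (G.color r))
    (hb : G.color b ≠ G.color r) (p : Prop) : ∃ r', G.Sim r r' ∧ (G.graph.Adj r' b ↔ p) := by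
  by_cases hp : G.graph.Adj r b ↔ p
  · exact ⟨r, Sim.refl r, hp⟩
  obtain ⟨x, hx, hne⟩ := hG.exists_mate hr
  obtain ⟨z, hz, h1, h2⟩ := hG.exists_separating hx hne (¬ p)
  have h3 : G.graph.Adj r z ↔ G.graph.Adj r b := by tauto
  obtain ⟨g, hg, hgr, hgz⟩ := hG.homogeneous.exists_aut_pair (x := r) (x' := r) (y := z) (y' := b) rfl
    (Color.eq_of_ne_of_ne hb hz) (compatible_of_ne rfl (Color.eq_of_ne_of_ne hb hz) hz.symm h3)
  refine ⟨g x, ?_, ?_⟩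
  · exact (hg.sim_of_eq hgr rfl).2 hx
  · rw [hg.adj_of_eq rfl hgz, h2, not_not]

/-- Infinitely many cliques contain vertices that are related to `r` and `r'` as prescribed by
`p` and `q`, where `r` and `r'` have the same colour. -/
def MeetsMany (G : TwoColGraph.{u}) (r r' : G.V) (p q : Prop) : Prop :=
  ∀ X : Finset G.V, ∃ b, (G.color b ≠ G.color r ∧ (G.graph.Adj r b ↔ p) ∧ (G.graph.Adj r' b ↔ q)) ∧
    ∀ y ∈ X, ¬ G.Sim y b

/-- If a pattern over an edge occurs at all, then it occurs in infinitely many cliques.  Otherwise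
the cliques in which the pattern occurs over an edge `e` form a finite set `J e`.  For edges in
different cliques, these sets intersect.  But an automorphism moves `J e` away from `J e` and
from `J f`, where `f` is an edge in another clique, and so the image of `e` would have to lie in the
clique of `e` and in the clique of `f`. -/
theorem meetsMany (hG : G.IsReduced) {r r' : G.V} {p q : Prop}
    (hd : ∀ d, d ≠ G.color r → G.ManyCliques d) (hr : G.Sim r r') (hne : r ≠ r')
    (h : ∃ b, G.color b ≠ G.color r ∧ (G.graph.Adj r b ↔ p) ∧ (G.graph.Adj r' b ↔ q)) :
    MeetsMany G r r' p q := by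
  classical
  have hedge : G.HasEdge (G.color r) := ⟨r, r', rfl, hr, hne⟩
  -- edges in different cliques have a vertex with the given pattern in common
  have share : ∀ s s', G.color s = G.color r → G.Sim s s' → s ≠ s' → ¬ G.Sim r s →
      ∃ b, G.color b ≠ G.color r ∧ (G.graph.Adj r b ↔ p) ∧ (G.graph.Adj r' b ↔ q) ∧
        (G.graph.Adj s b ↔ p) ∧ (G.graph.Adj s' b ↔ q) := by
    intro s s' hs hss hsne hrs
    obtain ⟨b, hb, hbr, hbr'⟩ := h
    obtain ⟨t, hst, ht⟩ := hG.exists_sim_adj_iff (r := s) (b := b) (hs.symm ▸ hedge) (hs.symm ▸ hb) p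
    have htc : G.color t = G.color r := hst.1.symm.trans hs
    obtain ⟨g, hg, hgr, hgb⟩ := hG.homogeneous.exists_aut_pair (x := r) (x' := t) (y := b)
      (y' := b) htc rfl (compatible_of_ne htc rfl hb.symm (hbr.trans ht.symm))
    have hrt : ¬ G.Sim r t := fun e => hrs (hG.sim_trans e hst.symm)
    obtain ⟨k, hk, k1, k2, k3, k4⟩ := hG.homogeneous.exists_aut_edges hG.cliques (x := r) (y := r')
      (z := t) (w := g r') (x' := r) (y' := r') (z' := s) (w' := s') hr hr
      ((hg.sim_of_eq hgr rfl).2 hr) hss hne hne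
      (by rw [← hgr]; exact g.injective.ne hne) hsne rfl htc hs hrt hrs
    refine ⟨k b, by rwa [hk.color], ?_, ?_, ?_, ?_⟩
    · rw [hk.adj_of_eq k1 rfl, hbr]
    · rw [hk.adj_of_eq k2 rfl, hbr']
    · rw [hk.adj_of_eq k3 rfl, ht]
    · rw [hk.adj_of_eq k4 rfl, hg.adj_of_eq rfl hgb, hbr']
  by_contra hfin
  simp only [MeetsMany, not_forall, not_exists, not_and, not_not] at hfin
  obtain ⟨X, hX⟩ := hfin
  obtain ⟨T, hTX, hT, hTc⟩ := exists_transversal (G := G) (X.filter fun x => G.color x ≠ G.color r)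
  have hTcol : ∀ t ∈ T, G.color t ≠ G.color r := fun t ht => (Finset.mem_filter.1 (hTX ht)).2
  have hJ : ∀ b, G.color b ≠ G.color r → (G.graph.Adj r b ↔ p) → (G.graph.Adj r' b ↔ q) →
      ∃ t ∈ T, G.Sim t b := fun b hb h1 h2 => by
    obtain ⟨y, hy, hyb⟩ := by simpa using hX b ⟨hb, h1, h2⟩
    obtain ⟨t, ht, hty⟩ := hTc y (Finset.mem_filter.2 ⟨hy, hyb.1 ▸ hb⟩)
    exact ⟨t, ht, hG.sim_trans hty hyb⟩
  -- an edge `(s, g₁ r')` in another clique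
  obtain ⟨s, hs, hrs⟩ := hG.exists_not_sim_left r
  obtain ⟨g₁, hg₁, hgs⟩ := hG.homogeneous.exists_aut_vertex hs
  obtain ⟨f, hfc, hfX, hfT⟩ := exists_fresh_choice (R := G.Sim) (fun _ _ => Sim.symm) (T := T)
    (P := fun _ b => G.color b ≠ G.color r) (fun t ht Y => by
      obtain ⟨b, hb, hbY⟩ := hd (G.color t) (hTcol t ht) Y
      exact ⟨b, hb ▸ hTcol t ht, hbY⟩) (T ∪ T.image g₁)
  obtain ⟨g₂, hg₂, -, hg₂f⟩ := hG.homogeneous.exists_aut_fixing (c := G.color r) (W := ∅) (S := T)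
    (f := f) (by simp) hTcol hfc (fun b hb b' hb' e => hfT b hb b' hb' (e ▸ Sim.refl _))
    (fun b hb b' hb' => ⟨fun e => hfT b hb b' hb' e ▸ Sim.refl _,
      fun e => hT b hb b' hb' e ▸ Sim.refl _⟩) (by simp)
  -- the edge `(g₂ r, g₂ r')` lies in the clique of each of the two edges considered so far
  have key : ∀ g : G.V ≃ G.V, G.IsAut g → (∀ t ∈ T, g t ∈ T ∪ T.image g₁) →
      G.Sim (g r) (g₂ r) := by
    intro g hg hgT
    by_contra hn
    have hn' : ¬ G.Sim r ((g₂.trans g.symm) r) := by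
      rw [← hg.sim_iff, Equiv.trans_apply, g.apply_symm_apply]
      exact hn
    have haut : ∀ x y, G.Sim ((g₂.trans g.symm) x) ((g₂.trans g.symm) y) ↔ G.Sim x y := by
      intro x y
      rw [Equiv.trans_apply, Equiv.trans_apply, hg.symm.sim_iff, hg₂.sim_iff]
    obtain ⟨b, hb, h1, h2, h3, h4⟩ := share _ ((g₂.trans g.symm) r')
      ((hg.symm.color _).trans (hg₂.color r)) ((haut _ _).2 hr)
      ((g₂.trans g.symm).injective.ne hne) hn'
    obtain ⟨t, ht, htb⟩ := hJ b hb h1 h2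
    have hb' : (g₂.trans g.symm) ((g₂.symm) (g b)) = b := by simp
    have hadj : ∀ x, G.graph.Adj ((g₂.trans g.symm) x) b ↔ G.graph.Adj x (g₂.symm (g b)) := by
      intro x
      rw [← hg.adj, ← hg₂.symm.adj]
      simp
    obtain ⟨t', ht', htb'⟩ := hJ (g₂.symm (g b)) (by rwa [hg₂.symm.color, hg.color])
      ((hadj r).symm.trans h3) ((hadj r').symm.trans h4)
    refine hfX t' ht' (g t) (hgT t ht) (hG.sim_trans ((hg.sim_iff _ _).2 htb) ?_)
    rw [← hg₂f t' ht', sim_comm, ← hg₂.symm.sim_iff, g₂.symm_apply_apply]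
    exact htb'
  have k1 := key (Equiv.refl _) ⟨fun _ => rfl, fun _ _ => Iff.rfl⟩
    (fun t ht => Finset.mem_union_left _ ht)
  have k2 := key g₁ hg₁ (fun t ht => Finset.mem_union_right _ (Finset.mem_image_of_mem _ ht))
  rw [hgs] at k2
  exact hrs (hG.sim_trans k1 k2.symm)

/-- It is impossible that every vertex is related by `p` to at most one vertex of each clique of
the other colour, if these have at least three vertices and `p` occurs sufficiently often. -/
theorem false_of_unique (hG : G.IsReduced) {p : Prop} {r r' r'' b₁ b₂ b₃ : G.V}
    (h' : G.Sim r r') (h'' : G.Sim r r'') (hne : r ≠ r') (hne' : r ≠ r'') (hne'' : r' ≠ r'')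
    (hb₁ : G.color b₁ ≠ G.color r) (hb₂ : G.color b₂ ≠ G.color r) (hb₃ : G.color b₃ ≠ G.color r)
    (h₁ : G.graph.Adj r' b₁ ↔ p) (h₂ : G.graph.Adj r' b₂ ↔ p) (h₃ : G.graph.Adj r'' b₃ ↔ p)
    (h₁₂ : ¬ G.Sim b₁ b₂) (h₁₃ : ¬ G.Sim b₁ b₃)
    (huniq : ∀ x y b, G.color b ≠ G.color r → G.Sim r x → G.Sim r y → (G.graph.Adj x b ↔ p) →
      (G.graph.Adj y b ↔ p) → x = y) : False := by
  have n₁ : ¬ (G.graph.Adj r b₁ ↔ p) := fun e => hne (huniq _ _ b₁ hb₁ (Sim.refl _) h' e h₁)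
  have n₂ : ¬ (G.graph.Adj r b₂ ↔ p) := fun e => hne (huniq _ _ b₂ hb₂ (Sim.refl _) h' e h₂)
  have n₃ : ¬ (G.graph.Adj r b₃ ↔ p) := fun e => hne' (huniq _ _ b₃ hb₃ (Sim.refl _) h'' e h₃)
  have c₂₃ : G.color b₃ = G.color b₂ := Color.eq_of_ne_of_ne hb₃ hb₂
  obtain ⟨g, hg, gr, g₁, g₂⟩ := hG.homogeneous.exists_aut_triple (x := r) (y := b₁) (z := b₂)
    (x' := r) (y' := b₁) (z' := b₃) rfl rfl c₂₃
    (compatible_of_ne rfl rfl hb₁.symm Iff.rfl)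
    (compatible_of_ne rfl c₂₃ hb₂.symm (by tauto))
    (compatible_of_not_sim (Color.eq_of_ne_of_ne hb₁ hb₂) (Color.eq_of_ne_of_ne hb₁ hb₃) h₁₂ h₁₃)
  have hgs : G.Sim r (g r') := (hg.sim_of_eq gr rfl).2 h'
  have hgr' : g r' = r' :=
    huniq _ _ b₁ hb₁ hgs h' ((hg.adj_of_eq rfl g₁).trans h₁) h₁
  refine hne'' (huniq _ _ b₃ hb₃ h' h'' ?_ h₃)
  rw [hg.adj_of_eq hgr' g₂, h₂]

/-- In a clique with at least three vertices, all patterns over an edge occur infinitely often. -/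
theorem meetsMany_of_hasTriangle (hG : G.IsReduced) {r r' : G.V}
    (hd : ∀ d, d ≠ G.color r → G.ManyCliques d) (h3 : G.HasTriangle (G.color r))
    (hr : G.Sim r r') (hne : r ≠ r') (p q : Prop) : MeetsMany G r r' p q := by
  -- patterns that separate the ends of an edge
  have hsep : ∀ {x y : G.V}, G.Sim r x → G.Sim x y → x ≠ y → ∀ p, MeetsMany G x y p (¬ p) := by
    intro x y hrx hxy hxne p
    refine hG.meetsMany (by rwa [← hrx.1]) hxy hxne ?_
    exact hG.exists_separating hxy hxne p
  by_cases hpq : p ↔ q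
  · rw [← propext hpq]
    refine hG.meetsMany hd hr hne ?_
    by_contra hno
    -- otherwise every vertex is related by `p` to at most one vertex of each clique
    have huniq : ∀ x y b, G.color b ≠ G.color r → G.Sim r x → G.Sim r y → (G.graph.Adj x b ↔ p) →
        (G.graph.Adj y b ↔ p) → x = y := by
      intro x y b hb hx hy h1 h2
      by_contra hxy
      obtain ⟨g, hg, gx, gy⟩ := hG.homogeneous.exists_aut_edge (hG.sim_trans hx.symm hy) hr hxy hne
        hx.1
      refine hno ⟨g b, by rwa [hg.color], ?_, ?_⟩
      · rw [hg.adj_of_eq gx rfl, h1]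
      · rw [hg.adj_of_eq gy rfl, h2]
    obtain ⟨r'', hr'', h1, h2⟩ := hG.exists_third h3 hr hne
    obtain ⟨b₁, ⟨hb₁, -, hp₁⟩, -⟩ := hsep (Sim.refl r) hr hne (¬ p) ∅
    obtain ⟨b₂, ⟨hb₂, -, hp₂⟩, hn₂⟩ := hsep (Sim.refl r) hr hne (¬ p) {b₁}
    obtain ⟨b₃, ⟨hb₃, -, hp₃⟩, hn₃⟩ := hsep (Sim.refl r) hr'' h1 (¬ p) {b₁}
    rw [not_not] at hp₁ hp₂ hp₃
    exact hG.false_of_unique hr hr'' hne h1 h2 hb₁ hb₂ hb₃ hp₁ hp₂ hp₃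
      (hn₂ b₁ (Finset.mem_singleton_self _)) (hn₃ b₁ (Finset.mem_singleton_self _)) huniq
  · have hq : q ↔ ¬ p := by tauto
    rw [propext hq]
    exact hsep (Sim.refl r) hr hne p

/-- In a clique with at least three vertices, all neighbourhoods over a set of representatives of
cliques of the other colour are realized: for another vertex `r₁` of the clique of `r`, the set `T`
is mapped to a set with the old relation to `r` and the prescribed relation to `r₁`. -/
theorem exists_of_transversal (hG : G.IsReduced) {r : G.V}
    (hd : ∀ d, d ≠ G.color r → G.ManyCliques d) (h3 : G.HasTriangle (G.color r))
    {T : Finset G.V} (hTc : ∀ t ∈ T, G.color t ≠ G.color r)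
    (hT : ∀ t ∈ T, ∀ t' ∈ T, G.Sim t t' → t = t') (τ : G.V → Prop) :
    ∃ r', G.Sim r r' ∧ ∀ t ∈ T, G.graph.Adj r' t ↔ τ t := by
  obtain ⟨x, y, -, hx, hxy, -, hne, -⟩ := id h3
  obtain ⟨r₁, hr₁, hne₁⟩ := hG.exists_mate (x := r) ⟨x, y, hx, hxy, hne⟩
  obtain ⟨f, hf, -, hfT⟩ := exists_fresh_choice (R := G.Sim) (fun _ _ => Sim.symm) (T := T) (P := fun t b =>
    G.color b ≠ G.color r ∧ (G.graph.Adj r b ↔ G.graph.Adj r t) ∧ (G.graph.Adj r₁ b ↔ τ t))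
    (fun t _ => hG.meetsMany_of_hasTriangle hd h3 hr₁ hne₁ _ _) ∅
  obtain ⟨g, hg, hgr, hgf⟩ := hG.homogeneous.exists_aut_fixing (c := G.color r) (W := {r}) (S := T)
    (f := f) (by simp) hTc (fun t ht => (hf t ht).1)
    (fun b hb b' hb' e => hfT b hb b' hb' (e ▸ Sim.refl _))
    (fun b hb b' hb' => ⟨fun e => hfT b hb b' hb' e ▸ Sim.refl _,
      fun e => hT b hb b' hb' e ▸ Sim.refl _⟩) (by
      intro w hw b hb
      rw [Finset.mem_singleton.1 hw]
      exact (hf b hb).2.1)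
  have hgr := hgr r (Finset.mem_singleton_self r)
  refine ⟨g.symm r₁, ?_, fun t ht => ?_⟩
  · rw [← hg.sim_iff, hgr, g.apply_symm_apply]
    exact hr₁
  · rw [← hg.adj, g.apply_symm_apply, hgf t ht]
    exact (hf t ht).2.2

/-- In a clique with at least three vertices, every neighbourhood over a finite set of vertices of
the other colour that satisfies the parity condition is realized infinitely often. -/
theorem exists_realization (hG : G.IsReduced) (hpar : G.CrossParity) {r : G.V}
    (hd : ∀ d, d ≠ G.color r → G.ManyCliques d) (h3 : G.HasTriangle (G.color r))
    (W : Finset G.V) {S : Finset G.V} (hS : ∀ b ∈ S, G.color b ≠ G.color r) (τ : G.V → Prop)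
    (hτ : ∀ b ∈ S, ∀ b' ∈ S, G.Sim b b' →
      ((τ b ↔ τ b') ↔ (G.graph.Adj r b ↔ G.graph.Adj r b'))) :
    ∃ r', G.Sim r r' ∧ r' ∉ W ∧ ∀ b ∈ S, G.graph.Adj r' b ↔ τ b := by
  classical
  induction W using Finset.induction_on generalizing S τ with
  | empty =>
    obtain ⟨T, hTS, hT, hTc⟩ := exists_transversal (G := G) S
    obtain ⟨r', hr', h⟩ := hG.exists_of_transversal hd h3 (fun t ht => hS t (hTS ht)) hT τ
    refine ⟨r', hr', Finset.notMem_empty _, fun b hb => ?_⟩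
    obtain ⟨t, ht, htb⟩ := hTc b hb
    have h1 := hτ t (hTS ht) b hb htb
    have h2 := hpar hr' htb (Ne.symm (hS t (hTS ht)))
    have h4 := h t ht
    grind
  | insert w W hw ih =>
    obtain ⟨z, hz⟩ : ∃ z, z ≠ G.color r := by
      cases G.color r
      exacts [⟨.blue, by simp⟩, ⟨.red, by simp⟩]
    -- a further vertex `a` distinguishes the new vertex from `w`
    obtain ⟨a, hac, ha⟩ := hd z hz S
    have haS : ∀ b ∈ S, b ≠ a := fun b hb e => ha b hb (e ▸ Sim.refl _)
    obtain ⟨r', hr', hW, h⟩ := ih (S := insert a S)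
      (fun b hb => by
        rcases Finset.mem_insert.1 hb with rfl | hb
        exacts [hac ▸ hz, hS b hb])
      (fun b => if b = a then ¬ G.graph.Adj w a else τ b)
      (fun b hb b' hb' hs => by
        rcases Finset.mem_insert.1 hb with rfl | hb1 <;>
          rcases Finset.mem_insert.1 hb' with rfl | hb2
        · simp
        · exact absurd hs.symm (ha b' hb2)
        · exact absurd hs (ha b hb1)
        · simp only [haS b hb1, haS b' hb2, if_false]
          exact hτ b hb1 b' hb2 hs)
    refine ⟨r', hr', ?_, fun b hb => ?_⟩
    · rw [Finset.mem_insert]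
      rintro (rfl | h')
      · have := h a (Finset.mem_insert_self _ _)
        simp at this
      · exact hW h'
    · have := h b (Finset.mem_insert_of_mem hb)
      rwa [if_neg (haS b hb)] at this

end IsReduced
end TwoColGraph

namespace TwoColGraph

variable {G : TwoColGraph.{u}} {c d : Color}

/-! ### The parity condition -/

theorem iff_of_not_iff {p q r : Prop} (h : ¬ (p ↔ r)) (h' : ¬ (q ↔ r)) : p ↔ q := by
  by_cases p <;> by_cases q <;> by_cases r <;> simp_all

namespace IsReduced

/-- If no `2 × 2` pattern between two cliques has exactly three entries related by `p`, then none
has exactly one such entry. -/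
theorem false_of_single (hG : G.IsReduced) {p : Prop}
    (hp : ∀ x x' y y' : G.V, G.color x ≠ G.color y → G.Sim x x' → G.Sim y y' →
      (G.graph.Adj x y ↔ p) → (G.graph.Adj x y' ↔ p) → (G.graph.Adj x' y ↔ p) →
      (G.graph.Adj x' y' ↔ p)) {r r' b b' : G.V} (hc : G.color b ≠ G.color r)
    (hr : G.Sim r r') (hb : G.Sim b b') (h₁ : G.graph.Adj r b ↔ p) (h₂ : ¬ (G.graph.Adj r b' ↔ p))
    (h₃ : ¬ (G.graph.Adj r' b ↔ p)) (h₄ : ¬ (G.graph.Adj r' b' ↔ p)) : False := by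
  have hrne : r ≠ r' := fun e => h₃ (e ▸ h₁)
  have hbne : b ≠ b' := fun e => h₂ (e ▸ h₁)
  have er : G.HasEdge (G.color r) := ⟨r, r', rfl, hr, hrne⟩
  have eb : G.HasEdge (G.color b) := ⟨b, b', rfl, hb, hbne⟩
  have hc' : G.color b' ≠ G.color r := hb.1 ▸ hc
  have hrc : G.color r' = G.color r := hr.1.symm
  -- `r'` and `b'` have `p`-neighbours `b''` and `w` in the two cliques
  obtain ⟨w, hw, hwb⟩ := hG.exists_sim_adj_iff er hc' p
  obtain ⟨b'', hb'', hb''r⟩ := hG.exists_sim_adj_iff (r := b) (b := r') eb (hrc ▸ hc.symm) p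
  rw [SimpleGraph.adj_comm] at hb''r
  have hb''c : G.color b'' ≠ G.color r := hb''.1 ▸ hc
  by_cases huniq : ∀ x y a, G.color a ≠ G.color r → G.Sim r x → G.Sim r y →
      (G.graph.Adj x a ↔ p) → (G.graph.Adj y a ↔ p) → x = y
  · -- the `p`-neighbours form a matching with at least three edges
    obtain ⟨a, ha, hna⟩ := hG.exists_not_sim_left b
    have hac : G.color a ≠ G.color r := ha ▸ hc
    have ea : G.HasEdge (G.color a) := ha.symm ▸ eb
    obtain ⟨b₂, hb₂, h₂'⟩ := hG.exists_sim_adj_iff (r := a) (b := r') ea (hrc ▸ hac.symm) p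
    obtain ⟨b₃, hb₃, h₃'⟩ := hG.exists_sim_adj_iff (r := a) (b := w) ea (hw.1 ▸ hac.symm) p
    rw [SimpleGraph.adj_comm] at h₂' h₃'
    exact hG.false_of_unique hr hw hrne (fun e => h₂ (e ▸ hwb)) (fun e => h₄ (e ▸ hwb)) hb''c
      (hb₂.1 ▸ hac) (hb₃.1 ▸ hac) hb''r h₂' h₃'
      (fun e => hna (hG.sim_trans hb'' (hG.sim_trans e hb₂.symm)))
      (fun e => hna (hG.sim_trans hb'' (hG.sim_trans e hb₃.symm))) huniq
  · -- `r` has a companion `v` with the same `p`-neighbours in the clique of `b`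
    push Not at huniq
    obtain ⟨x, y, a, ha, hx, hy, hxa, hya, hxy⟩ := huniq
    have hxc : G.color r = G.color x := hx.1
    obtain ⟨g, hg, gx, ga⟩ := hG.homogeneous.exists_aut_pair (x := x) (x' := r) (y := a) (y' := b)
      hxc (Color.eq_of_ne_of_ne hc ha) (compatible_of_ne hxc (Color.eq_of_ne_of_ne hc ha)
        (hxc ▸ ha.symm) (hxa.trans h₁.symm))
    have hv : G.Sim r (g y) := (hg.sim_of_eq gx rfl).2 (hG.sim_trans hx.symm hy)
    have hvb : G.graph.Adj (g y) b ↔ p := (hg.adj_of_eq rfl ga).trans hya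
    have hrv : r ≠ g y := fun e => hxy (g.injective (gx.trans e))
    have hvc : G.color (g y) = G.color r := hv.1.symm
    have hvb' : ¬ (G.graph.Adj (g y) b' ↔ p) := fun e =>
      h₂ (hp (g y) r b b' (hvc ▸ hc.symm) hv.symm hb hvb e h₁)
    -- over `b'`, the vertex `v` cannot be told from `r'`
    obtain ⟨k, hk, kr, kv, kb⟩ := hG.homogeneous.exists_aut_triple (x := r) (y := g y) (z := b')
      (x' := r) (y' := r') (z' := b') rfl (hrc.trans hvc.symm) rfl
      (compatible_of_sim hv hr hrv hrne) (compatible_of_ne rfl rfl hc'.symm Iff.rfl)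
      (compatible_of_ne (hrc.trans hvc.symm) rfl (hvc ▸ hc'.symm) (iff_of_not_iff hvb' h₄))
    have hkb : G.Sim (k b) b := hG.sim_trans ((hk.sim_of_eq rfl kb).2 hb) hb.symm
    have hkbc : G.color r ≠ G.color (k b) := hkb.1 ▸ hc.symm
    exact h₃ (hp r r' (k b) b hkbc hr hkb ((hk.adj_of_eq kr rfl).trans h₁) h₁
      ((hk.adj_of_eq kv rfl).trans hvb))

theorem crossParity (hG : G.IsReduced) {p : Prop}
    (hp : ∀ x x' y y' : G.V, G.color x ≠ G.color y → G.Sim x x' → G.Sim y y' →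
      (G.graph.Adj x y ↔ p) → (G.graph.Adj x y' ↔ p) → (G.graph.Adj x' y ↔ p) →
      (G.graph.Adj x' y' ↔ p)) : G.CrossParity := by
  intro x x' y y' hx hy hxy
  have hxy' : G.color x ≠ G.color y' := hy.1 ▸ hxy
  have hx'y : G.color x' ≠ G.color y := hx.1 ▸ hxy
  have hx'y' : G.color x' ≠ G.color y' := hx.1 ▸ hxy'
  have a1 := hp x x' y y' hxy hx hy
  have a2 := hp x x' y' y hxy' hx hy.symm
  have a3 := hp x' x y y' hx'y hx.symm hy
  have a4 := hp x' x y' y hx'y' hx.symm hy.symm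
  have b1 := hG.false_of_single hp hxy.symm hx hy
  have b2 := hG.false_of_single hp hxy'.symm hx hy.symm
  have b3 := hG.false_of_single hp hx'y.symm hx.symm hy
  have b4 := hG.false_of_single hp hx'y'.symm hx.symm hy.symm
  clear hp
  by_cases hp : p <;>
  · simp only [hp, iff_true, iff_false, not_not] at a1 a2 a3 a4 b1 b2 b3 b4
    grind

theorem crossParity_of_omitted_twoCliques (hG : G.IsReduced) {p : Prop}
    (h : Omitted (twoCliques 2 2 fun i j => ¬ (i = 1 ∧ j = 1) ↔ p) G) : G.CrossParity := by
  rw [omitted_D_iff] at h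
  refine hG.crossParity (p := p) fun x x' y y' hxy hx hy h₁ h₂ h₃ => ?_
  by_cases hxx : x = x'
  · rwa [← hxx]
  by_cases hyy : y = y'
  · rwa [← hyy]
  cases hxc : G.color x
  · exact h x x' y y' hxc (Color.eq_of_ne_of_ne (hxc ▸ hxy.symm) (by simp)) hx hy hxx hyy h₁ h₂ h₃
  · rw [SimpleGraph.adj_comm] at h₁ h₂ h₃ ⊢
    exact h y y' x x' (Color.eq_of_ne_of_ne (hxc ▸ hxy.symm) (by simp)) hxc hy hx hyy hxx h₁ h₃ h₂

theorem crossParity_of_omitted (hG : G.IsReduced) (h : Omitted D G ∨ Omitted D.crossCompl G) :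
    G.CrossParity := by
  rw [crossCompl_D_eq, D_eq] at h
  exact h.elim hG.crossParity_of_omitted_twoCliques hG.crossParity_of_omitted_twoCliques

/-! ### Finitely many vertices or cliques of one colour -/

/-- If one colour class is finite, then vertices in different cliques of the other colour have the
same neighbours in it. -/
theorem adj_iff_of_finite (hG : G.IsReduced) (hc : {x | G.color x = c}.Finite) {b b' r : G.V}
    (hr : G.color r = c) (hb : G.color b ≠ c) (hb' : G.color b' ≠ c) (hn : ¬ G.Sim b b') :
    G.graph.Adj r b ↔ G.graph.Adj r b' := by
  have hinf : {x | G.color x ≠ c}.Infinite := fun hfin => by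
    have := hG.infinite
    refine Set.infinite_univ (α := G.V) ((hc.union hfin).subset fun x _ => ?_)
    exact em _
  -- by the pigeonhole principle, some two vertices have the same neighbours
  obtain ⟨x, hx, y, hy, hxy, he⟩ := hinf.exists_ne_map_eq_of_mapsTo
    (f := fun b => {r | G.color r = c ∧ G.graph.Adj r b}) (t := 𝒫 {x | G.color x = c})
    (fun b _ r hr => hr.1) hc.finite_subsets
  have hxy' : ∀ r, G.color r = c → (G.graph.Adj r x ↔ G.graph.Adj r y) := fun r hr => by
    have := Set.ext_iff.1 he r
    simpa [hr] using this
  have hcol : G.color x = G.color y := Color.eq_of_ne_of_ne hx hy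
  by_cases hs : G.Sim x y
  · obtain ⟨z, hz, h⟩ := hG.twinFree x y hs hxy
    rw [SimpleGraph.adj_comm, SimpleGraph.adj_comm _ y] at h
    exact absurd (hxy' z (Color.eq_of_ne_of_ne hz hx.symm)) h
  · obtain ⟨g, hg, gx, gy⟩ := hG.homogeneous.exists_aut_pair (x := x) (y := y) (x' := b) (y' := b')
      (Color.eq_of_ne_of_ne hb hx) (Color.eq_of_ne_of_ne hb' hy)
      (compatible_of_not_sim hcol (Color.eq_of_ne_of_ne hb hb') hs hn)
    have := hxy' (g.symm r) (by rw [hg.symm.color, hr])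
    rw [hg.adj_of_eq (g.apply_symm_apply r) gx, hg.adj_of_eq (g.apply_symm_apply r) gy, this]

theorem infinite_of_hasEdge (hG : G.IsReduced) {d : Color} (hd : G.HasEdge d) (c : Color) :
    {x | G.color x = c}.Infinite := by
  intro hc
  have hsame : ∀ b b' r, G.color r = c → G.color b ≠ c → G.color b' ≠ c → ¬ G.Sim b b' →
      (G.graph.Adj r b ↔ G.graph.Adj r b') := fun b b' r => hG.adj_iff_of_finite hc
  -- an edge of the other colour would consist of twins
  have hno : ∀ b b', G.color b ≠ c → G.Sim b b' → b = b' := by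
    intro b b' hb hs
    by_contra hne
    obtain ⟨z, hz, hzb⟩ := hG.twinFree b b' hs hne
    obtain ⟨a, ha, hna⟩ := hG.exists_not_sim_left b
    have hzc : G.color z = c := Color.eq_of_ne_of_ne hz hb.symm
    have h1 := hsame b a z hzc hb (ha ▸ hb) hna
    have h2 := hsame b' a z hzc (hs.1 ▸ hb) (ha ▸ hb) (fun e => hna (hG.sim_trans hs e))
    rw [SimpleGraph.adj_comm, SimpleGraph.adj_comm _ b', h1, h2] at hzb
    exact hzb Iff.rfl
  obtain ⟨x, y, hx, hxy, hne⟩ := hd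
  by_cases hdc : d = c
  · obtain ⟨z, hz, hz1, -⟩ := hG.exists_separating hxy hne True
    obtain ⟨w, hw, hw1, -⟩ := hG.exists_separating hxy hne False
    have hcx : G.color x = c := hx.trans hdc
    refine absurd (hsame z w x hcx (hcx ▸ hz) (hcx ▸ hw) fun e => ?_) (by tauto)
    have := hno z w (hcx ▸ hz) e
    subst this
    tauto
  · exact hne (hno x y (hx ▸ hdc) hxy)

theorem clique_finite_of_not_hasTriangle (h : ¬ G.HasTriangle c) {x : G.V} (hx : G.color x = c) :
    {y | G.Sim x y}.Finite := by
  by_cases hm : ∃ y, G.Sim x y ∧ x ≠ y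
  · obtain ⟨y, hy, hne⟩ := hm
    refine (Set.toFinite {x, y}).subset fun z hz => ?_
    by_contra hzn
    simp only [Set.mem_insert_iff, Set.mem_singleton_iff, not_or] at hzn
    exact h ⟨x, y, z, hx, hy, hz, hne, Ne.symm hzn.1, Ne.symm hzn.2⟩
  · push Not at hm
    exact (Set.finite_singleton x).subset fun z hz => (hm z hz).symm

theorem class_finite (hm : ¬ G.ManyCliques c)
    (hfin : ∀ x, G.color x = c → {y | G.Sim x y}.Finite) : {x | G.color x = c}.Finite := by
  classical
  simp only [ManyCliques, not_forall, not_exists, not_and, not_not] at hm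
  obtain ⟨X, hX⟩ := hm
  refine ((X.filter fun y => G.color y = c).finite_toSet.biUnion
    (t := fun x => {y | G.Sim x y}) fun x hx => hfin x (Finset.mem_filter.1 hx).2).subset ?_
  intro x hx
  obtain ⟨y, hy, hyx⟩ := hX x hx
  exact Set.mem_biUnion (Finset.mem_filter.2 ⟨hy, hyx.1.trans hx⟩) hyx

theorem manyCliques_of_not_hasTriangle (hG : G.IsReduced) (hd : G.HasEdge d)
    (hc : ¬ G.HasTriangle c) : G.ManyCliques c := by
  by_contra hm
  exact hG.infinite_of_hasEdge hd c
    (class_finite hm fun x hx => clique_finite_of_not_hasTriangle hc hx)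

/-- If there are only finitely many cliques of the other colour, then the vertices of a clique are
told apart by their neighbours in a finite set of representatives. -/
theorem clique_finite (hG : G.IsReduced) (hpar : G.CrossParity) (hcd : c ≠ d)
    (hd : ¬ G.ManyCliques d) {x : G.V} (hx : G.color x = c) : {y | G.Sim x y}.Finite := by
  simp only [ManyCliques, not_forall, not_exists, not_and, not_not] at hd
  obtain ⟨X, hX⟩ := hd
  refine Set.Finite.of_injOn (f := fun y => {z | z ∈ X ∧ G.graph.Adj y z})
    (t := 𝒫 (X : Set G.V)) (fun y _ z hz => hz.1) ?_ X.finite_toSet.finite_subsets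
  intro y hy z hz hyz
  by_contra hne
  have hs : G.Sim y z := hG.sim_trans (Sim.symm hy) hz
  have hyc : G.color y = c := (Sim.color_eq hy).symm.trans hx
  obtain ⟨b, hb, h⟩ := hG.twinFree y z hs hne
  obtain ⟨a, ha, hab⟩ :=
    hX b (Color.eq_of_ne_of_ne (hyc ▸ hb) hcd.symm)
  have h1 := Set.ext_iff.1 hyz a
  simp only [Set.mem_ofPred_eq, ha, true_and] at h1
  have h2 := hpar hs hab (by rw [hab.1]; exact hb.symm)
  tauto

/-- If there are only finitely many cliques of colour `d`, then those of colour `c` have at most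
two vertices: infinitely many edges of colour `c` fall into finitely many types according to the
cliques that separate their ends, hence by homogeneity all edges have the same type. -/
theorem not_hasTriangle (hG : G.IsReduced) (hpar : G.CrossParity) (hcd : c ≠ d)
    (hd : ¬ G.ManyCliques d) (hc : G.ManyCliques c) : ¬ G.HasTriangle c := by
  classical
  rintro ⟨x, y, z, hx, hxy, hxz, hne, hne', hne''⟩
  have hd' := hd
  simp only [ManyCliques, not_forall, not_exists, not_and, not_not] at hd
  obtain ⟨X, hX⟩ := hd
  -- the representatives of the cliques that separate the ends of an edge
  let J : G.V × G.V → Finset G.V := fun e => X.filter fun b => ¬ (G.graph.Adj e.1 b ↔ G.graph.Adj e.2 b)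
  let good : G.V × G.V → Prop := fun e => G.color e.1 = c ∧ G.Sim e.1 e.2 ∧ e.1 ≠ e.2
  -- two edges of the same type in different cliques
  obtain ⟨e, f, he, hf, hJ, hef⟩ : ∃ e f, good e ∧ good f ∧ J e = J f ∧ ¬ G.Sim e.1 f.1 := by
    let e : Finset G.V → G.V × G.V := fun t =>
      if h : ∃ e, good e ∧ J e = t then h.choose else (x, x)
    obtain ⟨u, hu, huX⟩ := hc (X.powerset.image fun t => (e t).1)
    obtain ⟨w, huw, hw⟩ := hG.exists_mate (x := u) (hu ▸ ⟨x, y, hx, hxy, hne⟩)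
    have hex : ∃ e, good e ∧ J e = J (u, w) := ⟨(u, w), ⟨hu, huw, hw⟩, rfl⟩
    refine ⟨hex.choose, (u, w), hex.choose_spec.1, ⟨hu, huw, hw⟩, hex.choose_spec.2, ?_⟩
    have := huX (e (J (u, w))).1 (Finset.mem_image_of_mem _
      (Finset.mem_powerset.2 (Finset.filter_subset _ _)))
    simpa only [e, dif_pos hex] using this
  have htype : ∀ b, G.color b ≠ c → ((G.graph.Adj e.1 b ↔ G.graph.Adj e.2 b) ↔
      (G.graph.Adj f.1 b ↔ G.graph.Adj f.2 b)) := by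
    intro b hb
    obtain ⟨a, ha, hab⟩ := hX b (Color.eq_of_ne_of_ne hb hcd.symm)
    have h1 := Finset.ext_iff.1 hJ a
    simp only [J, Finset.mem_filter, ha, true_and, not_iff_not] at h1
    have h2 := hpar he.2.1 hab (by rw [he.1, hab.1]; exact hb.symm)
    have h3 := hpar hf.2.1 hab (by rw [hf.1, hab.1]; exact hb.symm)
    rw [← h2, ← h3, h1]
  have hall : ∀ e' f', good e' → good f' → ¬ G.Sim e'.1 f'.1 → ∀ b, G.color b ≠ c →
      ((G.graph.Adj e'.1 b ↔ G.graph.Adj e'.2 b) ↔ (G.graph.Adj f'.1 b ↔ G.graph.Adj f'.2 b)) := by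
    intro e' f' he' hf' hn b hb
    obtain ⟨g, hg, g1, g2, g3, g4⟩ := hG.homogeneous.exists_aut_edges hG.cliques he.2.1 he'.2.1
      hf.2.1 hf'.2.1 he.2.2 he'.2.2 hf.2.2 hf'.2.2 (he'.1.trans he.1.symm) (hf.1.trans he.1.symm)
      (hf'.1.trans he'.1.symm) hef hn
    have := htype (g.symm b) (by rwa [hg.symm.color])
    have hb' := g.apply_symm_apply b
    rw [hg.adj_of_eq g1 hb', hg.adj_of_eq g2 hb', hg.adj_of_eq g3 hb', hg.adj_of_eq g4 hb', this]
  -- so any two edges have the same type, which is absurd for a triangle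
  obtain ⟨b, hb, hxyb⟩ := hG.twinFree x y hxy hne
  rw [hx] at hb
  obtain ⟨u, hu, hnu⟩ := hG.exists_not_sim_left x
  obtain ⟨w, huw, hw⟩ := hG.exists_mate (x := u) (hu ▸ ⟨x, y, rfl, hxy, hne⟩)
  have hgu : good (u, w) := ⟨hu.trans hx, huw, hw⟩
  have h1 := hall (x, y) (u, w) ⟨hx, hxy, hne⟩ hgu hnu b hb
  have h2 := hall (x, z) (u, w) ⟨hx, hxz, hne'⟩ hgu hnu b hb
  have h3 := hall (y, z) (u, w) ⟨hxy.1.symm.trans hx, hG.sim_trans hxy.symm hxz, hne''⟩ hgu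
    (fun e => hnu (hG.sim_trans hxy e)) b hb
  have hF := mt h1.2 hxyb
  exact hxyb (iff_of_not_iff (mt h2.1 hF) (mt h3.1 hF))

/-- In cliques with two vertices these have complementary neighbourhoods. -/
theorem sizeCondition_two (hG : G.IsReduced) (hc : ¬ G.HasTriangle c) : G.SizeCondition c .two := by
  refine ⟨fun x y z hx hxy hxz => ?_, fun x y z hx hz hxy hne => ?_⟩
  · by_contra h
    push Not at h
    exact hc ⟨x, y, z, hx, hxy, hxz, h⟩
  · obtain ⟨w, hw, hwz⟩ := hG.exists_sim_adj_iff (r := x) (b := z) ⟨x, y, rfl, hxy, hne⟩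
      (hx ▸ hz) (¬ G.graph.Adj x z)
    have : w = y := by
      by_contra hwy
      refine hc ⟨x, y, w, hx, hxy, hw, hne, ?_, Ne.symm hwy⟩
      rintro rfl
      tauto
    subst this
    tauto

end IsReduced
end TwoColGraph

namespace TwoColGraph

variable {s : Color → CliqueSize} {κ : Color → ℕ∞} {G : TwoColGraph.{u}} {c d : Color}

/-! ### The extension property -/

/-- A reduced graph in the class described by `s` and `κ` in which the bounds `s` and `κ` are
attained.  Such a graph is the Fraïssé limit of the class. -/
structure IsRich (s : Color → CliqueSize) (κ : Color → ℕ∞) (G : TwoColGraph.{u}) : Prop where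
  reduced : G.IsReduced
  inClass : InClass s κ G
  admissible : Admissible s κ
  exists_hasEdge : ∃ c, G.HasEdge c
  hasEdge : ∀ c, s c = .two → G.HasEdge c
  hasTriangle : ∀ c, s c = .many → G.HasTriangle c
  manyCliques : ∀ c, κ c = ⊤ → G.ManyCliques c
  exists_clique : ∀ (c : Color) (t : Finset G.V), (t.card : ℕ∞) < κ c →
    ∃ u, G.color u = c ∧ ∀ y ∈ t, ¬ G.Sim y u

namespace IsRich

theorem eq_top (h : IsRich s κ G) (hcd : c ≠ d) (hc : s c ≠ .many ∨ s d = .many) : κ c = ⊤ := by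
  by_contra hk
  have := h.admissible c d hcd hk
  exact hc.elim (fun h => h this.1) (fun h => this.2 h)

/-- Neighbourhoods over finite sets of vertices of the other colour `d` are realized when this
colour has no large cliques. -/
theorem exists_realization_of_small (h : IsRich s κ G) (hcd : c ≠ d)
    (hd : s d ≠ .many) {S : Finset G.V} (hS : ∀ b ∈ S, G.color b = d)
    (τ : G.V → Prop) (hτ : s d = .two → ∀ b ∈ S, ∀ b' ∈ S, G.Sim b b' → b ≠ b' →
      (τ b ↔ ¬ τ b')) : ∃ v, G.color v = c ∧ ∀ b ∈ S, G.graph.Adj v b ↔ τ b := by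
  have hG := h.reduced
  obtain ⟨r, -, hr, -, -⟩ := hG.exists_not_sim c
  -- it is enough to find an isomorphic copy of `S` that is related to `r` as prescribed
  obtain ⟨f, hfc, hfi, hfs, hfr⟩ : ∃ f : G.V → G.V, (∀ b ∈ S, G.color (f b) = d) ∧
      (∀ b ∈ S, ∀ b' ∈ S, f b = f b' → b = b') ∧
      (∀ b ∈ S, ∀ b' ∈ S, (G.Sim (f b) (f b') ↔ G.Sim b b')) ∧
      ∀ b ∈ S, (G.graph.Adj r (f b) ↔ τ b) := by
    cases hsd : s d with
    | many => exact absurd hsd hd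
    | one =>
      obtain ⟨e, he⟩ := h.exists_hasEdge
      have hone : ∀ x y, G.color x = d → G.Sim x y → x = y := fun x y hx =>
        h.inClass.one (hx ▸ hsd)
      have hec : e = c := by
        refine (Color.eq_or_eq hcd e).resolve_right ?_
        rintro rfl
        obtain ⟨x, y, hx, hxy, hne⟩ := he
        exact hne (hone x y hx hxy)
      obtain ⟨r', hr', hne⟩ := hG.exists_mate (x := r) (hr ▸ hec ▸ he)
      obtain ⟨f, hf, -, hfT⟩ := exists_fresh_choice (R := G.Sim) (fun _ _ => Sim.symm) (T := S)
        (P := fun t b => G.color b ≠ G.color r ∧ (G.graph.Adj r b ↔ τ t) ∧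
          (G.graph.Adj r' b ↔ ¬ τ t)) (fun t _ => hG.meetsMany (fun d' hd' => by
            rw [Color.eq_of_ne_of_ne hd' (hr ▸ hcd.symm)]
            exact h.manyCliques d (h.eq_top hcd.symm (Or.inl hd))) hr' hne
            (hG.exists_separating hr' hne _)) ∅
      refine ⟨f, fun b hb => Color.eq_of_ne_of_ne (hf b hb).1 (hr ▸ hcd.symm),
        fun b hb b' hb' e => hfT b hb b' hb' (e ▸ Sim.refl _), fun b hb b' hb' => ⟨fun e =>
          hfT b hb b' hb' e ▸ Sim.refl _, fun e => hone b b' (hS b hb) e ▸ Sim.refl _⟩,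
        fun b hb => (hf b hb).2.1⟩
    | two =>
      have hex : ∀ b, ∃ b', b ∈ S → G.Sim b b' ∧ (G.graph.Adj r b' ↔ τ b) := fun b => by
        by_cases hb : b ∈ S
        · obtain ⟨b', h1, h2⟩ := hG.exists_sim_adj_iff (r := b) (b := r)
            (hS b hb ▸ h.hasEdge d hsd) (by rw [hr, hS b hb]; exact hcd) (τ b)
          exact ⟨b', fun _ => ⟨h1, by rwa [SimpleGraph.adj_comm]⟩⟩
        · exact ⟨b, fun h => absurd h hb⟩
      choose f hf using hex
      refine ⟨f, fun b hb => (hf b hb).1.1 ▸ hS b hb, fun b hb b' hb' e => ?_, fun b hb b' hb' =>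
        ⟨fun e => hG.sim_trans (hf b hb).1 (hG.sim_trans e (hf b' hb').1.symm),
          fun e => hG.sim_trans (hf b hb).1.symm (hG.sim_trans e (hf b' hb').1)⟩,
        fun b hb => (hf b hb).2⟩
      by_contra hne
      have h1 := hτ hsd b hb b' hb' (hG.sim_trans (hf b hb).1 (e ▸ (hf b' hb').1.symm)) hne
      have h2 := (hf b hb).2
      have h3 := (hf b' hb').2
      rw [e] at h2
      tauto
  obtain ⟨g, hg, -, hgf⟩ := hG.homogeneous.exists_aut_fixing (c := c) (W := ∅) (S := S) (f := f)
    (by simp) (fun b hb => hS b hb ▸ hcd.symm) (fun b hb => hfc b hb ▸ hcd.symm) hfi hfs (by simp)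
  refine ⟨g.symm r, (hg.symm.color r).trans hr, fun b hb => ?_⟩
  rw [← hfr b hb]
  exact (hg.adj_of_eq (g.apply_symm_apply r) (hgf b hb)).symm

/-- A vertex in a new clique with a prescribed neighbourhood. -/
theorem exists_new_clique (h : IsRich s κ G) (hcd : c ≠ d)
    {S W : Finset G.V} (hS : ∀ b ∈ S, G.color b = d) (hW : ∀ w ∈ W, G.color w = c)
    (τ : G.V → Prop) (hτ : s d = .two → ∀ b ∈ S, ∀ b' ∈ S, G.Sim b b' → b ≠ b' → (τ b ↔ ¬ τ b'))
    (hu : ∃ u, G.color u = c ∧ ∀ w ∈ W, ¬ G.Sim w u) :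
    ∃ v, G.color v = c ∧ (∀ w ∈ W, ¬ G.Sim w v) ∧ ∀ b ∈ S, G.graph.Adj v b ↔ τ b := by
  classical
  have hG := h.reduced
  have hpar : G.CrossParity := fun _ _ _ _ => h.inClass.parity
  obtain ⟨u, huc, hu⟩ := hu
  by_cases hd : s d = .many
  · -- move `S` within its cliques, keeping its relation to `W`
    have hc : G.ManyCliques c := h.manyCliques c (h.eq_top hcd (Or.inr hd))
    obtain ⟨f, hf, -, hfi⟩ := exists_fresh_choice (R := Eq) (fun _ _ => Eq.symm) (T := S)
      (P := fun b b' => G.Sim b b' ∧ (∀ w ∈ W, G.graph.Adj b' w ↔ G.graph.Adj b w) ∧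
        (G.graph.Adj b' u ↔ τ b)) (fun b hb X => by
        have hne : ∀ w ∈ W, w ≠ u := fun w hw e => hu w hw (e ▸ Sim.refl _)
        obtain ⟨b', h1, h2, h3⟩ := hG.exists_realization hpar (r := b) (fun e he => by
            rw [Color.eq_of_ne_of_ne he (hS b hb ▸ hcd)]; exact hc)
          (hS b hb ▸ h.hasTriangle d hd) X (S := insert u W) (fun w hw => by
            rw [hS b hb]
            rcases Finset.mem_insert.1 hw with rfl | hw
            exacts [huc ▸ hcd, hW w hw ▸ hcd])
          (fun w => if w = u then τ b else G.graph.Adj b w) (fun w hw w' hw' hs => by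
            rcases Finset.mem_insert.1 hw with rfl | hw1 <;>
              rcases Finset.mem_insert.1 hw' with rfl | hw2
            · simp
            · exact absurd hs.symm (hu w' hw2)
            · exact absurd hs (hu w hw1)
            · simp only [hne w hw1, hne w' hw2, if_false])
        refine ⟨b', ⟨h1, fun w hw => ?_, ?_⟩, fun y hy e => h2 (e ▸ hy)⟩
        · have := h3 w (Finset.mem_insert_of_mem hw)
          rwa [if_neg (hne w hw)] at this
        · have := h3 u (Finset.mem_insert_self _ _)
          rwa [if_pos rfl] at this) ∅
    obtain ⟨g, hg, hgW, hgS⟩ := hG.homogeneous.exists_aut_fixing (c := c) (W := W) (S := S) (f := f)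
      hW (fun b hb => hS b hb ▸ hcd.symm)
      (fun b hb => by rw [← (hf b hb).1.1, hS b hb]; exact hcd.symm) hfi
      (fun b hb b' hb' => ⟨fun e => hG.sim_trans (hf b hb).1 (hG.sim_trans e (hf b' hb').1.symm),
        fun e => hG.sim_trans (hf b hb).1.symm (hG.sim_trans e (hf b' hb').1)⟩)
      (fun w hw b hb => by
        rw [SimpleGraph.adj_comm, (hf b hb).2.1 w hw, SimpleGraph.adj_comm])
    refine ⟨g.symm u, (hg.symm.color u).trans huc, fun w hw => ?_, fun b hb => ?_⟩
    · rw [← hg.sim_of_eq (hgW w hw) (g.apply_symm_apply u)]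
      exact hu w hw
    · rw [← hg.adj_of_eq (g.apply_symm_apply u) (hgS b hb), SimpleGraph.adj_comm]
      exact (hf b hb).2.2
  have hmd : G.ManyCliques d := h.manyCliques d (h.eq_top hcd.symm (Or.inl hd))
  by_cases hc : s c = .many
  · obtain ⟨v, hv, -, hvS⟩ := hG.exists_realization hpar (r := u) (fun e he => by
        rw [Color.eq_of_ne_of_ne he (huc ▸ hcd.symm)]; exact hmd)
      (huc ▸ h.hasTriangle c hc) ∅ (S := S) (fun b hb => by rw [huc, hS b hb]; exact hcd.symm) τ
      (fun b hb b' hb' hs => by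
        by_cases hne : b = b'
        · subst hne; simp
        cases hsd : s d with
        | many => exact absurd hsd hd
        | one => exact absurd (h.inClass.one ((hS b hb).symm ▸ hsd) hs) hne
        | two =>
          have h1 := hτ hsd b hb b' hb' hs hne
          have h2 := h.inClass.mates (z := u) ((hS b hb).symm ▸ hsd) hs hne
            (by rw [huc, hS b hb]; exact hcd)
          rw [SimpleGraph.adj_comm, SimpleGraph.adj_comm _ b'] at h2
          tauto)
    exact ⟨v, hv.1.symm.trans huc, fun w hw e => hu w hw (hG.sim_trans e hv.symm), hvS⟩
  -- neither colour has large cliques; two additional vertices keep `v` out of each clique in `W`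
  clear hu huc u
  induction W using Finset.induction_on generalizing S τ with
  | empty =>
    obtain ⟨v, hv, hvS⟩ := h.exists_realization_of_small hcd hd hS τ hτ
    exact ⟨v, hv, by simp, hvS⟩
  | insert w W hw ih =>
    obtain ⟨a, ha, haS⟩ := hmd S
    obtain ⟨b, hb, hbS⟩ := hmd (insert a S)
    have hab : b ≠ a := fun e => hbS a (Finset.mem_insert_self _ _) (e ▸ Sim.refl _)
    have hSa : ∀ x ∈ S, x ≠ a := fun x hx e => haS x hx (e ▸ Sim.refl _)
    have hSb : ∀ x ∈ S, x ≠ b := fun x hx e =>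
      hbS x (Finset.mem_insert_of_mem hx) (e ▸ Sim.refl _)
    obtain ⟨v, hv, hvW, hvS⟩ := ih (S := insert b (insert a S)) (fun x hx => by
        rcases Finset.mem_insert.1 hx with rfl | hx
        · exact hb
        rcases Finset.mem_insert.1 hx with rfl | hx
        exacts [ha, hS x hx])
      (fun x hx => hW x (Finset.mem_insert_of_mem hx))
      (fun x => if x = b then G.graph.Adj w b else if x = a then ¬ G.graph.Adj w a else τ x)
      (fun hsd x hx y hy hs hne => by
        rcases Finset.mem_insert.1 hx with rfl | hx' <;> rcases Finset.mem_insert.1 hy with rfl | hy'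
        · exact absurd rfl hne
        · exact absurd hs.symm (hbS y hy')
        · exact absurd hs (hbS x hx')
        rcases Finset.mem_insert.1 hx' with rfl | hx'' <;>
          rcases Finset.mem_insert.1 hy' with rfl | hy''
        · exact absurd rfl hne
        · exact absurd hs.symm (haS y hy'')
        · exact absurd hs (haS x hx'')
        simp only [hSa x hx'', hSb x hx'', hSa y hy'', hSb y hy'', if_false]
        exact hτ hsd x hx'' y hy'' hs hne)
    have hva := hvS a (by simp)
    have hvb := hvS b (by simp)
    rw [if_neg hab.symm, if_pos rfl] at hva
    rw [if_pos rfl] at hvb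
    refine ⟨v, hv, fun x hx hs => ?_, fun x hx => ?_⟩
    · rcases Finset.mem_insert.1 hx with rfl | hx
      · have hne : x ≠ v := by
          rintro rfl
          tauto
        have hxc : G.color x = c := hs.1.trans hv
        cases hsc : s c with
        | many => exact hc hsc
        | one => exact hne (h.inClass.one (hxc.symm ▸ hsc) hs)
        | two =>
          have := h.inClass.mates (z := b) (hxc.symm ▸ hsc) hs hne (by rw [hb, hxc]; exact hcd.symm)
          tauto
      · exact hvW x hx hs
    · have := hvS x (by simp [hx])
      rwa [if_neg (hSb x hx), if_neg (hSa x hx)] at this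

/-- The extension property. -/
theorem exists_extension (h : IsRich s κ G) {A : TwoColGraph.{v}} (hA : InClass s κ A)
    {X : Finset A.V} {f : A.V → G.V} (hf : IsEmbOn A G X f) {x : A.V} (hx : x ∉ X) :
    ∃ v, G.color v = A.color x ∧ ∀ y ∈ X, f y ≠ v ∧ (G.graph.Adj (f y) v ↔ A.graph.Adj y x) := by
  classical
  have hG := h.reduced
  have hpar : G.CrossParity := fun _ _ _ _ => h.inClass.parity
  obtain ⟨d, hcd⟩ : ∃ d, A.color x ≠ d := by
    cases A.color x
    exacts [⟨.blue, by simp⟩, ⟨.red, by simp⟩]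
  have hyx : ∀ y ∈ X, y ≠ x := fun y hy e => hx (e ▸ hy)
  -- it is enough to deal with cliques and with the other colour separately
  suffices hv : ∃ v, G.color v = A.color x ∧ (∀ y ∈ X, f y ≠ v) ∧
      (∀ y ∈ X, A.color y = A.color x → (G.Sim (f y) v ↔ A.Sim y x)) ∧
      ∀ y ∈ X, A.color y ≠ A.color x → (G.graph.Adj (f y) v ↔ A.graph.Adj y x) by
    obtain ⟨v, hvc, hne, hv1, hv2⟩ := hv
    refine ⟨v, hvc, fun y hy => ⟨hne y hy, ?_⟩⟩
    by_cases hyc : A.color y = A.color x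
    · rw [adj_iff_sim (by rw [hf.color y hy, hvc, hyc]), adj_iff_sim hyc, hv1 y hy hyc,
        and_iff_left (hne y hy), and_iff_left (hyx y hy)]
    · exact hv2 y hy hyc
  let S : Finset G.V := (X.filter fun y => A.color y ≠ A.color x).image f
  have hS : ∀ b ∈ S, ∃ y ∈ X, A.color y ≠ A.color x ∧ f y = b := fun b hb => by
    obtain ⟨y, hy, rfl⟩ := Finset.mem_image.1 hb
    exact ⟨y, (Finset.mem_filter.1 hy).1, (Finset.mem_filter.1 hy).2, rfl⟩
  have hfS : ∀ y ∈ X, A.color y ≠ A.color x → f y ∈ S := fun y hy hyc =>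
    Finset.mem_image_of_mem f (Finset.mem_filter.2 ⟨hy, hyc⟩)
  have hSd : ∀ b ∈ S, G.color b = d := fun b hb => by
    obtain ⟨y, hy, hyc, rfl⟩ := hS b hb
    rw [hf.color y hy]
    exact Color.eq_of_ne_of_ne hyc hcd.symm
  let τ : G.V → Prop := fun b => ∃ y ∈ X, f y = b ∧ A.graph.Adj y x
  have hτ : ∀ y ∈ X, (τ (f y) ↔ A.graph.Adj y x) := fun y hy =>
    ⟨fun ⟨z, hz, hzy, h⟩ => hf.inj hz hy hzy ▸ h, fun h => ⟨y, hy, rfl, h⟩⟩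
  by_cases hX : ∃ x₀ ∈ X, A.Sim x₀ x
  · obtain ⟨x₀, hx₀, hsim⟩ := hX
    have hne : x₀ ≠ x := hyx x₀ hx₀
    have huc : G.color (f x₀) = A.color x := (hf.color _ hx₀).trans hsim.1
    have hsimiff : ∀ v, G.Sim (f x₀) v → ∀ y ∈ X, (G.Sim (f y) v ↔ A.Sim y x) := fun v hv y hy => by
      constructor
      · exact fun e => hA.sim_trans ((hf.sim_iff hy hx₀).1 (hG.sim_trans e hv.symm)) hsim
      · exact fun e => hG.sim_trans ((hf.sim_iff hy hx₀).2 (hA.sim_trans e hsim.symm)) hv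
    cases hs : s (A.color x) with
    | one => exact absurd (hA.one (hsim.1 ▸ hs) hsim) hne
    | two =>
      have hs0 : s (A.color x₀) = .two := hsim.1 ▸ hs
      obtain ⟨v, hv, hvne⟩ := hG.exists_mate (x := f x₀) (huc ▸ h.hasEdge _ hs)
      refine ⟨v, hv.1.symm.trans huc, fun y hy e => ?_, fun y hy _ => hsimiff v hv y hy,
        fun y hy hyc => ?_⟩
      · have hyx0 : A.Sim x₀ y := (hf.sim_iff hx₀ hy).1 (e ▸ hv)
        rcases hA.two hs0 hyx0 hsim with e' | e' | e'
        · exact hvne (e' ▸ e)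
        · exact hne e'
        · exact hyx y hy e'
      · have h1 := hA.mates hs0 hsim hne (fun e => hyc (e.trans hsim.1))
        have h2 := h.inClass.mates (huc ▸ hs) hv hvne (z := f y)
          (by rw [huc, hf.color y hy]; exact hyc)
        rw [hf.adj _ hx₀ _ hy] at h2
        rw [SimpleGraph.adj_comm, SimpleGraph.adj_comm _ y]
        tauto
    | many =>
      have hmd : G.ManyCliques d := by
        refine h.manyCliques d ?_
        by_contra hk
        exact (h.admissible d _ hcd.symm hk).2 hs
      obtain ⟨v, hv, hvX, hvS⟩ := hG.exists_realization hpar (r := f x₀) (fun e he => by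
          rw [Color.eq_of_ne_of_ne he (huc ▸ hcd.symm)]; exact hmd)
        (huc ▸ h.hasTriangle _ hs) (X.image f) (S := S)
        (fun b hb => by rw [huc, hSd b hb]; exact hcd.symm) τ (fun b hb b' hb' hbb => by
          obtain ⟨y, hy, hyc, rfl⟩ := hS b hb
          obtain ⟨y', hy', hyc', rfl⟩ := hS b' hb'
          rw [hτ y hy, hτ y' hy', hf.adj _ hx₀ _ hy, hf.adj _ hx₀ _ hy']
          have := hA.parity hsim ((hf.sim_iff hy hy').1 hbb) (fun e => hyc (e.symm.trans hsim.1))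
          rw [SimpleGraph.adj_comm _ y, SimpleGraph.adj_comm _ y']
          exact (parity_comm.1 (parity_swap.1 this)))
      refine ⟨v, hv.1.symm.trans huc, fun y hy e => hvX (e ▸ Finset.mem_image_of_mem f hy),
        fun y hy _ => hsimiff v hv y hy, fun y hy hyc => ?_⟩
      rw [SimpleGraph.adj_comm, hvS _ (hfS y hy hyc), hτ y hy]
  · push Not at hX
    let W : Finset G.V := (X.filter fun y => A.color y = A.color x).image f
    have hW : ∀ b ∈ W, ∃ y ∈ X, A.color y = A.color x ∧ f y = b := fun b hb => by
      obtain ⟨y, hy, rfl⟩ := Finset.mem_image.1 hb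
      exact ⟨y, (Finset.mem_filter.1 hy).1, (Finset.mem_filter.1 hy).2, rfl⟩
    have hfW : ∀ y ∈ X, A.color y = A.color x → f y ∈ W := fun y hy hyc =>
      Finset.mem_image_of_mem f (Finset.mem_filter.2 ⟨hy, hyc⟩)
    have hu : ∃ u, G.color u = A.color x ∧ ∀ w ∈ W, ¬ G.Sim w u := by
      -- representatives of the cliques in question, together with `x`, form an independent set
      obtain ⟨T, hTX, hT, hTc⟩ :=
        exists_transversal (G := A) (X.filter fun y => A.color y = A.color x)
      have hTm : ∀ t ∈ T, t ∈ X ∧ A.color t = A.color x := fun t ht => Finset.mem_filter.1 (hTX ht)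
      have hxT : x ∉ T := fun e => hx (hTm x e).1
      have hcard := hA.bound (A.color x) (insert x T) (fun y hy => by
          rcases Finset.mem_insert.1 hy with rfl | hy
          exacts [rfl, (hTm y hy).2]) (fun y hy z hz hyz => by
          rcases Finset.mem_insert.1 hy with rfl | hy' <;>
            rcases Finset.mem_insert.1 hz with rfl | hz'
          · rfl
          · exact absurd hyz.symm (hX z (hTm z hz').1)
          · exact absurd hyz (hX y (hTm y hy').1)
          · exact hT y hy' z hz' hyz)
      rw [Finset.card_insert_of_notMem hxT] at hcard
      obtain ⟨u, huc, hu⟩ := h.exists_clique (A.color x) (T.image f)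
        (lt_of_lt_of_le (by exact_mod_cast Nat.lt_succ_of_le Finset.card_image_le) hcard)
      refine ⟨u, huc, fun w hw hs => ?_⟩
      obtain ⟨y, hy, hyc, rfl⟩ := hW w hw
      obtain ⟨t, ht, hty⟩ := hTc y (Finset.mem_filter.2 ⟨hy, hyc⟩)
      exact hu (f t) (Finset.mem_image_of_mem f ht)
        (hG.sim_trans ((hf.sim_iff (hTm t ht).1 hy).2 hty) hs)
    obtain ⟨v, hv, hvW, hvS⟩ := h.exists_new_clique hcd hSd (fun w hw => by
        obtain ⟨y, hy, hyc, rfl⟩ := hW w hw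
        rw [hf.color y hy, hyc]) τ (fun hsd b hb b' hb' hbb hne => by
        obtain ⟨y, hy, hyc, rfl⟩ := hS b hb
        obtain ⟨y', hy', hyc', rfl⟩ := hS b' hb'
        rw [hτ y hy, hτ y' hy']
        refine hA.mates ?_ ((hf.sim_iff hy hy').1 hbb) (fun e => hne (congrArg f e)) (Ne.symm hyc)
        rw [Color.eq_of_ne_of_ne hyc hcd.symm, hsd]) hu
    refine ⟨v, hv, fun y hy e => ?_, fun y hy hyc => iff_of_false (hvW _ (hfW y hy hyc)) (hX y hy),
      fun y hy hyc => ?_⟩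
    · by_cases hyc : A.color y = A.color x
      · exact hvW _ (hfW y hy hyc) (e ▸ Sim.refl _)
      · exact hyc (by rw [← hf.color y hy, e, hv])
    · rw [SimpleGraph.adj_comm, hvS _ (hfS y hy hyc), hτ y hy]

/-- Every finite member of the class embeds in `G`. -/
theorem exists_isEmbOn (h : IsRich s κ G) {A : TwoColGraph.{v}} (hA : InClass s κ A)
    (X : Finset A.V) : ∃ f : A.V → G.V, IsEmbOn A G X f := by
  classical
  induction X using Finset.induction_on with
  | empty =>
    obtain ⟨r, -, -⟩ := h.reduced.exists_not_sim .red
    rw [Finset.coe_empty]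
    exact ⟨fun _ => r, Set.injOn_empty _, fun _ h => h.elim, fun _ h => h.elim⟩
  | insert x X hx ih =>
    obtain ⟨f, hf⟩ := ih
    obtain ⟨v, hvc, hv⟩ := h.exists_extension hA hf hx
    refine ⟨Function.update f x v, ?_⟩
    rw [Finset.coe_insert]
    exact hf.insert hx hvc hv

/-- A countable graph that is homogeneous and has the extension property for a class to which it
belongs is the limit of this class. -/
theorem isLimitOf (h : IsRich s κ G) (hcount : Countable G.V) : G.IsLimitOf (finClass.{u} s κ) := by
  refine ⟨hcount, (homogeneous_iff G).2 h.reduced.homogeneous, ?_⟩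
  ext N
  constructor
  · rintro ⟨hN, ⟨φ⟩⟩
    have : Finite N := Language.Structure.fg_iff_finite.1 hN
    exact ⟨G.comap φ.toEmbedding, this, h.inClass.of_isEmbOn (isEmbOn_comap G _), ⟨equivComap G φ⟩⟩
  · intro hN
    refine ⟨Language.Structure.fg_iff_finite.2 (finClass.finite hN), ?_⟩
    obtain ⟨A, hAfin, hA, ⟨e⟩⟩ := hN
    have : Fintype A.V := Fintype.ofFinite _
    obtain ⟨f, hf⟩ := h.exists_isEmbOn hA Finset.univ
    rw [Finset.coe_univ] at hf
    exact ⟨hf.toEmbedding.comp e.toEmbedding⟩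

end IsRich
end TwoColGraph

namespace TwoColGraph

variable {G : TwoColGraph.{u}} {c d : Color}

/-! ### Independence numbers -/

theorem isIndepSet_iff {s : Finset G.V} (hs : ∀ x ∈ s, G.color x = c) :
    G.graph.IsIndepSet (s : Set G.V) ↔ ∀ x ∈ s, ∀ y ∈ s, G.Sim x y → x = y := by
  constructor
  · intro h x hx y hy hxy
    by_contra hne
    exact h hx hy hne (hxy.2.resolve_left hne)
  · intro h x hx y hy hne hxy
    exact hne (h x hx y hy ⟨(hs x hx).trans (hs y hy).symm, Or.inr hxy⟩)

theorem card_le_alpha {s : Finset G.V} (hs : ∀ x ∈ s, G.color x = c)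
    (h : ∀ x ∈ s, ∀ y ∈ s, G.Sim x y → x = y) : (s.card : ℕ∞) ≤ G.alpha c :=
  le_iSup (fun s : {s : Finset G.V // (∀ x ∈ s, G.color x = c) ∧
    G.graph.IsIndepSet (s : Set G.V)} => (s.1.card : ℕ∞)) ⟨s, hs, (isIndepSet_iff hs).2 h⟩

theorem exists_of_le_alpha {n : ℕ} (h : (n : ℕ∞) ≤ G.alpha c) : ∃ s : Finset G.V,
    (∀ x ∈ s, G.color x = c) ∧ (∀ x ∈ s, ∀ y ∈ s, G.Sim x y → x = y) ∧ n ≤ s.card := by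
  by_contra! hn
  have hn0 : 0 < n := by simpa using hn ∅ (by simp) (by simp)
  have hle : G.alpha c ≤ ((n - 1 : ℕ) : ℕ∞) := iSup_le fun s => by
    have := hn s.1 s.2.1 ((isIndepSet_iff s.2.1).1 s.2.2)
    exact_mod_cast Nat.le_sub_one_of_lt this
  have : n ≤ n - 1 := by exact_mod_cast h.trans hle
  omega

theorem exists_of_card_lt_alpha (hG : ∀ c, G.ClassIsCliques c) {t : Finset G.V}
    (h : (t.card : ℕ∞) < G.alpha c) : ∃ u, G.color u = c ∧ ∀ y ∈ t, ¬ G.Sim y u := by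
  obtain ⟨s, hs, hsi, hcard⟩ := exists_of_le_alpha (n := t.card + 1) (c := c) (G := G)
    (by exact_mod_cast Order.add_one_le_of_lt h)
  by_contra! hu
  choose! f hf hfs using fun u (hu' : u ∈ s) => hu u (hs u hu')
  obtain ⟨x, hx, y, hy, hne, hxy⟩ := Finset.exists_ne_map_eq_of_card_lt_of_maps_to
    (Nat.lt_of_succ_le hcard) hf
  exact hne (hsi x hx y hy ((hfs x hx).symm.trans hG (hxy ▸ hfs y hy)))

theorem alpha_eq_top_iff (hG : ∀ c, G.ClassIsCliques c) : G.alpha c = ⊤ ↔ G.ManyCliques c := by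
  classical
  constructor
  · exact fun h X => exists_of_card_lt_alpha hG (h ▸ ENat.natCast_lt_top _)
  · intro h
    by_contra hne
    obtain ⟨k, hk⟩ := ENat.ne_top_iff_exists.1 hne
    obtain ⟨s, hs, hsi, hcard⟩ := exists_of_le_alpha hk.le
    obtain ⟨x, hx, hxs⟩ := h s
    have hle := card_le_alpha (s := insert x s) (c := c) (fun y hy => by
        rcases Finset.mem_insert.1 hy with rfl | hy
        exacts [hx, hs y hy]) (fun y hy z hz hyz => by
        rcases Finset.mem_insert.1 hy with e | hy' <;>
          rcases Finset.mem_insert.1 hz with e' | hz'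
        · exact e.trans e'.symm
        · exact absurd (e ▸ hyz.symm) (hxs z hz')
        · exact absurd (e' ▸ hyz) (hxs y hy')
        · exact hsi y hy' z hz' hyz)
    rw [Finset.card_insert_of_notMem fun hxm => hxs x hxm (Sim.refl _), ← hk] at hle
    have : s.card + 1 ≤ k := by exact_mod_cast hle
    omega

/-! ### Twins and blow-ups -/

/-- If some two adjacent vertices of one colour are twins, then by homogeneity any two are, and the
graph is a blow-up of the subgraph induced by one vertex of each clique of that colour and all
vertices of the other colour. -/
theorem Homogeneous.isBlowUp (hG : G.Homogeneous) (hcl : ∀ c, G.ClassIsCliques c)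
    (hcount : Countable G.V) {x₀ y₀ : G.V} (h : G.Sim x₀ y₀) (hne : x₀ ≠ y₀)
    (htw : ∀ z, G.color z ≠ G.color x₀ → (G.graph.Adj x₀ z ↔ G.graph.Adj y₀ z)) :
    G.IsBlowUp := by
  classical
  have twin : ∀ x y z, G.color x = G.color x₀ → G.Sim x y → G.color z ≠ G.color x₀ →
      (G.graph.Adj x z ↔ G.graph.Adj y z) := by
    intro x y z hx hxy hz
    by_cases hne' : x = y
    · rw [hne']
    obtain ⟨g, hg, gx, gy⟩ := hG.exists_aut_edge hxy h hne' hne hx.symm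
    rw [← hg.adj x z, ← hg.adj y z, gx, gy]
    exact htw _ (hg.color z ▸ hz)
  -- representatives of the cliques of the colour of `x₀`
  let S : Setoid G.V := ⟨G.Sim, Sim.refl, Sim.symm, fun h h' => h.trans hcl h'⟩
  let rep : G.V → G.V := fun x => if G.color x = G.color x₀ then (Quotient.mk S x).out else x
  have rep_sim : ∀ x, G.Sim (rep x) x := fun x => by
    by_cases hx : G.color x = G.color x₀
    · rw [show rep x = (Quotient.mk S x).out from if_pos hx]
      exact Quotient.exact (s := S) (Quotient.out_eq _)
    · rw [show rep x = x from if_neg hx]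
      exact Sim.refl _
  have rep_eq : ∀ x y, G.color x = G.color x₀ → G.Sim x y → rep x = rep y := fun x y hx hxy => by
    change ite _ _ _ = ite _ _ _
    rw [if_pos hx, if_pos (hxy.1.symm.trans hx), Quotient.sound (s := S) hxy]
  have rep_ne : ∀ x, G.color x ≠ G.color x₀ → rep x = x := fun x hx => if_neg hx
  have rep_rep : ∀ x, rep (rep x) = rep x := fun x => by
    by_cases hx : G.color x = G.color x₀
    · exact (rep_eq x _ hx (rep_sim x).symm).symm
    · rw [rep_ne x hx, rep_ne x hx]
  -- the cliques are indexed by the clique of `x₀`, coded as a set of natural numbers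
  obtain ⟨code, hcode⟩ := hcount.exists_injective_nat'
  let I : Type := code '' {y | G.Sim x₀ y}
  let e : {y | G.Sim x₀ y} ≃ I := Equiv.Set.image code _ hcode
  have hex : ∀ r, ∃ g : G.V ≃ G.V, G.color r = G.color x₀ → G.IsAut g ∧ g x₀ = r := fun r => by
    by_cases hr : G.color r = G.color x₀
    · obtain ⟨g, hg⟩ := hG.exists_aut_vertex hr
      exact ⟨g, fun _ => hg⟩
    · exact ⟨Equiv.refl _, fun h => absurd h hr⟩
  choose g hg using hex
  let H : TwoColGraph.{u} := G.comap (W := {x // rep x = x}) ⟨Subtype.val, Subtype.val_injective⟩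
  let F : (H.blowUp (G.color x₀) I).V → G.V := fun x => match x with
    | .inl p => g p.1.1.1 (e.symm p.2).1
    | .inr y => y.1.1
  let b : (H.blowUp (G.color x₀) I).V → G.V := fun x => (H.blowUpBase (G.color x₀) I x).1
  have hb : ∀ x, rep (b x) = b x := fun x => (H.blowUpBase (G.color x₀) I x).2
  have F_sim : ∀ x, G.Sim (b x) (F x) := by
    rintro (p | y)
    · have hp := hg p.1.1.1 p.1.2
      have := (hp.1.sim_iff x₀ (e.symm p.2).1).2 (e.symm p.2).2
      rwa [hp.2] at this
    · exact Sim.refl _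
  have F_eq : ∀ x, G.color (F x) ≠ G.color x₀ → F x = b x := by
    rintro (p | y) hx
    · exact absurd ((F_sim (.inl p)).1.symm.trans p.1.2) hx
    · rfl
  have b_eq : ∀ x y, G.Sim (F x) (F y) → G.color (F x) = G.color x₀ → b x = b y := by
    intro x y hxy hx
    have hs : G.Sim (b x) (b y) := (F_sim x).trans hcl (hxy.trans hcl (F_sim y).symm)
    rw [← hb x, ← hb y]
    exact rep_eq _ _ ((F_sim x).1.trans hx) hs
  have F_inj : Function.Injective F := by
    rintro x y hxy
    by_cases hx : G.color (F x) = G.color x₀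
    · have hbe := b_eq x y (hxy ▸ Sim.refl _) hx
      rcases x with p | x
      · rcases y with q | y
        · have hpq : p.1 = q.1 := Subtype.ext (Subtype.ext hbe)
          obtain ⟨p₁, p₂⟩ := p
          obtain ⟨q₁, q₂⟩ := q
          obtain rfl : p₁ = q₁ := hpq
          have := e.symm.injective (Subtype.ext ((g p₁.1.1).injective hxy))
          exact congrArg (fun i => Sum.inl (p₁, i)) this
        · exact absurd ((congrArg G.color hxy).symm.trans hx) y.2
      · exact absurd hx x.2
    · have hbe : b x = b y := (F_eq x hx).symm.trans (hxy.trans (F_eq y (hxy ▸ hx)))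
      rcases x with p | x
      · exact absurd ((F_sim (.inl p)).1.symm.trans p.1.2) hx
      · rcases y with q | y
        · exact absurd ((congrArg G.color hbe).trans q.1.2) x.2
        · exact congrArg Sum.inr (Subtype.ext (Subtype.ext hbe))
  have F_surj : Function.Surjective F := by
    intro y
    by_cases hy : G.color y = G.color x₀
    · have hr : G.color (rep y) = G.color x₀ := (rep_sim y).1.trans hy
      have hp := hg (rep y) hr
      have hs : G.Sim x₀ ((g (rep y)).symm y) := by
        have := (hp.1.symm.sim_iff (rep y) y).2 (rep_sim y)
        rwa [(Equiv.symm_apply_eq _).2 hp.2.symm] at this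
      refine ⟨.inl (⟨⟨rep y, rep_rep y⟩, hr⟩, e ⟨_, hs⟩), ?_⟩
      change g (rep y) (e.symm (e ⟨_, hs⟩)).1 = y
      rw [Equiv.symm_apply_apply, Equiv.apply_symm_apply]
    · exact ⟨.inr ⟨⟨y, rep_ne y hy⟩, hy⟩, rfl⟩
  have F_emb : IsEmbOn (H.blowUp (G.color x₀) I) G Set.univ F := by
    refine ⟨F_inj.injOn, fun x _ => (F_sim x).1.symm, fun x _ y _ => ?_⟩
    suffices G.graph.Adj (F x) (F y) ↔ G.graph.Adj (b x) (b y) ∨ (b x = b y ∧ x ≠ y) from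
      this.trans (or_congr_right (and_congr_left' Subtype.ext_iff.symm))
    have hxc := (F_sim x).1
    have hyc := (F_sim y).1
    by_cases hx : G.color (F x) = G.color x₀ <;> by_cases hy : G.color (F y) = G.color x₀
    · rw [adj_iff_sim (hx.trans hy.symm), F_inj.ne_iff]
      constructor
      · exact fun h => Or.inr ⟨b_eq x y h.1 hx, h.2⟩
      · rintro (h | h)
        · have := rep_eq _ _ (hxc.trans hx) ⟨hxc.trans (hx.trans (hyc.trans hy).symm), Or.inr h⟩
          rw [hb, hb] at this
          exact absurd this h.ne
        · exact ⟨(F_sim x).symm.trans hcl (h.1 ▸ F_sim y), h.2⟩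
    · have hbn : b x ≠ b y := fun e => hy (by rw [← hyc, ← e, hxc, hx])
      rw [← twin (b x) (F x) (F y) (hxc.trans hx) (F_sim x) hy, F_eq y hy]
      simp [hbn]
    · have hbn : b x ≠ b y := fun e => hx (by rw [← hxc, e, hyc, hy])
      rw [SimpleGraph.adj_comm, ← twin (b y) (F y) (F x) (hyc.trans hy) (F_sim y) hx, F_eq x hx,
        SimpleGraph.adj_comm]
      simp [hbn]
    · have : b x = b y → x = y := fun e => F_inj (by rw [F_eq x hx, F_eq y hy, e])
      rw [F_eq x hx, F_eq y hy]
      exact ⟨Or.inl, fun h => h.elim id fun h => absurd (this h.1) h.2⟩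
  refine ⟨H, G.color x₀, I, fun x hx y hy hxy h => ?_, ?_, inferInstance,
    ⟨(equivOfIsEmbOn (Equiv.ofBijective F ⟨F_inj, F_surj⟩) F_emb).symm⟩⟩
  · refine hxy (Subtype.ext ?_)
    have := rep_eq x.1 y.1 hx ⟨hx.trans hy.symm, Or.inr h⟩
    rwa [x.2, y.2] at this
  · exact ⟨e ⟨x₀, Sim.refl _⟩, e ⟨y₀, h⟩, fun he => hne (congrArg Subtype.val (e.injective he))⟩

theorem IsBasicCUH.isReduced (h : G.IsBasicCUH) : G.IsReduced where
  homogeneous := (homogeneous_iff G).1 h.ultrahomogeneous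
  cliques := h.cliques
  infinite := h.infinite
  twinFree x y hxy hne := by
    by_contra! htw
    exact h.not_blowUp (((homogeneous_iff G).1 h.ultrahomogeneous).isBlowUp h.cliques h.countable
      hxy hne htw)
  exists_not_sim c := by
    obtain ⟨s, hs, hsi, hcard⟩ := exists_of_le_alpha (n := 2) (h.two_le_alpha c)
    obtain ⟨x, hx, y, hy, hne⟩ := Finset.one_lt_card.1 hcard
    exact ⟨x, y, hs x hx, hs y hy, fun hxy => hne (hsi x hx y hy hxy)⟩

/-! ### Interchanging the colours -/

theorem _root_.Color.other_inj {a b : Color} : a.other = b.other ↔ a = b := by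
  cases a <;> cases b <;> simp [Color.other]

theorem _root_.Color.other_other (a : Color) : a.other.other = a := by
  cases a <;> rfl

theorem swap_color_eq {x : G.V} : G.swap.color x = c ↔ G.color x = c.other := by
  change (G.color x).other = c ↔ _
  rw [← Color.other_inj, Color.other_other]

theorem swap_sim {x y : G.V} : G.swap.Sim x y ↔ G.Sim x y :=
  and_congr_left' Color.other_inj

theorem swap_hasEdge : G.swap.HasEdge c ↔ G.HasEdge c.other :=
  exists₂_congr fun _ _ => and_congr swap_color_eq (and_congr_left' swap_sim)

theorem swap_hasTriangle : G.swap.HasTriangle c ↔ G.HasTriangle c.other :=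
  exists₃_congr fun _ _ _ => and_congr swap_color_eq
    (and_congr swap_sim (and_congr_left' swap_sim))

theorem swap_manyCliques : G.swap.ManyCliques c ↔ G.ManyCliques c.other :=
  forall_congr' fun _ => exists_congr fun _ => and_congr swap_color_eq
    (forall₂_congr fun _ _ => not_congr swap_sim)

theorem CrossParity.swap (h : G.CrossParity) : G.swap.CrossParity :=
  fun _ _ _ _ hx hy hxy => h (swap_sim.1 hx) (swap_sim.1 hy) fun e => hxy (Color.other_inj.2 e)

theorem IsReduced.swap (h : G.IsReduced) : G.swap.IsReduced where
  homogeneous s f hf := by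
    obtain ⟨g, hg, hgf⟩ := h.homogeneous s f
      ⟨hf.inj, fun x hx => Color.other_inj.1 (hf.color x hx), hf.adj⟩
    exact ⟨g, ⟨fun x => Color.other_inj.2 (hg.color x), hg.adj⟩, hgf⟩
  cliques c x y z hx hy hz := h.cliques c.other x y z (swap_color_eq.1 hx) (swap_color_eq.1 hy)
    (swap_color_eq.1 hz)
  infinite := h.infinite
  twinFree x y hxy hne := by
    obtain ⟨z, hz, hn⟩ := h.twinFree x y (swap_sim.1 hxy) hne
    exact ⟨z, fun e => hz (Color.other_inj.1 e), hn⟩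
  exists_not_sim c := by
    obtain ⟨x, y, hx, hy, hn⟩ := h.exists_not_sim c.other
    exact ⟨x, y, swap_color_eq.2 hx, swap_color_eq.2 hy, fun e => hn (swap_sim.1 e)⟩

end TwoColGraph

namespace TwoColGraph

variable {G : TwoColGraph.{u}} {c d : Color}

/-! ### Bipartite graphs -/

/-- The vertices `b` of the other colour with `r b` an edge if `p` holds, and with `r b` a non-edge
if `p` does not hold. -/
def crossNbrs (G : TwoColGraph.{u}) (p : Prop) (r : G.V) : Set G.V :=
  {b | G.color b ≠ G.color r ∧ (G.graph.Adj r b ↔ p)}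

theorem mem_crossNbrs_comm {p : Prop} {r b : G.V} :
    b ∈ G.crossNbrs p r ↔ r ∈ G.crossNbrs p b := by
  change _ ∧ _ ↔ _ ∧ _
  rw [ne_comm, SimpleGraph.adj_comm]

theorem IsAut.mem_crossNbrs {g : G.V ≃ G.V} (hg : G.IsAut g) {p : Prop} {r b : G.V} :
    g b ∈ G.crossNbrs p (g r) ↔ b ∈ G.crossNbrs p r := by
  change _ ∧ _ ↔ _ ∧ _
  rw [hg.color, hg.color, hg.adj]

namespace IsReduced

theorem eq_of_sim (he : ∀ c, ¬ G.HasEdge c) {x y : G.V} (h : G.Sim x y) : x = y := by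
  by_contra hne
  exact he _ ⟨x, y, rfl, h, hne⟩

theorem isHomogeneouslyConnected_of_forall {p : Prop}
    (h : ∀ x y, G.color x ≠ G.color y → (G.graph.Adj x y ↔ p)) : G.IsHomogeneouslyConnected := by
  by_cases hp : p
  · exact Or.inl fun x y hxy => (h x y hxy).2 hp
  · exact Or.inr fun x y hxy e => hp ((h x y hxy).1 e)

theorem isHomogeneouslyConnected_of_finite (hG : G.IsReduced) (he : ∀ c, ¬ G.HasEdge c)
    (hc : {x | G.color x = c}.Finite) : G.IsHomogeneouslyConnected := by
  have key : ∀ x y x' y', G.color x = c → G.color x' = c → G.color y ≠ c → G.color y' ≠ c →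
      (G.graph.Adj x y ↔ G.graph.Adj x' y') := by
    intro x y x' y' hx hx' hy hy'
    obtain ⟨g, hg, gx⟩ := hG.homogeneous.exists_aut_vertex (hx'.trans hx.symm)
    rw [← hg.adj, gx]
    by_cases hyy : g y = y'
    · rw [hyy]
    · exact hG.adj_iff_of_finite hc hx' (hg.color y ▸ hy) hy' fun e => hyy (eq_of_sim he e)
  by_cases h : ∃ x y, G.color x = c ∧ G.color y ≠ c
  · obtain ⟨x, y, hx, hy⟩ := h
    refine isHomogeneouslyConnected_of_forall (p := G.graph.Adj x y) fun x' y' hxy => ?_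
    by_cases hx' : G.color x' = c
    · exact key x' y' x y hx' hx (fun e => hxy (hx'.trans e.symm)) hy
    · have hy' : G.color y' = c := by
        by_contra hy'
        exact hxy (Color.eq_of_ne_of_ne hx' hy')
      rw [SimpleGraph.adj_comm]
      exact key y' x' x y hy' hx hx' hy
  · push Not at h
    obtain ⟨x, -, hx, -⟩ := hG.exists_not_sim c
    exact Or.inl fun y z hyz => absurd ((h x y hx).trans (h x z hx).symm) hyz

/-- Between vertices of one colour, every injection of finite sets extends to an automorphism. -/
theorem exists_aut_of_injOn (hG : G.IsReduced) (he : ∀ c, ¬ G.HasEdge c) {S : Finset G.V}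
    {f : G.V → G.V} (hS : ∀ b ∈ S, G.color b = c) (hf : ∀ b ∈ S, G.color (f b) = c)
    (hinj : ∀ b ∈ S, ∀ b' ∈ S, f b = f b' → b = b') : ∃ g, G.IsAut g ∧ ∀ b ∈ S, g b = f b := by
  obtain ⟨d, hd⟩ : ∃ d, c ≠ d := by
    cases c
    exacts [⟨.blue, by simp⟩, ⟨.red, by simp⟩]
  obtain ⟨g, hg, -, h⟩ := hG.homogeneous.exists_aut_fixing (W := ∅) (c := d) (S := S) (f := f)
    (by simp) (fun b hb => hS b hb ▸ hd) (fun b hb => hf b hb ▸ hd) hinj (fun b hb b' hb' =>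
      ⟨fun e => hinj b hb b' hb' (eq_of_sim he e) ▸ Sim.refl _,
        fun e => eq_of_sim he e ▸ Sim.refl _⟩) (by simp)
  exact ⟨g, hg, h⟩

theorem crossIsGeneric (hG : G.IsReduced) (he : ∀ c, ¬ G.HasEdge c)
    (hinf : ∀ r p, (G.crossNbrs p r).Infinite) : G.CrossIsGeneric := by
  classical
  intro c S T hST hS hT
  obtain ⟨d, hd⟩ : ∃ d, d ≠ c := by
    cases c
    exacts [⟨.blue, by simp⟩, ⟨.red, by simp⟩]
  obtain ⟨y, -, hy, -⟩ := hG.exists_not_sim d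
  have hyc : G.color y ≠ c := hy ▸ hd
  have hUc : ∀ x ∈ S ∪ T, G.color x = c := fun x hx => by
    rcases Finset.mem_union.1 hx with hx | hx
    exacts [hS x hx, hT x hx]
  -- a copy of `S ∪ T` that is related to `y` as prescribed
  obtain ⟨f, hf, -, hfi⟩ := exists_fresh_choice (R := Eq) (fun _ _ => Eq.symm) (T := S ∪ T)
    (P := fun t b => b ∈ G.crossNbrs (t ∈ S) y) (fun t _ X => by
      obtain ⟨b, hb, hbX⟩ := (hinf y (t ∈ S)).exists_notMem_finset X
      exact ⟨b, hb, fun z hz e => hbX (e ▸ hz)⟩) ∅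
  obtain ⟨g, hg, hgf⟩ := hG.exists_aut_of_injOn he hUc
    (fun x hx => Color.eq_of_ne_of_ne (c := d) (hy ▸ (hf x hx).1) hd.symm) hfi
  have hadj : ∀ x ∈ S ∪ T, (G.graph.Adj (g.symm y) x ↔ x ∈ S) := fun x hx => by
    rw [← hg.adj, g.apply_symm_apply, hgf x hx]
    exact (hf x hx).2
  refine ⟨g.symm y, ?_, fun x hx => ?_, fun x hx => ?_⟩
  · rwa [hg.symm.color]
  · exact (hadj x (Finset.mem_union_left _ hx)).2 hx
  · exact fun h => Finset.disjoint_left.1 hST ((hadj x (Finset.mem_union_right _ hx)).1 h) hx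

/-- If `r` has only finitely many neighbours, then there is a vertex that has no neighbour in
common with `r`, and hence no vertex has: all pairs of distinct vertices of a colour are
equivalent. -/
theorem eq_of_mem_crossNbrs (hG : G.IsReduced) (he : ∀ c, ¬ G.HasEdge c)
    (hinf : ∀ c, {x | G.color x = c}.Infinite) {p : Prop} {r r' b : G.V}
    (hfin : (G.crossNbrs p r).Finite) (hr : G.color r' = G.color r) (hb : b ∈ G.crossNbrs p r)
    (hb' : b ∈ G.crossNbrs p r') : r = r' := by
  classical
  by_contra hne
  have hbc : ∀ x ∈ hfin.toFinset, G.color x = G.color b := fun x hx =>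
    Color.eq_of_ne_of_ne (hfin.mem_toFinset.1 hx).1 hb.1
  obtain ⟨f, hf, hfX, hfi⟩ := exists_fresh_choice (R := Eq) (fun _ _ => Eq.symm)
    (T := hfin.toFinset) (P := fun _ x => G.color x = G.color b) (fun _ _ X => by
      obtain ⟨x, hx, hxX⟩ := (hinf (G.color b)).exists_notMem_finset X
      exact ⟨x, hx, fun z hz e => hxX (e ▸ hz)⟩) hfin.toFinset
  obtain ⟨g, hg, hgf⟩ := hG.exists_aut_of_injOn he hbc hf hfi
  -- `r` and `g r` have no neighbour in common
  have hdisj : ∀ x, x ∈ G.crossNbrs p r → x ∉ G.crossNbrs p (g r) := fun x hx hx' => by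
    have hx'' : g.symm x ∈ G.crossNbrs p r := by
      rwa [← hg.mem_crossNbrs, g.apply_symm_apply]
    have hm := hfin.mem_toFinset.2 hx''
    have := hgf _ hm
    rw [g.apply_symm_apply] at this
    exact hfX _ hm x (hfin.mem_toFinset.2 hx) this
  have hgr : r ≠ g r := fun e => hdisj b hb (e ▸ hb)
  have hgc := hg.color r
  obtain ⟨k, hk, kr, kr'⟩ := hG.homogeneous.exists_aut_pair (x := r) (x' := r) (y := r') (y' := g r)
    rfl (hgc.trans hr.symm) (compatible_of_not_sim hr.symm hgc.symm (fun e => hne (eq_of_sim he e))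
      fun e => hgr (eq_of_sim he e))
  refine hdisj (k b) ?_ ?_
  · rw [← kr, hk.mem_crossNbrs]
    exact hb
  · rw [← kr', hk.mem_crossNbrs]
    exact hb'

/-- The classification of the graphs in which both colour classes are independent sets. -/
theorem isJenkinsonBipartite (hG : G.IsReduced) (hcount : Countable G.V)
    (he : ∀ c, ¬ G.HasEdge c) : G.IsJenkinsonBipartite := by
  refine ⟨hcount, fun c x hx y hy hne h => hne (eq_of_sim he ⟨hx.trans hy.symm, Or.inr h⟩), ?_⟩
  by_cases hinf : ∀ c, {x | G.color x = c}.Infinite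
  swap
  · push Not at hinf
    obtain ⟨c, hc⟩ := hinf
    exact Or.inl (hG.isHomogeneouslyConnected_of_finite he hc)
  by_cases hN : ∀ r p, (G.crossNbrs p r).Infinite
  · exact Or.inr (Or.inr (Or.inr (hG.crossIsGeneric he hN)))
  push Not at hN
  obtain ⟨r, p, hfin⟩ := hN
  by_cases hne : (G.crossNbrs p r).Nonempty
  swap
  · refine Or.inl (isHomogeneouslyConnected_of_forall (p := ¬ p) ?_)
    have key : ∀ x y, G.color x = G.color r → G.color y ≠ G.color r → (G.graph.Adj x y ↔ ¬ p) := by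
      intro x y hx hy
      obtain ⟨g, hg, gr⟩ := hG.homogeneous.exists_aut_vertex hx.symm
      have hn : ¬ (G.graph.Adj x y ↔ p) := fun e => hne ⟨g y, by
        rw [← gr, hg.mem_crossNbrs]
        exact ⟨hx ▸ hy, e⟩⟩
      grind
    intro x y hxy
    by_cases hx : G.color x = G.color r
    · exact key x y hx fun e => hxy (hx.trans e.symm)
    · rw [SimpleGraph.adj_comm]
      refine key y x ?_ hx
      by_contra hy
      exact hxy (Color.eq_of_ne_of_ne hx hy)
  obtain ⟨b, hb⟩ := hne
  -- `r` is the only neighbour of `b`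
  have hfin' : (G.crossNbrs p b).Finite := (Set.finite_singleton r).subset fun x hx =>
    (hG.eq_of_mem_crossNbrs he hinf hfin
      (Color.eq_of_ne_of_ne hx.1 (mem_crossNbrs_comm.1 hb).1) hb (mem_crossNbrs_comm.1 hx)).symm
  have huniq : ∀ x, ∃! y, G.color x ≠ G.color y ∧ (G.graph.Adj x y ↔ p) := by
    -- this holds for `r` and for `b`, and every vertex is equivalent to one of these
    have key : ∀ r b, b ∈ G.crossNbrs p r → (G.crossNbrs p b).Finite → ∀ x,
        G.color x = G.color r → ∃! y, G.color x ≠ G.color y ∧ (G.graph.Adj x y ↔ p) := by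
      intro r b hb hfin x hx
      obtain ⟨g, hg, gr⟩ := hG.homogeneous.exists_aut_vertex hx
      obtain rfl := gr
      refine ⟨g b, ⟨((hg.mem_crossNbrs).2 hb).1.symm, ((hg.mem_crossNbrs).2 hb).2⟩,
        fun y hy => ?_⟩
      have hy' : g.symm y ∈ G.crossNbrs p r := by
        rw [← hg.mem_crossNbrs, g.apply_symm_apply]
        exact ⟨hy.1.symm, hy.2⟩
      rw [hG.eq_of_mem_crossNbrs he hinf hfin (Color.eq_of_ne_of_ne hy'.1 hb.1)
        (mem_crossNbrs_comm.1 hb) (mem_crossNbrs_comm.1 hy'), g.apply_symm_apply]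
    intro x
    by_cases hx : G.color x = G.color r
    · exact key r b hb hfin' x hx
    · exact key b r (mem_crossNbrs_comm.1 hb) hfin x (Color.eq_of_ne_of_ne hx hb.1)
  by_cases hp : p
  · refine Or.inr (Or.inl fun x => ?_)
    simpa only [hp, iff_true] using huniq x
  · refine Or.inr (Or.inr (Or.inl fun x => ?_))
    obtain ⟨y, hy, hy'⟩ := huniq x
    refine ⟨y, ⟨hy.1, Or.inr ⟨hy.1, fun e => hp (hy.2.1 e)⟩⟩, fun z hz => hy' z ⟨hz.1, ?_⟩⟩
    exact iff_of_false (hz.2.resolve_left fun e => hz.1 e.1).2 hp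

end IsReduced

end TwoColGraph

namespace TwoColGraph

variable {G : TwoColGraph.{u}} {c d : Color}

/-! ### The classification -/

namespace IsReduced

/-- The possible values of the clique sizes of the colour `c`: cliques of size at least three count
as large. -/
theorem exists_size (hG : G.IsReduced) (c : Color) : ∃ s, G.SizeCondition c s ∧
    (s = .one → ¬ G.HasEdge c) ∧ (s = .two → G.HasEdge c) ∧ (s = .many ↔ G.HasTriangle c) := by
  by_cases ht : G.HasTriangle c
  · exact ⟨.many, trivial, by simp, by simp, by simp [ht]⟩
  by_cases he : G.HasEdge c
  · exact ⟨.two, hG.sizeCondition_two ht, by simp, by simp [he], by simp [ht]⟩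
  · refine ⟨.one, fun x y hx hxy => ?_, by simp [he], by simp, by simp [ht]⟩
    by_contra hne
    exact he ⟨x, y, hx, hxy, hne⟩

/-- A reduced graph with infinitely many blue cliques is the limit of the class given by the sizes
of its cliques and the number of its red cliques, provided that this class is admissible. -/
theorem isLimitOf (hG : G.IsReduced) (hpar : G.CrossParity) (hcount : Countable G.V)
    {r b : CliqueSize} (hr : G.SizeCondition .red r ∧ (r = .one → ¬ G.HasEdge .red) ∧
      (r = .two → G.HasEdge .red) ∧ (r = .many ↔ G.HasTriangle .red))
    (hb : G.SizeCondition .blue b ∧ (b = .one → ¬ G.HasEdge .blue) ∧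
      (b = .two → G.HasEdge .blue) ∧ (b = .many ↔ G.HasTriangle .blue))
    (he : ∃ c, G.HasEdge c) (hm : G.ManyCliques .blue)
    (hv : Admissible (sizes r b) (redBound (G.alpha .red))) :
    G.IsLimitOf (finClass.{u} (sizes r b) (redBound (G.alpha .red))) := by
  have hα : ∀ c, redBound (G.alpha .red) c = G.alpha c := by
    rintro (_ | _)
    · rfl
    · exact ((alpha_eq_top_iff hG.cliques).2 hm).symm
  refine IsRich.isLimitOf
    { reduced := hG
      inClass := inClass_sizes_iff.2 ⟨hG.cliques, hpar, ⟨hr.1, hb.1⟩, fun t => card_le_alpha⟩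
      admissible := hv
      exists_hasEdge := he
      hasEdge := ?_
      hasTriangle := ?_
      manyCliques := fun c h => (alpha_eq_top_iff hG.cliques).1 ((hα c).symm.trans h)
      exists_clique := fun c t ht => exists_of_card_lt_alpha hG.cliques (hα c ▸ ht) } hcount
  · rintro (_ | _)
    exacts [hr.2.2.1, hb.2.2.1]
  · rintro (_ | _)
    exacts [hr.2.2.2.1, hb.2.2.2.1]

/-- The classification when the colours are such that the large cliques are red. -/
theorem isLimitOf_classes (hG : G.IsReduced) (hpar : G.CrossParity) (hcount : Countable G.V)
    (he : G.HasEdge .red) (hm : G.ManyCliques .blue)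
    (ht : G.HasTriangle .blue → G.HasTriangle .red) :
    (∀ k : ℕ, G.alpha .red = k →
      G.IsLimitOf (classInfOneFin k) ∨ G.IsLimitOf (classInfTwoFin k)) ∧
    (G.alpha .red = ⊤ → G.IsLimitOf classTwoOne ∨ G.IsLimitOf classInfOne ∨
      G.IsLimitOf classTwoTwo ∨ G.IsLimitOf classInfTwo ∨ G.IsLimitOf classInfInf) := by
  have hmany : ¬ G.HasTriangle .red ∨ G.HasTriangle .blue → G.alpha .red = ⊤ := by
    refine fun h => (alpha_eq_top_iff hG.cliques).2 ?_
    rcases h with h | h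
    · exact hG.manyCliques_of_not_hasTriangle he h
    · by_contra hn
      exact hG.not_hasTriangle hpar (c := .blue) (d := .red) (by simp) hn hm h
  obtain ⟨r, hr⟩ := hG.exists_size .red
  obtain ⟨b, hb⟩ := hG.exists_size .blue
  have hlim := hG.isLimitOf hpar hcount hr hb ⟨_, he⟩ hm
  rw [classTwoOne_eq, classInfOne_eq, classTwoTwo_eq, classInfTwo_eq, classInfInf_eq]
  have hr1 : r ≠ .one := fun h => hr.2.1 h he
  constructor
  · intro k hk
    rw [classInfOneFin_eq, classInfTwoFin_eq]
    have hne : ¬ (¬ G.HasTriangle .red ∨ G.HasTriangle .blue) := fun h =>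
      ENat.natCast_ne_top k (hk.symm.trans (hmany h))
    push Not at hne
    rw [hk] at hlim
    obtain rfl := hr.2.2.2.2 hne.1
    have hbm : b ≠ .many := fun h => hne.2 (hb.2.2.2.1 h)
    have := hlim (admissible_many hbm k)
    cases b with
    | one => exact Or.inl this
    | two => exact Or.inr this
    | many => exact absurd rfl hbm
  · intro hk
    rw [hk] at hlim
    have := hlim (admissible_top r b)
    cases r with
    | one => exact absurd rfl hr1
    | two =>
      cases b with
      | one => exact Or.inl this
      | two => exact Or.inr (Or.inr (Or.inl this))
      | many => exact absurd (hr.2.2.2.2 (ht (hb.2.2.2.1 rfl))) (by simp)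
    | many =>
      cases b with
      | one => exact Or.inr (Or.inl this)
      | two => exact Or.inr (Or.inr (Or.inr (Or.inl this)))
      | many => exact Or.inr (Or.inr (Or.inr (Or.inr this)))

/-- One of the colours can play the part of red: the colour with finitely many cliques, if there is
one, and otherwise a colour with cliques as large as those of the other colour. -/
theorem exists_color (hG : G.IsReduced) (hpar : G.CrossParity) (he : ∃ c, G.HasEdge c) :
    ∃ c : Color, G.HasEdge c ∧ G.ManyCliques c.other ∧
      (G.HasTriangle c.other → G.HasTriangle c) := by
  have hne : ∀ c : Color, c ≠ c.other := by rintro (_ | _) <;> simp [Color.other]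
  by_cases hm : ∀ c, G.ManyCliques c
  · by_cases ht : ∃ c, G.HasTriangle c
    · obtain ⟨c, x, y, z, hx, hxy, h⟩ := ht
      exact ⟨c, ⟨x, y, hx, hxy, h.2.1⟩, hm _, fun _ => ⟨x, y, z, hx, hxy, h⟩⟩
    · push Not at ht
      obtain ⟨c, hc⟩ := he
      exact ⟨c, hc, hm _, fun h => absurd h (ht _)⟩
  · push Not at hm
    obtain ⟨d, hd⟩ := hm
    obtain ⟨e, hee⟩ := he
    have hmd : G.ManyCliques d.other := by
      by_contra hn
      exact hG.infinite_of_hasEdge hee d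
        (class_finite hd fun x hx => hG.clique_finite hpar (hne d) hn hx)
    have htd : ¬ G.HasTriangle d.other := hG.not_hasTriangle hpar (hne d).symm hd hmd
    refine ⟨d, ?_, hmd, fun h => absurd h htd⟩
    by_contra hn
    exact hd (hG.manyCliques_of_not_hasTriangle hee
      fun ⟨x, y, _, hx, hxy, h⟩ => hn ⟨x, y, hx, hxy, h.2.1⟩)

end IsReduced

end TwoColGraph

/-- Each of the listed classes is a Fraïssé (amalgamation) class, and, up to interchanging the
colours, every basic CUH graph that omits `D` or `D̃` and is not one of the bipartite graphs of
Jenkinson et al. is the Fraïssé limit of one of them. -/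
theorem theorem5 :
    ((∀ k : ℕ, 2 ≤ k →
        FirstOrder.Language.IsFraisse (TwoColGraph.classInfOneFin.{u} k) ∧
        FirstOrder.Language.IsFraisse (TwoColGraph.classInfTwoFin.{u} k)) ∧
      FirstOrder.Language.IsFraisse TwoColGraph.classTwoOne.{u} ∧
      FirstOrder.Language.IsFraisse TwoColGraph.classInfOne.{u} ∧
      FirstOrder.Language.IsFraisse TwoColGraph.classTwoTwo.{u} ∧
      FirstOrder.Language.IsFraisse TwoColGraph.classInfTwo.{u} ∧
      FirstOrder.Language.IsFraisse TwoColGraph.classInfInf.{u}) ∧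
    ∀ G : TwoColGraph.{u}, G.IsBasicCUH →
      (TwoColGraph.Omitted TwoColGraph.D G ∨ TwoColGraph.Omitted TwoColGraph.D.crossCompl G) →
      ¬ G.IsJenkinsonBipartite →
      ∃ G' : TwoColGraph.{u}, (G' = G ∨ G' = G.swap) ∧
        (∀ k : ℕ, G'.alpha .red = k →
          G'.IsLimitOf (TwoColGraph.classInfOneFin k) ∨
          G'.IsLimitOf (TwoColGraph.classInfTwoFin k)) ∧
        (G'.alpha .red = ⊤ →
          G'.IsLimitOf TwoColGraph.classTwoOne ∨
          G'.IsLimitOf TwoColGraph.classInfOne ∨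
          G'.IsLimitOf TwoColGraph.classTwoTwo ∨
          G'.IsLimitOf TwoColGraph.classInfTwo ∨
          G'.IsLimitOf TwoColGraph.classInfInf) := by
  constructor
  · rw [TwoColGraph.classTwoOne_eq, TwoColGraph.classInfOne_eq, TwoColGraph.classTwoTwo_eq,
      TwoColGraph.classInfTwo_eq, TwoColGraph.classInfInf_eq]
    refine ⟨fun k _ => ?_, ?_⟩
    · rw [TwoColGraph.classInfOneFin_eq, TwoColGraph.classInfTwoFin_eq]
      exact ⟨TwoColGraph.finClass_isFraisse (TwoColGraph.admissible_many (by simp) k),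
        TwoColGraph.finClass_isFraisse (TwoColGraph.admissible_many (by simp) k)⟩
    · refine ⟨?_, ?_, ?_, ?_, ?_⟩ <;>
        exact TwoColGraph.finClass_isFraisse (TwoColGraph.admissible_top _ _)
  · intro G hG hD hJ
    have hred := hG.isReduced
    have hpar := hred.crossParity_of_omitted hD
    have he : ∃ c, G.HasEdge c := by
      by_contra! he
      exact hJ (hred.isJenkinsonBipartite hG.countable he)
    obtain ⟨c, hc, hm, ht⟩ := hred.exists_color hpar he
    cases c with
    | red => exact ⟨G, Or.inl rfl, hred.isLimitOf_classes hpar hG.countable hc hm ht⟩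
    | blue =>
      refine ⟨G.swap, Or.inr rfl, hred.swap.isLimitOf_classes hpar.swap hG.countable ?_ ?_ ?_⟩
      · exact TwoColGraph.swap_hasEdge.2 hc
      · exact TwoColGraph.swap_manyCliques.2 hm
      · rw [TwoColGraph.swap_hasTriangle, TwoColGraph.swap_hasTriangle]
        exact ht
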